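/- Let $q\colon(0,\infty)\to\mathbb R$ satisfy $q\in L^1_{\mathrm{loc}}((0,\infty))$ and $$\int_0^1 x(1-\log x)\,|q(x)|\,dx<\infty,\qquad \int_1^\infty x\log(1+x)\,|q(x)|\,dx<\infty .$$ Let $\tau=-\frac{d^2}{dx^2}-\frac1{4x^2}+q(x)$ on $(0,\infty)$. Solutions $u$ of $\tau u=zu$ are understood in the sense that $u$ is differentiable, $u'$ is locally absolutely continuous on $(0,\infty)$, and the equation holds almost everywhere. For $z\in\mathbb C$ let $\phi(z,\cdot)$ be the solution of $\tau u=zu$ of the form $\phi(z,x)=\sqrt{\pi x/2}\;\tilde\phi(z,x)$, $0<x\le1$, with $\tilde\phi(z,\cdot)$ absolutely continuous on $[0,1]$ and $\tilde\phi(z,0)=1$. For $k\neq0$ with $\operatorname{Im}k\ge0$ let $f(k,\cdot)$ be the solution of $\tau u=k^2u$ with $$f(k,x)=e^{ikx}(1+o(1)),\qquad f'(k,x)=ik\,e^{ikx}(1+o(1)),\qquad x\to\infty .$$ Put $W(u,v)=uv'-u'v$ (constant in $x$ when $u,v$ solve the same equation $\tau u=zu$) and $$F(k)=e^{i\pi/4}\,k^{-1/2}\,W\big(f(k,\cdot),\phi(k^2,\cdot)\big),\qquad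 \operatorname{Im}k\ge0,\ k\ne0,$$ where $k^{-1/2}$ is taken with $\arg k\in[0,\pi]$. Then the solutions $\phi(z,\cdot)$ ($z\in\mathbb C$) and $f(k,\cdot)$ ($\operatorname{Im}k\ge0$, $k\neq0$) exist, $F$ is (complex) differentiable, relative to the closed upper half-plane, at every $k\ne0$ with $\operatorname{Im}k\ge 0$ (in particular, $F$ is differentiable on $\mathbb R\setminus\{0\}$), and there is a constant $C$, which may depend on $q$ but not on $k$, such that $$|F'(k)|\le\frac{C}{|k|},\qquad \operatorname{Im}k\ge0,\ k\neq0 .$$ -/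

import Mathlib

open Filter Topology MeasureTheory Set

noncomputable section

/-- `u` solves `-u'' - u / (4 x^2) + q u = z u` on `(0, ∞)` in the Carathéodory sense:
`u` is differentiable, `u'` is locally absolutely continuous, and the equation holds
almost everywhere. -/
structure IsSolution (q : ℝ → ℝ) (z : ℂ) (u : ℝ → ℂ) : Prop where
  differentiableAt : ∀ x : ℝ, 0 < x → DifferentiableAt ℝ u x
  absolutelyContinuous : ∀ a b : ℝ, 0 < a → a ≤ b →
    AbsolutelyContinuousOnInterval (deriv u) a b
  equation : ∀ᵐ x : ℝ, 0 < x →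
    HasDerivAt (deriv u) (-(1 / (4 * (x : ℂ) ^ 2)) * u x + (q x : ℂ) * u x - z * u x) x

/-- The regular solution `φ(z, ·)`: `φ(z, x) = √(π x / 2) v(x)` on `(0, 1]`, where `v` is
absolutely continuous on `[0, 1]` (that is, `v ∈ W^{1,1}[0,1]`) and `v(0) = 1`. These
properties determine `φ(z, ·)` on `(0, ∞)`. -/
structure IsRegularSolution (q : ℝ → ℝ) (z : ℂ) (u : ℝ → ℂ) : Prop where
  isSolution : IsSolution q z u
  regular : ∃ v : ℝ → ℂ, AbsolutelyContinuousOnInterval v 0 1 ∧ v 0 = 1 ∧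
    ∀ x : ℝ, 0 < x → x ≤ 1 → u x = (Real.sqrt (Real.pi * x / 2) : ℂ) * v x

/-- The Jost solution `f(k, ·)`: a solution at energy `k^2` with
`f(k, x) = e^{ikx} (1 + o(1))` and `f'(k, x) = i k e^{ikx} (1 + o(1))` as `x → ∞`.
For `k ≠ 0` with `0 ≤ Im k` these properties determine `f(k, ·)` on `(0, ∞)`. -/
structure IsJostSolution (q : ℝ → ℝ) (k : ℂ) (u : ℝ → ℂ) : Prop where
  isSolution : IsSolution q (k ^ 2) u
  tendsto : Tendsto (fun x : ℝ => u x / Complex.exp (Complex.I * k * x)) atTop (𝓝 1)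
  tendsto_deriv : Tendsto
    (fun x : ℝ => deriv u x / (Complex.I * k * Complex.exp (Complex.I * k * x))) atTop (𝓝 1)

open scoped Classical in
/-- `φ(z, ·)`, with the value `0` if there is no regular solution. -/
def regularSolution (q : ℝ → ℝ) (z : ℂ) : ℝ → ℂ :=
  if h : ∃ u, IsRegularSolution q z u then h.choose else 0

open scoped Classical in
/-- `f(k, ·)`, with the value `0` if there is no Jost solution. -/
def jostSolution (q : ℝ → ℝ) (k : ℂ) : ℝ → ℂ :=
  if h : ∃ u, IsJostSolution q k u then h.choose else 0

/-- The Wronskian `W(u, v)(x) = u(x) v'(x) - u'(x) v(x)`. -/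
def wronskianAt (u v : ℝ → ℂ) (x : ℝ) : ℂ := u x * deriv v x - deriv u x * v x

/-- The Jost function `f(k) = W(f(k, ·), φ(k^2, ·))`. Both functions solve the same equation,
so their Wronskian does not depend on the point; it is evaluated at `x = 1`. -/
def jostFunction (q : ℝ → ℝ) (k : ℂ) : ℂ :=
  wronskianAt (jostSolution q k) (regularSolution q (k ^ 2)) 1

/-- `F(k) = e^{iπ/4} k^{-1/2} f(k)` for `k ≠ 0` with `0 ≤ Im k`; here `k^{-1/2}` is taken with
`arg k ∈ [0, π]`. -/
def jostF (q : ℝ → ℝ) (k : ℂ) : ℂ :=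
  Complex.exp (Complex.I * (Real.pi / 4)) * k ^ (-(1 / 2) : ℂ) * jostFunction q k

end

/-! Put `κ = -ik`, so that `Re κ ≥ 0` and `k² = -κ²`. Let `ψ(s) = √(2/π) K₀(s)`, with `K₀` the
Macdonald function. For `q = 0` the Jost solution is `G(κ,x) = κ^{1/2} √x ψ(κx)`; it has no zeros,
so write `f = G m` and `φ = √(πx/2) v`. The factor `κ^{-1/2}` in `F` removes the branch. Since the
Wronskian is constant, for every `x > 0` `F = √(π/2) (m · W - x m' ψ(κx) v)`, where `W = ψ(κx) x v'
- κx ψ'(κx) v`. Here `W` pairs the free Jost solution with the full regular solution (`redF`,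
`freeW`, `cpow_mul_wronskianAt_eq`).

It suffices to show that `F` is differentiable and that near each `κ₀` it satisfies `|F(κ) - F(κ₀)|
≤ C |κ - κ₀| / |κ₀|`. The point of evaluation is frozen at the natural scale `a = 1/|κ₀|` while `κ`
runs through a half-disc around `κ₀`; there `|κy|` is bounded for `y ≤ a` and bounded below for `y ≥
a`.

Outer region `y ≥ a`. The quotient `m` solves `m = 1 + ∫ₓ^∞ D(x,y) q(y) m(y) dy` with `D(x,y) = ∫ₓ^y
(G(y)/G(t))² dt`. Differentiating under the integral in `D` gives only `∂D/∂κ = O(y²)`, which is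
useless against `q`. Homogeneity of `G` in `κx` (`integral_jE_deriv`) together with `D = O(1/|κ|)`
(`norm_jD_le_div`) improves this to `O(y/|κ|)`. Hence `m` and `a m'` at `a` are Lipschitz in `κ`
with constant `C ε/|κ₀|`, where `ε = ∫ₐ^∞ y|q|`.

Inner region `y ≤ a`. One has `|v(y)| ≤ C (1 + log⁺ y)` uniformly (`norm_regV_le`). The derivative
of `W` in `x` is `x q ψ v`, and `W(κ,x) - W(κ₀,x) → 0` as `x → 0`, so `W(κ,a) - W(κ₀,a) = ∫₀^a y q
(ψv - ψ₀v₀) dy`. Since `∂ψ(κy)/∂κ = (sψ'(s))/κ` at `s = κy`, with `sψ'` bounded near `0`, the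
integrand is at most `C y (1 + log⁺ y) |q(y)| |κ - κ₀| / |κ₀|` (`norm_freeW_sub_le`).

In the product the growth `1 + log⁺ a` of `v` and `W` is always multiplied by the tail `ε`, and `ε
(1 + log⁺ a)` is bounded by the norm `∫ x(1 + |log x|)|q|` (`qTail_mul_logWeight_le`). This is where
the logarithmic moment at infinity enters for small `κ`.

Both Volterra equations are solved by inverting `1 - T` on bounded continuous functions after
conjugation with an exponential weight. Differentiability in the parameter is that of `T` in
operator norm followed by inversion. Because `φ` and `f` in the statement are arbitrary choices, it
is also shown that replacing either by the constructed solution does not change the Wronskian. -/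

open scoped BoundedContinuousFunction

/-! ### Complex-valued absolutely continuous functions -/

theorem AbsolutelyContinuousOnInterval.congr {X : Type*} [PseudoMetricSpace X] {f g : ℝ → X}
    {a b : ℝ} (hf : AbsolutelyContinuousOnInterval f a b) (h : EqOn f g (uIcc a b)) :
    AbsolutelyContinuousOnInterval g a b := by
  rw [absolutelyContinuousOnInterval_iff] at hf ⊢
  intro ε hε
  obtain ⟨δ, hδ, H⟩ := hf ε hε
  refine ⟨δ, hδ, fun E hE hlt => ?_⟩
  have := H E hE hlt
  refine lt_of_eq_of_lt (Finset.sum_congr rfl fun i hi => ?_) this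
  rw [h (hE.1 i hi).1, h (hE.1 i hi).2]

theorem AbsolutelyContinuousOnInterval.of_re_im {f : ℝ → ℂ} {a b : ℝ}
    (hr : AbsolutelyContinuousOnInterval (fun x => (f x).re) a b)
    (hi : AbsolutelyContinuousOnInterval (fun x => (f x).im) a b) :
    AbsolutelyContinuousOnInterval f a b := by
  refine squeeze_zero (fun E => Finset.sum_nonneg fun i _ => dist_nonneg) (fun E => ?_)
    (by simpa using Tendsto.add hr hi)
  rw [← Finset.sum_add_distrib]
  refine Finset.sum_le_sum fun i _ => ?_
  rw [Complex.dist_eq, Real.dist_eq, Real.dist_eq, ← Complex.sub_re, ← Complex.sub_im]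
  exact Complex.norm_le_abs_re_add_abs_im _

theorem absolutelyContinuousOnInterval_integral {f : ℝ → ℂ} {a b c : ℝ}
    (h : IntervalIntegrable f volume a b) (hc : c ∈ uIcc a b) :
    AbsolutelyContinuousOnInterval (fun x => ∫ v in c..x, f v) a b := by
  have hsub : ∀ x ∈ uIcc a b, IntervalIntegrable f volume c x := fun x hx =>
    h.mono_set (uIcc_subset_uIcc hc hx)
  have hr : IntervalIntegrable (fun x => (f x).re) volume a b := ⟨h.1.re, h.2.re⟩
  have hi : IntervalIntegrable (fun x => (f x).im) volume a b := ⟨h.1.im, h.2.im⟩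
  refine .of_re_im ((hr.absolutelyContinuousOnInterval_intervalIntegral hc).congr fun x hx => ?_)
    ((hi.absolutelyContinuousOnInterval_intervalIntegral hc).congr fun x hx => ?_)
  · exact Complex.reCLM.intervalIntegral_comp_comm (hsub x hx)
  · exact Complex.imCLM.intervalIntegral_comp_comm (hsub x hx)

/-- The difference of `f` and the primitive of `g` is absolutely continuous with derivative zero
almost everywhere, hence constant. -/
theorem AbsolutelyContinuousOnInterval.sub_eq_integral {f g : ℝ → ℂ} {a b : ℝ}
    (hf : AbsolutelyContinuousOnInterval f a b) (hg : IntervalIntegrable g volume a b)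
    (h : ∀ᵐ x, x ∈ uIcc a b → HasDerivAt f (g x) x) :
    f b - f a = ∫ x in a..b, g x := by
  have hG := absolutelyContinuousOnInterval_integral hg (left_mem_uIcc (a := a) (b := b))
  obtain ⟨C, hC⟩ := (hf.sub hG).const_of_ae_hasDerivAt_zero (by
    filter_upwards [h, hg.ae_hasDerivAt_integral] with x h1 h2 hx
    simpa using (h1 hx).sub (h2 hx a left_mem_uIcc))
  have h1 := hC a left_mem_uIcc
  have h2 := hC b right_mem_uIcc
  simp only [Pi.sub_apply, intervalIntegral.integral_same, sub_zero] at h1 h2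
  rw [h1, ← h2]; ring

theorem AbsolutelyContinuousOnInterval.of_hasDerivAt {f f' : ℝ → ℂ} {a b : ℝ}
    (hf : ∀ x ∈ uIcc a b, HasDerivAt f (f' x) x) (hc : ContinuousOn f' (uIcc a b)) :
    AbsolutelyContinuousOnInterval f a b := by
  obtain ⟨C, hC⟩ := isCompact_uIcc.exists_bound_of_continuousOn hc
  have : LipschitzOnWith (Real.toNNReal C) f (uIcc a b) := by
    refine Convex.lipschitzOnWith_of_nnnorm_hasDerivWithin_le (convex_uIcc a b)
      (fun x hx => (hf x hx).hasDerivWithinAt) fun x hx => ?_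
    rw [← NNReal.coe_le_coe, coe_nnnorm]
    exact (hC x hx).trans (Real.le_coe_toNNReal C)
  exact this.absolutelyContinuousOnInterval

theorem absolutelyContinuousOnInterval_const {X : Type*} [PseudoMetricSpace X] (c : X) (a b : ℝ) :
    AbsolutelyContinuousOnInterval (fun _ : ℝ => c) a b :=
  ((LipschitzWith.const c).lipschitzOnWith (s := uIcc a b)).absolutelyContinuousOnInterval

theorem AbsolutelyContinuousOnInterval.cmul {f g : ℝ → ℂ} {a b : ℝ}
    (hf : AbsolutelyContinuousOnInterval f a b) (hg : AbsolutelyContinuousOnInterval g a b) :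
    AbsolutelyContinuousOnInterval (fun x => f x * g x) a b :=
  hf.smul hg

theorem uIcc_subset_Ioi {a b c : ℝ} (ha : c < a) (hb : c < b) : uIcc a b ⊆ Ioi c :=
  fun _ hx => lt_of_lt_of_le (lt_min ha hb) hx.1

/-! ### Carathéodory solutions and constancy of the Wronskian -/

namespace IsSolution
variable {q : ℝ → ℝ} {z : ℂ} {u v : ℝ → ℂ}

theorem of_hasDerivAt {u₁ : ℝ → ℂ} (h : ∀ x, 0 < x → HasDerivAt u (u₁ x) x)
    (hac : ∀ a b, 0 < a → a ≤ b → AbsolutelyContinuousOnInterval u₁ a b)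
    (heq : ∀ᵐ x : ℝ, 0 < x →
      HasDerivAt u₁ (-(1 / (4 * (x : ℂ) ^ 2)) * u x + (q x : ℂ) * u x - z * u x) x) :
    IsSolution q z u where
  differentiableAt x hx := (h x hx).differentiableAt
  absolutelyContinuous a b ha hab := (hac a b ha hab).congr fun x hx =>
    ((h x (uIcc_subset_Ioi ha (ha.trans_le hab) hx)).deriv).symm
  equation := by
    filter_upwards [heq] with x hx h0
    refine (hx h0).congr_of_eventuallyEq ?_
    filter_upwards [Ioi_mem_nhds h0] with y hy using (h y hy).deriv

theorem absolutelyContinuous_deriv (hu : IsSolution q z u) {a b : ℝ} (ha : 0 < a) (hb : 0 < b) :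
    AbsolutelyContinuousOnInterval (deriv u) a b := by
  rcases le_total a b with h | h
  · exact hu.absolutelyContinuous a b ha h
  · exact (hu.absolutelyContinuous b a hb h).symm

theorem absolutelyContinuous_self (hu : IsSolution q z u) {a b : ℝ} (ha : 0 < a) (hb : 0 < b) :
    AbsolutelyContinuousOnInterval u a b :=
  .of_hasDerivAt (fun x hx => (hu.differentiableAt x (uIcc_subset_Ioi ha hb hx)).hasDerivAt)
    (hu.absolutelyContinuous_deriv ha hb).continuousOn

theorem sub (hu : IsSolution q z u) (hv : IsSolution q z v) : IsSolution q z (fun x => u x - v x) := by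
  refine of_hasDerivAt (u₁ := fun x => deriv u x - deriv v x)
    (fun x hx => (hu.differentiableAt x hx).hasDerivAt.sub (hv.differentiableAt x hx).hasDerivAt)
    (fun a b ha hab => (hu.absolutelyContinuous a b ha hab).sub
      (hv.absolutelyContinuous a b ha hab)) ?_
  filter_upwards [hu.equation, hv.equation] with x h1 h2 hx
  refine ((h1 hx).sub (h2 hx)).congr_deriv ?_
  ring

theorem wronskianAt_eq (hu : IsSolution q z u) (hv : IsSolution q z v) {x y : ℝ} (hx : 0 < x)
    (hy : 0 < y) : wronskianAt u v x = wronskianAt u v y := by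
  have hac : AbsolutelyContinuousOnInterval (wronskianAt u v) x y :=
    ((hu.absolutelyContinuous_self hx hy).cmul (hv.absolutelyContinuous_deriv hx hy)).sub
      ((hu.absolutelyContinuous_deriv hx hy).cmul (hv.absolutelyContinuous_self hx hy))
  obtain ⟨C, hC⟩ := hac.const_of_ae_hasDerivAt_zero (by
    filter_upwards [hu.equation, hv.equation] with t h1 h2 ht
    have ht0 : 0 < t := uIcc_subset_Ioi hx hy ht
    have := (((hu.differentiableAt t ht0).hasDerivAt.mul (h2 ht0))).sub
      ((h1 ht0).mul (hv.differentiableAt t ht0).hasDerivAt)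
    refine HasDerivAt.congr_deriv this ?_
    ring)
  rw [hC x left_mem_uIcc, hC y right_mem_uIcc]

end IsSolution

/-! ### Differentiating Volterra integrals; exponential weights -/

/-- Differentiation of `∫ (B x - B y) n y dy`, written through primitives `N` of `n` and
`N₂` of `B n`. -/
theorem hasDerivAt_mul_primitive_sub {B B' n N N₂ : ℝ → ℂ} {x : ℝ} {U : Set ℝ} (hU : IsOpen U)
    (hconv : Convex ℝ U) (hx : x ∈ U)
    (hB : ∀ t ∈ U, HasDerivAt B (B' t) t) (hB' : ContinuousOn B' U)
    (hn : ∀ s ∈ U, ∀ t ∈ U, IntervalIntegrable n volume s t)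
    (hN : ∀ s ∈ U, ∀ t ∈ U, N t - N s = ∫ y in s..t, n y)
    (hN₂ : ∀ s ∈ U, ∀ t ∈ U, N₂ t - N₂ s = ∫ y in s..t, B y * n y) :
    HasDerivAt (fun t => B t * N t - N₂ t) (B' x * N x) x := by
  obtain ⟨ε, hε, hball⟩ := Metric.isOpen_iff.1 hU x hx
  have hBc : ContinuousOn B U := fun t ht => (hB t ht).continuousAt.continuousWithinAt
  obtain ⟨L, hL⟩ := (isCompact_closedBall x (ε / 2)).exists_bound_of_continuousOn
    (hB'.mono ((Metric.closedBall_subset_ball (half_lt_self hε)).trans hball))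
  have hLip : ∀ s ∈ Metric.closedBall x (ε / 2), ∀ t ∈ Metric.closedBall x (ε / 2),
      ‖B t - B s‖ ≤ L * ‖t - s‖ := fun s hs t ht =>
    Convex.norm_image_sub_le_of_norm_hasDerivWithin_le
      (fun y hy => (hB y (hball (Metric.closedBall_subset_ball (half_lt_self hε) hy))).hasDerivWithinAt)
      hL (convex_closedBall _ _) hs ht
  have hL0 : 0 ≤ L := (norm_nonneg _).trans (hL x (Metric.mem_closedBall_self (by positivity)))
  -- Since `n` is only integrable, `N` and `N₂` need not be differentiable at `x`. The increment is
  -- a term linear in `B t - B x` plus a remainder of size `O(|t - x|)` times `∫ₓᵗ |n| = o(1)`, so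
  -- the derivative exists at every point.
  have key : ∀ t ∈ U, B t * N t - N₂ t - (B x * N x - N₂ x)
      = (B t - B x) * N x + ∫ y in x..t, (B t - B y) * n y := by
    intro t ht
    have hsub : uIcc x t ⊆ U := hconv.ordConnected.uIcc_subset hx ht
    have h1 : IntervalIntegrable (fun y => B y * n y) volume x t :=
      (hn x hx t ht).continuousOn_mul (hBc.mono hsub)
    have : ∫ y in x..t, (B t - B y) * n y = B t * (N t - N x) - (N₂ t - N₂ x) := by
      rw [hN x hx t ht, hN₂ x hx t ht, ← intervalIntegral.integral_const_mul,
        ← intervalIntegral.integral_sub ((hn x hx t ht).const_mul _) h1]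
      congr 1; ext y; ring
    rw [this]; ring
  have hprim : Tendsto (fun t => ∫ y in x..t, ‖n y‖) (𝓝 x) (𝓝 0) := by
    have hc : ContinuousOn (fun t => ∫ y in x..t, ‖n y‖)
        (uIcc (x - ε / 2) (x + ε / 2)) := by
      refine intervalIntegral.continuousOn_primitive_interval' (a := x) (hn _ (hball ?_) _ (hball ?_)).norm ?_
      · simpa [abs_of_pos hε] using hε
      · simpa [abs_of_pos hε] using hε
      · rw [uIcc_of_le (by linarith)]; constructor <;> linarith
    have := (hc.continuousAt (x := x) (by
      rw [uIcc_of_le (by linarith)]; exact Icc_mem_nhds (by linarith) (by linarith))).tendsto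
    simpa using this
  have hrem : HasDerivAt (fun t => ∫ y in x..t, (B t - B y) * n y) 0 x := by
    rw [hasDerivAt_iff_isLittleO]
    simp only [intervalIntegral.integral_same, smul_zero, sub_zero]
    rw [Asymptotics.isLittleO_iff]
    intro c hc
    have h0 := hprim.const_mul L
    rw [mul_zero] at h0
    filter_upwards [(Metric.tendsto_nhds.1 h0) c hc, Metric.closedBall_mem_nhds x (half_pos hε)]
      with t h1 h2
    have hsub : uIcc x t ⊆ Metric.closedBall x (ε / 2) :=
      (convex_closedBall x (ε / 2)).ordConnected.uIcc_subset
        (Metric.mem_closedBall_self (by positivity)) h2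
    have hx' := hball (Metric.closedBall_subset_ball (half_lt_self hε) h2)
    have hle : ‖∫ y in x..t, (B t - B y) * n y‖ ≤ |∫ y in x..t, (L * ‖t - x‖) * ‖n y‖| := by
      refine intervalIntegral.norm_integral_le_abs_of_norm_le ?_ ((hn x hx t hx').norm.const_mul _)
      refine (ae_restrict_iff' measurableSet_uIoc).2 (.of_forall fun y hy => ?_)
      rw [norm_mul]
      refine mul_le_mul_of_nonneg_right ?_ (norm_nonneg _)
      refine (hLip y (hsub (uIoc_subset_uIcc hy)) t h2).trans ?_
      refine mul_le_mul_of_nonneg_left ?_ hL0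
      rw [Real.norm_eq_abs, Real.norm_eq_abs]
      exact abs_sub_right_of_mem_uIcc (uIoc_subset_uIcc hy)
    refine hle.trans ?_
    rw [intervalIntegral.integral_const_mul, abs_mul, abs_of_nonneg (by positivity)]
    rw [Real.dist_eq, sub_zero, abs_mul, abs_of_nonneg hL0] at h1
    calc L * ‖t - x‖ * |∫ y in x..t, ‖n y‖| = (L * |∫ y in x..t, ‖n y‖|) * ‖t - x‖ := by ring
      _ ≤ c * ‖t - x‖ := mul_le_mul_of_nonneg_right h1.le (norm_nonneg _)
  have hfin := (((hB x hx).sub_const (B x)).mul_const (N x)).add hrem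
  rw [add_zero] at hfin
  have := hfin.add_const (B x * N x - N₂ x)
  refine this.congr_of_eventuallyEq ?_
  filter_upwards [hU.mem_nhds hx] with t ht
  have := key t ht
  simp only [Pi.add_apply]
  linear_combination this

/-- With `R` the primitive of `ρ`, the integrand is half the derivative of `exp (2R)`; integrate
from `a` to `x`, drop the positive term at `a` and let `a → -∞`. The factor `1/2` later makes the
weighted Volterra operator a contraction, whatever the size of `ρ`. -/
theorem setIntegral_Iio_mul_exp_le {ρ : ℝ → ℝ} (hρ : Integrable ρ) (h0 : ∀ x, 0 ≤ ρ x) (x : ℝ) :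
    ∫ y in Iio x, ρ y * Real.exp (2 * ∫ t in Iio y, ρ t) ≤ Real.exp (2 * ∫ t in Iio x, ρ t) / 2 := by
  set R : ℝ → ℝ := fun y => ∫ t in Iio y, ρ t with hR
  have hRsub : ∀ a b, R b - R a = ∫ t in a..b, ρ t := fun a b => by
    simp only [hR, ← integral_Iic_eq_integral_Iio]
    exact intervalIntegral.integral_Iic_sub_Iic hρ.integrableOn hρ.integrableOn
  have hR0 : ∀ y, 0 ≤ R y := fun y => integral_nonneg h0
  have hRM : ∀ y, R y ≤ ∫ t, ρ t := fun y => setIntegral_le_integral hρ (.of_forall h0)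
  have hRc : Continuous R := by
    have : R = fun b => R 0 + ∫ t in (0 : ℝ)..b, ρ t := by ext b; rw [← hRsub]; ring
    rw [this]
    exact continuous_const.add (intervalIntegral.continuous_primitive (fun a b => hρ.intervalIntegrable) 0)
  have hint : Integrable (fun y => ρ y * Real.exp (2 * R y)) := by
    refine (hρ.mul_const (Real.exp (2 * ∫ t, ρ t))).mono'
      (hρ.aestronglyMeasurable.mul (by fun_prop)) (.of_forall fun y => ?_)
    rw [Real.norm_eq_abs, abs_of_nonneg (mul_nonneg (h0 y) (Real.exp_pos _).le)]
    exact mul_le_mul_of_nonneg_left (Real.exp_le_exp.2 (by linarith [hRM y])) (h0 y)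
  rw [← integral_Iic_eq_integral_Iio]
  refine le_of_tendsto (intervalIntegral_tendsto_integral_Iic x hint.integrableOn tendsto_id)
    ((eventually_le_atBot x).mono fun a ha => ?_)
  have hac : AbsolutelyContinuousOnInterval R a x := by
    refine ((hρ.intervalIntegrable.absolutelyContinuousOnInterval_intervalIntegral
      (left_mem_uIcc (a := a) (b := x))).add (absolutelyContinuousOnInterval_const (R a) a x)).congr
      fun y _ => ?_
    simp [← hRsub]
  -- The values of `R` lie in `[0, ∫ ρ]`, where `s ↦ exp (2s)` is Lipschitz, so the composition
  -- remains absolutely continuous.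
  have hexp : AbsolutelyContinuousOnInterval (fun y => (Real.exp (2 * R y) : ℂ)) a x := by
    have hlip : LipschitzOnWith (Real.toNNReal (2 * Real.exp (2 * ∫ t, ρ t)))
        (fun s : ℝ => (Real.exp (2 * s) : ℂ)) (Icc 0 (∫ t, ρ t)) := by
      refine Convex.lipschitzOnWith_of_nnnorm_hasDerivWithin_le
        (f' := fun s => ((Real.exp (2 * s) * 2 : ℝ) : ℂ)) (convex_Icc _ _)
        (fun s _ => HasDerivAt.hasDerivWithinAt ?_) fun s hs => ?_
      · exact (((hasDerivAt_id s).const_mul 2).exp.congr_deriv (by simp)).ofReal_comp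
      · rw [← NNReal.coe_le_coe, coe_nnnorm, Real.coe_toNNReal _ (by positivity), Complex.norm_real,
          Real.norm_eq_abs, abs_of_pos (by positivity), mul_comm]
        exact mul_le_mul_of_nonneg_left (Real.exp_le_exp.2 (by linarith [hs.2])) (by norm_num)
    set K := Real.toNNReal (2 * Real.exp (2 * ∫ t, ρ t))
    refine squeeze_zero (fun E => Finset.sum_nonneg fun i _ => dist_nonneg) (fun E => ?_)
      (by simpa using Tendsto.const_mul (K : ℝ) hac)
    rw [Finset.mul_sum]
    exact Finset.sum_le_sum fun i _ => hlip.dist_le_mul _ ⟨hR0 _, hRM _⟩ _ ⟨hR0 _, hRM _⟩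
  have hder : ∀ᵐ y, y ∈ uIcc a x → HasDerivAt (fun y => (Real.exp (2 * R y) : ℂ))
      ((2 * (ρ y * Real.exp (2 * R y)) : ℝ) : ℂ) y := by
    filter_upwards [LocallyIntegrable.ae_hasDerivAt_integral hρ.locallyIntegrable] with y hy _
    have h1 : HasDerivAt R (ρ y) y := by
      have := (hy 0).add_const (R 0)
      refine this.congr_of_eventuallyEq (.of_forall fun b => ?_)
      simp [← hRsub]
    exact ((h1.const_mul 2).exp.congr_deriv (by ring)).ofReal_comp
  have := hexp.sub_eq_integral (g := fun y => ((2 * (ρ y * Real.exp (2 * R y)) : ℝ) : ℂ))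
    ((hint.const_mul 2).ofReal.intervalIntegrable) hder
  rw [intervalIntegral.integral_ofReal, intervalIntegral.integral_const_mul, ← Complex.ofReal_sub] at this
  have h2 := Complex.ofReal_injective this
  simp only [id]
  have := Real.exp_pos (2 * R a)
  linarith

theorem setIntegral_Ioi_mul_exp_le {ρ : ℝ → ℝ} (hρ : Integrable ρ) (h0 : ∀ x, 0 ≤ ρ x) (x : ℝ) :
    ∫ y in Ioi x, ρ y * Real.exp (2 * ∫ t in Ioi y, ρ t) ≤ Real.exp (2 * ∫ t in Ioi x, ρ t) / 2 := by
  have := setIntegral_Iio_mul_exp_le (ρ := fun y => ρ (-y)) hρ.comp_neg (fun y => h0 _) (-x)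
  have hR : ∀ y, ∫ t in Iio y, ρ (-t) = ∫ t in Ioi (-y), ρ t := fun y => by
    rw [← integral_Iic_eq_integral_Iio, integral_comp_neg_Iic]
  simp only [hR, neg_neg] at this
  rw [← integral_Iic_eq_integral_Iio,
    integral_comp_neg_Iic (f := fun y => ρ y * Real.exp (2 * ∫ t in Ioi y, ρ t)), neg_neg] at this
  exact this

/-! ### Volterra operators on bounded continuous functions -/

/-- A kernel on `ℝ × ℝ`, continuous in its first variable, with an integrable majorant. -/
structure IsKernel (K : ℝ → ℝ → ℂ) (ρ : ℝ → ℝ) : Prop where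
  aestronglyMeasurable : ∀ x, AEStronglyMeasurable (K x)
  continuous : ∀ y, Continuous fun x => K x y
  bound : ∀ x y, ‖K x y‖ ≤ ρ y
  integrable : Integrable ρ

namespace IsKernel
variable {K : ℝ → ℝ → ℂ} {ρ : ℝ → ℝ}

theorem nonneg (h : IsKernel K ρ) (y : ℝ) : 0 ≤ ρ y := (norm_nonneg _).trans (h.bound 0 y)

theorem integrable_mul (h : IsKernel K ρ) (u : ℝ →ᵇ ℂ) (x : ℝ) :
    Integrable fun y => K x y * u y := by
  refine (h.integrable.mul_const ‖u‖).mono'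
    ((h.aestronglyMeasurable x).mul u.continuous.aestronglyMeasurable) (.of_forall fun y => ?_)
  rw [norm_mul]
  exact mul_le_mul (h.bound x y) (u.norm_coe_le_norm y) (norm_nonneg _) (h.nonneg y)

theorem norm_integral_mul_le (h : IsKernel K ρ) (u : ℝ →ᵇ ℂ) (x : ℝ) :
    ‖∫ y, K x y * u y‖ ≤ (∫ y, ρ y) * ‖u‖ := by
  rw [← integral_mul_const]
  refine norm_integral_le_of_norm_le (h.integrable.mul_const ‖u‖) (.of_forall fun y => ?_)
  rw [norm_mul]
  exact mul_le_mul (h.bound x y) (u.norm_coe_le_norm y) (norm_nonneg _) (h.nonneg y)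

theorem continuous_integral_mul (h : IsKernel K ρ) (u : ℝ →ᵇ ℂ) :
    Continuous fun x => ∫ y, K x y * u y := by
  refine MeasureTheory.continuous_of_dominated (bound := fun y => ρ y * ‖u‖)
    (fun x => (h.integrable_mul u x).aestronglyMeasurable) (fun x => .of_forall fun y => ?_)
    (h.integrable.mul_const _) (.of_forall fun y => (h.continuous y).mul_const _)
  rw [norm_mul]
  exact mul_le_mul (h.bound x y) (u.norm_coe_le_norm y) (norm_nonneg _) (h.nonneg y)

end IsKernel

open scoped Classical in
/-- The integral operator with kernel `K` on bounded continuous functions. -/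
noncomputable def kernelOp (K : ℝ → ℝ → ℂ) : (ℝ →ᵇ ℂ) →L[ℂ] (ℝ →ᵇ ℂ) :=
  if h : ∃ ρ, IsKernel K ρ then
    LinearMap.mkContinuous
      { toFun := fun u => BoundedContinuousFunction.ofNormedAddCommGroup
          (fun x => ∫ y, K x y * u y) (h.choose_spec.continuous_integral_mul u) _
          (h.choose_spec.norm_integral_mul_le u)
        map_add' := fun u v => by
          ext x
          simpa [mul_add] using integral_add (h.choose_spec.integrable_mul u x)
            (h.choose_spec.integrable_mul v x)
        map_smul' := fun c u => by
          ext x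
          simp [mul_left_comm _ c, integral_const_mul] }
      (∫ y, h.choose y) fun u => by
        refine (BoundedContinuousFunction.norm_le (mul_nonneg
          (integral_nonneg h.choose_spec.nonneg) (norm_nonneg _))).2 fun x => ?_
        exact h.choose_spec.norm_integral_mul_le u x
  else 0

theorem ContinuousLinearMap.norm_le_of_apply_eq_integral {A : (ℝ →ᵇ ℂ) →L[ℂ] (ℝ →ᵇ ℂ)}
    {k : ℝ → ℝ → ℂ} {σ : ℝ → ℝ} (hA : ∀ u x, A u x = ∫ y, k x y * u y)
    (hk : ∀ x y, ‖k x y‖ ≤ σ y) (hσ : Integrable σ) : ‖A‖ ≤ ∫ y, σ y := by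
  have h0 : ∀ y, 0 ≤ σ y := fun y => (norm_nonneg _).trans (hk 0 y)
  refine A.opNorm_le_bound (integral_nonneg h0) fun u => ?_
  refine (BoundedContinuousFunction.norm_le (mul_nonneg (integral_nonneg h0) (norm_nonneg _))).2
    fun x => ?_
  rw [hA, ← integral_mul_const]
  refine norm_integral_le_of_norm_le (hσ.mul_const ‖u‖) (.of_forall fun y => ?_)
  rw [norm_mul]
  exact mul_le_mul (hk x y) (u.norm_coe_le_norm y) (norm_nonneg _) (h0 y)

namespace IsKernel
variable {K K₁ K₂ : ℝ → ℝ → ℂ} {ρ ρ₁ ρ₂ : ℝ → ℝ}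

theorem kernelOp_apply (h : IsKernel K ρ) (u : ℝ →ᵇ ℂ) (x : ℝ) :
    kernelOp K u x = ∫ y, K x y * u y := by
  have : ∃ ρ, IsKernel K ρ := ⟨ρ, h⟩
  simp only [kernelOp, dif_pos this]
  rfl

theorem norm_kernelOp_sub_le (h₁ : IsKernel K₁ ρ₁) (h₂ : IsKernel K₂ ρ₂) {σ : ℝ → ℝ}
    (hσ : Integrable σ) (hk : ∀ x y, ‖K₁ x y - K₂ x y‖ ≤ σ y) :
    ‖kernelOp K₁ - kernelOp K₂‖ ≤ ∫ y, σ y := by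
  refine ContinuousLinearMap.norm_le_of_apply_eq_integral (k := fun x y => K₁ x y - K₂ x y)
    (fun u x => ?_) hk hσ
  change kernelOp K₁ u x - kernelOp K₂ u x = _
  rw [h₁.kernelOp_apply, h₂.kernelOp_apply, ← integral_sub (h₁.integrable_mul u x)
    (h₂.integrable_mul u x)]
  simp [sub_mul]

theorem norm_kernelOp_le (h : IsKernel K ρ) : ‖kernelOp K‖ ≤ ∫ y, ρ y :=
  ContinuousLinearMap.norm_le_of_apply_eq_integral (fun u x => h.kernelOp_apply u x) h.bound
    h.integrable

end IsKernel

theorem hasDerivWithinAt_of_norm_sub_le {F : Type*} [NormedAddCommGroup F] [NormedSpace ℂ F]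
    {f : ℂ → F} {f' : F} {S : Set ℂ} {κ₀ : ℂ}
    (h : ∀ c : ℝ, 0 < c → ∀ᶠ κ in 𝓝[S] κ₀, ‖f κ - f κ₀ - (κ - κ₀) • f'‖ ≤ c * ‖κ - κ₀‖) :
    HasDerivWithinAt f f' S κ₀ := by
  rw [hasDerivWithinAt_iff_isLittleO, Asymptotics.isLittleO_iff]
  exact fun c hc => h c hc

/-- The second-order bound `σ τ |κ - κ₀|²` may fail to be integrable, whereas the Lipschitz bound `σ
|κ - κ₀|` is integrable. Taking the minimum of the two, dominated convergence makes the remainder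
`o(|κ - κ₀|)` in operator norm. -/
theorem hasDerivWithinAt_kernelOp {K : ℂ → ℝ → ℝ → ℂ} {K' : ℝ → ℝ → ℂ} {ρ : ℂ → ℝ → ℝ}
    {ρ' σ τ : ℝ → ℝ} {S : Set ℂ} {κ₀ : ℂ} (h₀ : κ₀ ∈ S) (hK : ∀ κ ∈ S, IsKernel (K κ) (ρ κ))
    (hK' : IsKernel K' ρ') (hσ : Integrable σ) (hτ : AEStronglyMeasurable τ)
    (hσ0 : ∀ y, 0 ≤ σ y) (hτ0 : ∀ y, 0 ≤ τ y)
    (hb : ∀ κ ∈ S, ∀ x y, ‖K κ x y - K κ₀ x y - (κ - κ₀) * K' x y‖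
      ≤ ‖κ - κ₀‖ * (σ y * min 1 (τ y * ‖κ - κ₀‖))) :
    HasDerivWithinAt (fun κ => kernelOp (K κ)) (kernelOp K') S κ₀ := by
  refine hasDerivWithinAt_of_norm_sub_le (F := (ℝ →ᵇ ℂ) →L[ℂ] (ℝ →ᵇ ℂ)) ?_
  intro c hc
  have hmeas : ∀ κ : ℂ, AEStronglyMeasurable (fun y => σ y * min 1 (τ y * ‖κ - κ₀‖)) := fun κ =>
    hσ.aestronglyMeasurable.mul (aestronglyMeasurable_const.inf (hτ.mul_const _))
  have hdom : ∀ (κ : ℂ) y, ‖σ y * min 1 (τ y * ‖κ - κ₀‖)‖ ≤ σ y := fun κ y => by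
    have : 0 ≤ min 1 (τ y * ‖κ - κ₀‖) := le_min zero_le_one (mul_nonneg (hτ0 y) (norm_nonneg _))
    rw [Real.norm_eq_abs, abs_of_nonneg (mul_nonneg (hσ0 y) this)]
    exact mul_le_of_le_one_right (hσ0 y) (min_le_left _ _)
  have hint : ∀ κ : ℂ, Integrable (fun y => σ y * min 1 (τ y * ‖κ - κ₀‖)) := fun κ =>
    hσ.mono' (hmeas κ) (.of_forall (hdom κ))
  have hlim : Tendsto (fun κ : ℂ => ∫ y, σ y * min 1 (τ y * ‖κ - κ₀‖)) (𝓝[S] κ₀)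
      (𝓝 (∫ _ : ℝ, (0 : ℝ))) := by
    refine tendsto_integral_filter_of_dominated_convergence σ (.of_forall hmeas)
      (.of_forall fun κ => .of_forall (hdom κ)) hσ (.of_forall fun y => ?_)
    have hcont : Continuous fun κ : ℂ => σ y * min 1 (τ y * ‖κ - κ₀‖) := by fun_prop
    have := (hcont.tendsto κ₀).mono_left (nhdsWithin_le_nhds (s := S))
    simpa using this
  rw [integral_zero] at hlim
  filter_upwards [(Metric.tendsto_nhds.1 hlim) c hc, self_mem_nhdsWithin] with κ hκ hS
  have hle : ‖kernelOp (K κ) - kernelOp (K κ₀) - (κ - κ₀) • kernelOp K'‖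
      ≤ ∫ y, ‖κ - κ₀‖ * (σ y * min 1 (τ y * ‖κ - κ₀‖)) := by
    refine ContinuousLinearMap.norm_le_of_apply_eq_integral
      (k := fun x y => K κ x y - K κ₀ x y - (κ - κ₀) * K' x y)
      (fun u x => ?_) (hb κ hS) ((hint κ).const_mul _)
    change kernelOp (K κ) u x - kernelOp (K κ₀) u x - (κ - κ₀) * kernelOp K' u x = _
    have i₁ := (hK κ hS).integrable_mul u x
    have i₂ := (hK κ₀ h₀).integrable_mul u x
    have i₃ : Integrable fun y => K κ x y * u y - K κ₀ x y * u y := i₁.sub i₂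
    rw [(hK κ hS).kernelOp_apply, (hK κ₀ h₀).kernelOp_apply, hK'.kernelOp_apply,
      ← integral_const_mul, ← integral_sub i₁ i₂,
      ← integral_sub i₃ ((hK'.integrable_mul u x).const_mul _)]
    congr 1; ext y; ring
  refine hle.trans ?_
  rw [integral_const_mul, mul_comm]
  rw [Real.dist_eq, sub_zero] at hκ
  exact mul_le_mul_of_nonneg_right ((le_abs_self _).trans hκ.le) (norm_nonneg _)

/-- Conjugating `T` with multiplication by `ω` gives an operator of norm at most `1/2`, so the
Neumann series converges. Undoing the conjugation costs `sup ω · sup ω⁻¹ ≤ M`. -/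
theorem isUnit_one_sub_of_weight {T : (ℝ →ᵇ ℂ) →L[ℂ] (ℝ →ᵇ ℂ)} {ω : ℝ → ℝ} {M : ℝ}
    (hω : Continuous ω) (h1 : ∀ x, 1 ≤ ω x) (hM : ∀ x, ω x ≤ M)
    (hT : ∀ u v : ℝ →ᵇ ℂ, (∀ x, ‖u x‖ ≤ ω x * ‖v‖) → ∀ x, ‖T u x‖ ≤ ω x / 2 * ‖v‖) :
    IsUnit (1 - T) ∧ ‖Ring.inverse (1 - T)‖ ≤ 2 * M := by
  have hpos : ∀ x, 0 < ω x := fun x => zero_lt_one.trans_le (h1 x)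
  let w : ℝ →ᵇ ℂ := BoundedContinuousFunction.ofNormedAddCommGroup (fun x => (ω x : ℂ))
    (by fun_prop) M fun x => by
      rw [Complex.norm_real, Real.norm_eq_abs, abs_of_pos (hpos x)]; exact hM x
  let w' : ℝ →ᵇ ℂ := BoundedContinuousFunction.ofNormedAddCommGroup (fun x => ((ω x)⁻¹ : ℂ))
    (by
      have := hω.inv₀ fun x => (hpos x).ne'
      exact (Complex.continuous_ofReal.comp this).congr fun x => by simp) 1 fun x => by
      rw [norm_inv, Complex.norm_real, Real.norm_eq_abs, abs_of_pos (hpos x)]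
      exact inv_le_one_of_one_le₀ (h1 x)
  have hww : w * w' = 1 := by
    ext x
    exact mul_inv_cancel₀ (Complex.ofReal_ne_zero.2 (hpos x).ne')
  have hww' : w' * w = 1 := by rw [mul_comm]; exact hww
  let mw := ContinuousLinearMap.mul ℂ (ℝ →ᵇ ℂ)
  let U : ((ℝ →ᵇ ℂ) →L[ℂ] (ℝ →ᵇ ℂ))ˣ :=
    ⟨mw w, mw w', by ext1 u; change w * (w' * u) = u; rw [← mul_assoc, hww, one_mul],
      by ext1 u; change w' * (w * u) = u; rw [← mul_assoc, hww', one_mul]⟩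
  let S : (ℝ →ᵇ ℂ) →L[ℂ] (ℝ →ᵇ ℂ) := ↑U⁻¹ * T * ↑U
  have hSv : ∀ v, ‖S v‖ ≤ 1 / 2 * ‖v‖ := fun v => by
    refine (BoundedContinuousFunction.norm_le (by positivity)).2 fun x => ?_
    change ‖((ω x)⁻¹ : ℂ) * T (w * v) x‖ ≤ _
    have := hT (w * v) v (fun y => by
      change ‖(ω y : ℂ) * v y‖ ≤ _
      rw [norm_mul, Complex.norm_real, Real.norm_eq_abs, abs_of_pos (hpos y)]
      exact mul_le_mul_of_nonneg_left (v.norm_coe_le_norm y) (hpos y).le) x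
    rw [norm_mul, norm_inv, Complex.norm_real, Real.norm_eq_abs, abs_of_pos (hpos x)]
    calc (ω x)⁻¹ * ‖T (w * v) x‖ ≤ (ω x)⁻¹ * (ω x / 2 * ‖v‖) :=
          mul_le_mul_of_nonneg_left this (inv_pos.2 (hpos x)).le
      _ = 1 / 2 * ‖v‖ := by field_simp [(hpos x).ne']
  have hS : ‖S‖ ≤ 1 / 2 := S.opNorm_le_bound (by norm_num) hSv
  have hS1 : ‖S‖ < 1 := hS.trans_lt (by norm_num)
  let V := Units.oneSub S hS1
  -- From `u = b + S u` and `‖S u‖ ≤ ‖u‖ / 2` follows `‖u‖ ≤ 2 ‖b‖`.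
  have hV : ‖(↑V⁻¹ : (ℝ →ᵇ ℂ) →L[ℂ] (ℝ →ᵇ ℂ))‖ ≤ 2 := by
    refine ContinuousLinearMap.opNorm_le_bound _ (by norm_num) fun b => ?_
    set u := (↑V⁻¹ : (ℝ →ᵇ ℂ) →L[ℂ] (ℝ →ᵇ ℂ)) b with hu
    have hb : u - S u = b := by
      have : (V : (ℝ →ᵇ ℂ) →L[ℂ] (ℝ →ᵇ ℂ)) u = b := by
        rw [hu]
        change ((V : (ℝ →ᵇ ℂ) →L[ℂ] (ℝ →ᵇ ℂ)) * ↑V⁻¹) b = b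
        rw [Units.mul_inv]
        rfl
      simpa [V] using this
    have h2 := hSv u
    have h3 : ‖u‖ ≤ ‖b‖ + ‖S u‖ := by
      calc ‖u‖ = ‖b + S u‖ := by rw [← hb]; simp
        _ ≤ _ := norm_add_le _ _
    linarith
  have hfac : 1 - T = ((U * V * U⁻¹ : ((ℝ →ᵇ ℂ) →L[ℂ] (ℝ →ᵇ ℂ))ˣ) : (ℝ →ᵇ ℂ) →L[ℂ] (ℝ →ᵇ ℂ)) := by
    have : (V : (ℝ →ᵇ ℂ) →L[ℂ] (ℝ →ᵇ ℂ)) = 1 - ↑U⁻¹ * T * ↑U := rfl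
    simp only [Units.val_mul, this]
    rw [mul_sub, sub_mul, mul_one, Units.mul_inv]
    congr 1
    rw [← mul_assoc, ← mul_assoc, Units.mul_inv, one_mul, mul_assoc, Units.mul_inv, mul_one]
  refine ⟨hfac ▸ Units.isUnit _, ?_⟩
  rw [hfac, Ring.inverse_unit]
  have hM0 : 0 ≤ M := (hpos 0).le.trans (hM 0)
  have hU : ‖(U : (ℝ →ᵇ ℂ) →L[ℂ] (ℝ →ᵇ ℂ))‖ ≤ M :=
    (ContinuousLinearMap.opNorm_mul_apply_le ℂ (ℝ →ᵇ ℂ) w).trans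
      (BoundedContinuousFunction.norm_ofNormedAddCommGroup_le _ hM0 _)
  have hU' : ‖(↑U⁻¹ : (ℝ →ᵇ ℂ) →L[ℂ] (ℝ →ᵇ ℂ))‖ ≤ 1 :=
    (ContinuousLinearMap.opNorm_mul_apply_le ℂ (ℝ →ᵇ ℂ) w').trans
      (BoundedContinuousFunction.norm_ofNormedAddCommGroup_le _ zero_le_one _)
  rw [mul_inv_rev, mul_inv_rev, inv_inv, Units.val_mul, Units.val_mul]
  calc _ ≤ ‖(U : (ℝ →ᵇ ℂ) →L[ℂ] (ℝ →ᵇ ℂ))‖ * (‖(↑V⁻¹ : (ℝ →ᵇ ℂ) →L[ℂ] (ℝ →ᵇ ℂ))‖ *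
        ‖(↑U⁻¹ : (ℝ →ᵇ ℂ) →L[ℂ] (ℝ →ᵇ ℂ))‖) :=
        (norm_mul_le _ _).trans (mul_le_mul_of_nonneg_left (norm_mul_le _ _) (norm_nonneg _))
    _ ≤ M * (2 * 1) := by gcongr
    _ = 2 * M := by ring

namespace IsKernel
variable {K K₁ K₂ : ℝ → ℝ → ℂ} {ρ ρ₁ ρ₂ : ℝ → ℝ}

/-- The set `I x` is the half-line on which `K x` lives, to the right of `x` for the Jost solution
and to the left for the regular one. The weight is `exp (2 ∫_{I x} ρ)`. -/
theorem isUnit_one_sub_of_setIntegral (h : IsKernel K ρ) {I : ℝ → Set ℝ} (hK : ∀ x, ∀ y ∉ I x, K x y = 0)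
    (hc : Continuous fun x => ∫ y in I x, ρ y)
    (hw : ∀ x, ∫ y in I x, ρ y * Real.exp (2 * ∫ t in I y, ρ t)
      ≤ Real.exp (2 * ∫ t in I x, ρ t) / 2) :
    IsUnit (1 - kernelOp K) ∧
      ‖Ring.inverse (1 - kernelOp K)‖ ≤ 2 * Real.exp (2 * ∫ y, ρ y) := by
  have h0 : ∀ y, 0 ≤ ∫ t in I y, ρ t := fun y => integral_nonneg h.nonneg
  have hM : ∀ y, ∫ t in I y, ρ t ≤ ∫ t, ρ t := fun y =>
    setIntegral_le_integral h.integrable (.of_forall h.nonneg)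
  have hcw : Continuous fun x => Real.exp (2 * ∫ t in I x, ρ t) := by fun_prop
  refine isUnit_one_sub_of_weight (ω := fun x => Real.exp (2 * ∫ t in I x, ρ t)) hcw
    (fun x => Real.one_le_exp (by linarith [h0 x]))
    (fun x => Real.exp_le_exp.2 (by linarith [hM x])) fun u v huv x => ?_
  have hint : Integrable fun y => ρ y * Real.exp (2 * ∫ t in I y, ρ t) := by
    refine (h.integrable.mul_const (Real.exp (2 * ∫ t, ρ t))).mono'
      (h.integrable.aestronglyMeasurable.mul hcw.aestronglyMeasurable) (.of_forall fun y => ?_)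
    rw [Real.norm_eq_abs, abs_of_nonneg (mul_nonneg (h.nonneg y) (Real.exp_pos _).le)]
    exact mul_le_mul_of_nonneg_left (Real.exp_le_exp.2 (by linarith [hM y])) (h.nonneg y)
  rw [h.kernelOp_apply, ← setIntegral_eq_integral_of_forall_compl_eq_zero (s := I x)
    (fun y hy => by rw [hK x y hy, zero_mul])]
  refine (norm_integral_le_of_norm_le (hint.integrableOn.mul_const ‖v‖)
    (.of_forall fun y => ?_)).trans ?_
  · rw [norm_mul, mul_assoc]
    exact mul_le_mul (h.bound x y) (huv y) (norm_nonneg _) (h.nonneg y)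
  · rw [integral_mul_const]
    exact mul_le_mul_of_nonneg_right (hw x) (norm_nonneg _)

theorem isUnit_one_sub_of_upper (h : IsKernel K ρ) (hK : ∀ x y, y ≤ x → K x y = 0) :
    IsUnit (1 - kernelOp K) ∧
      ‖Ring.inverse (1 - kernelOp K)‖ ≤ 2 * Real.exp (2 * ∫ y, ρ y) := by
  refine h.isUnit_one_sub_of_setIntegral (I := Ioi)
    (fun x y hy => hK x y (not_lt.1 hy)) ?_ (setIntegral_Ioi_mul_exp_le h.integrable h.nonneg)
  have : (fun x => ∫ y in Ioi x, ρ y) = fun x => (∫ y in Ioi 0, ρ y) - ∫ y in (0 : ℝ)..x, ρ y := by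
    ext x
    rw [← intervalIntegral.integral_Ioi_sub_Ioi' h.integrable.integrableOn
      h.integrable.integrableOn]
    ring
  rw [this]
  exact continuous_const.sub
    (intervalIntegral.continuous_primitive (fun a b => h.integrable.intervalIntegrable) 0)

theorem isUnit_one_sub_of_lower (h : IsKernel K ρ) (hK : ∀ x y, x ≤ y → K x y = 0) :
    IsUnit (1 - kernelOp K) ∧
      ‖Ring.inverse (1 - kernelOp K)‖ ≤ 2 * Real.exp (2 * ∫ y, ρ y) := by
  refine h.isUnit_one_sub_of_setIntegral (I := Iio)
    (fun x y hy => hK x y (not_lt.1 hy)) ?_ (setIntegral_Iio_mul_exp_le h.integrable h.nonneg)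
  have : (fun x => ∫ y in Iio x, ρ y) = fun x => (∫ y in Iio 0, ρ y) + ∫ y in (0 : ℝ)..x, ρ y := by
    ext x
    rw [← intervalIntegral.integral_Iic_sub_Iic h.integrable.integrableOn
      h.integrable.integrableOn, integral_Iic_eq_integral_Iio, integral_Iic_eq_integral_Iio]
    ring
  rw [this]
  exact continuous_const.add
    (intervalIntegral.continuous_primitive (fun a b => h.integrable.intervalIntegrable) 0)

end IsKernel

/-! ### The inverse of `1 - T`: fixed points, perturbation, differentiability -/

theorem eq_inverse_one_sub_apply_iff {E : Type*} [NormedAddCommGroup E] [NormedSpace ℂ E]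
    {T : E →L[ℂ] E} (hT : IsUnit (1 - T)) {u b : E} :
    u = Ring.inverse (1 - T) b ↔ u = b + T u := by
  have h1 : ∀ x, Ring.inverse (1 - T) (x - T x) = x := fun x => by
    have := congrArg (fun A : E →L[ℂ] E => A x) (Ring.inverse_mul_cancel _ hT)
    simpa using this
  have h2 : ∀ x, Ring.inverse (1 - T) x - T (Ring.inverse (1 - T) x) = x := fun x => by
    have := congrArg (fun A : E →L[ℂ] E => A x) (Ring.mul_inverse_cancel _ hT)
    simpa using this
  constructor
  · rintro rfl
    exact sub_eq_iff_eq_add.1 (h2 b)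
  · intro h
    rw [← sub_eq_iff_eq_add.2 h, h1]

/-- Second resolvent identity. -/
theorem norm_inverse_one_sub_sub_le {E : Type*} [NormedAddCommGroup E] [NormedSpace ℂ E]
    {T₁ T₂ : E →L[ℂ] E} (h₁ : IsUnit (1 - T₁)) (h₂ : IsUnit (1 - T₂)) :
    ‖Ring.inverse (1 - T₁) - Ring.inverse (1 - T₂)‖
      ≤ ‖Ring.inverse (1 - T₁)‖ * ‖T₁ - T₂‖ * ‖Ring.inverse (1 - T₂)‖ := by
  have : Ring.inverse (1 - T₁) - Ring.inverse (1 - T₂)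
      = Ring.inverse (1 - T₁) * (T₁ - T₂) * Ring.inverse (1 - T₂) := by
    have e : T₁ - T₂ = (1 - T₂) - (1 - T₁) := by abel
    rw [e, mul_sub, sub_mul, Ring.inverse_mul_cancel _ h₁, one_mul, mul_assoc,
      Ring.mul_inverse_cancel _ h₂, mul_one]
  rw [this]
  exact (norm_mul_le _ _).trans (mul_le_mul_of_nonneg_right (norm_mul_le _ _) (norm_nonneg _))

theorem differentiableWithinAt_inverse_one_sub {E : Type*} [NormedAddCommGroup E]
    [NormedSpace ℂ E] [CompleteSpace E] {T : ℂ → E →L[ℂ] E} {S : Set ℂ} {κ : ℂ}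
    (h : DifferentiableWithinAt ℂ T S κ) (hu : IsUnit (1 - T κ)) :
    DifferentiableWithinAt ℂ (fun w => Ring.inverse (1 - T w)) S κ :=
  DifferentiableAt.comp_differentiableWithinAt (𝕜 := ℂ) (f := fun w => 1 - T w)
    (g := Ring.inverse) κ (differentiableAt_inverse hu) (h.const_sub 1)

/-! ### The Macdonald function on the closed right half-plane -/

/-- The weight `e^{-t} t^{-1/2}` of the Laplace integral of the Macdonald function. -/
noncomputable def macWeight (t : ℝ) : ℝ := Real.exp (-t) * t ^ ((1 / 2 : ℝ) - 1)

/-- `∫₀^∞ e^{-t} t^{-1/2} (s + t/2)^{-a} dt`. -/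
noncomputable def macInt (a : ℝ) (s : ℂ) : ℂ :=
  ∫ t in Ioi (0 : ℝ), (macWeight t : ℂ) * (s + t / 2) ^ (-(a : ℂ))

theorem macWeight_integrableOn : IntegrableOn macWeight (Ioi 0) :=
  Real.GammaIntegral_convergent (by norm_num)

theorem integral_macWeight : ∫ t in Ioi (0 : ℝ), macWeight t = √Real.pi := by
  rw [← Real.Gamma_one_half_eq, Real.Gamma_eq_integral (by norm_num)]; rfl

theorem mul_macWeight_eq {t : ℝ} (ht : 0 < t) :
    t * macWeight t = Real.exp (-t) * t ^ ((3 / 2 : ℝ) - 1) := by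
  have : t ^ ((3 / 2 : ℝ) - 1) = t * t ^ ((1 / 2 : ℝ) - 1) := by
    rw [← Real.rpow_one_add' ht.le (by norm_num)]; norm_num
  rw [this, macWeight]; ring

theorem mul_macWeight_integrableOn : IntegrableOn (fun t => t * macWeight t) (Ioi 0) :=
  (Real.GammaIntegral_convergent (s := 3 / 2) (by norm_num)).congr_fun
    (fun _ ht => (mul_macWeight_eq ht).symm) measurableSet_Ioi

theorem integral_mul_macWeight : ∫ t in Ioi (0 : ℝ), t * macWeight t = √Real.pi / 2 := by
  rw [setIntegral_congr_fun measurableSet_Ioi fun t ht => mul_macWeight_eq ht,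
    ← Real.Gamma_eq_integral (by norm_num), ← Real.Gamma_one_half_eq,
    show (3 / 2 : ℝ) = 1 / 2 + 1 by norm_num, Real.Gamma_add_one (by norm_num)]
  ring

theorem macWeight_pos {t : ℝ} (ht : 0 < t) : 0 < macWeight t :=
  mul_pos (Real.exp_pos _) (Real.rpow_pos_of_pos ht _)

theorem continuousOn_macWeight : ContinuousOn macWeight (Ioi 0) := fun t ht =>
  ((Real.continuous_exp.comp continuous_neg).continuousAt.mul
    (Real.continuousAt_rpow_const t _ (Or.inl (ne_of_gt ht)))).continuousWithinAt

theorem norm_le_norm_add_half {s : ℂ} (hs : 0 ≤ s.re) {t : ℝ} (ht : 0 ≤ t) :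
    ‖s‖ ≤ ‖s + t / 2‖ := by
  rw [← sq_le_sq₀ (norm_nonneg _) (norm_nonneg _), ← Complex.normSq_eq_norm_sq,
    ← Complex.normSq_eq_norm_sq, Complex.normSq_apply, Complex.normSq_apply]
  have e1 : (s + t / 2).re = s.re + t / 2 := by simp
  have e2 : (s + t / 2).im = s.im := by simp
  rw [e1, e2]
  nlinarith [mul_nonneg hs ht, sq_nonneg t]

theorem half_le_norm_add_half {s : ℂ} (hs : 0 ≤ s.re) {t : ℝ} : t / 2 ≤ ‖s + t / 2‖ := by
  have e1 : (s + t / 2).re = s.re + t / 2 := by simp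
  have := (Complex.abs_re_le_norm (s + t / 2))
  rw [e1] at this
  linarith [le_abs_self (s.re + t / 2)]

theorem add_half_re_nonneg {s : ℂ} (hs : 0 ≤ s.re) {t : ℝ} (ht : 0 ≤ t) :
    0 ≤ (s + t / 2 : ℂ).re := by
  have e1 : (s + t / 2 : ℂ).re = s.re + t / 2 := by simp
  rw [e1]; linarith

theorem mem_slitPlane_of_re_nonneg {s : ℂ} (hs : 0 ≤ s.re) (h0 : s ≠ 0) : s ∈ Complex.slitPlane := by
  rw [Complex.mem_slitPlane_iff]
  rcases hs.lt_or_eq with h | h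
  · exact Or.inl h
  · exact Or.inr fun h' => h0 (Complex.ext h.symm h')

/-- A disc centred in the closed right half-plane whose boundary passes through `0` cannot meet the
negative real axis. This gives room to cross the imaginary axis. -/
theorem mem_slitPlane_of_norm_sub_lt {w ζ : ℂ} (hζ : 0 ≤ ζ.re) (h : ‖w - ζ‖ < ‖ζ‖) :
    w ∈ Complex.slitPlane := by
  rw [Complex.mem_slitPlane_iff]
  by_contra! hc
  rw [← sq_lt_sq₀ (norm_nonneg _) (norm_nonneg _), ← Complex.normSq_eq_norm_sq,
    ← Complex.normSq_eq_norm_sq, Complex.normSq_apply, Complex.normSq_apply, Complex.sub_re,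
    Complex.sub_im, hc.2] at h
  nlinarith [mul_nonneg hζ (neg_nonneg.2 hc.1), sq_nonneg w.re]

theorem cpow_one_add {w : ℂ} (c : ℂ) (hw : w ≠ 0) : w ^ (1 + c) = w * w ^ c := by
  rw [Complex.cpow_add _ _ hw, Complex.cpow_one]

theorem norm_cpow_neg_le {a m : ℝ} (ha : 0 ≤ a) {w : ℂ} (hm : 0 < m) (h : m ≤ ‖w‖) :
    ‖w ^ (-(a : ℂ))‖ ≤ m ^ (-a) := by
  rw [show (-(a : ℂ)) = ((-a : ℝ) : ℂ) by push_cast; rfl, Complex.norm_cpow_real]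
  exact Real.rpow_le_rpow_of_nonpos hm h (by linarith)

theorem macInt_aestronglyMeasurable {a : ℝ} {s : ℂ}
    (h : ∀ t : ℝ, 0 < t → (s + t / 2 : ℂ) ∈ Complex.slitPlane) :
    AEStronglyMeasurable (fun t : ℝ => (macWeight t : ℂ) * (s + t / 2) ^ (-(a : ℂ)))
      (volume.restrict (Ioi 0)) := by
  refine ContinuousOn.aestronglyMeasurable (fun t ht => ?_) measurableSet_Ioi
  refine (Complex.continuous_ofReal.continuousAt.comp_continuousWithinAt
    (continuousOn_macWeight t ht)).mul (ContinuousAt.continuousWithinAt ?_)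
  exact ContinuousAt.cpow (by fun_prop) continuousAt_const (h t ht)

theorem macInt_integrableOn {a : ℝ} (ha : 0 ≤ a) {s : ℂ} (hs : 0 ≤ s.re) (h0 : s ≠ 0) :
    IntegrableOn (fun t : ℝ => (macWeight t : ℂ) * (s + t / 2) ^ (-(a : ℂ))) (Ioi 0) := by
  have hsl : ∀ t : ℝ, 0 < t → (s + t / 2 : ℂ) ∈ Complex.slitPlane := fun t ht =>
    mem_slitPlane_of_re_nonneg (add_half_re_nonneg hs ht.le) fun h => by
      have := norm_le_norm_add_half hs ht.le
      rw [h, norm_zero] at this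
      exact h0 (norm_le_zero_iff.1 this)
  refine (macWeight_integrableOn.mul_const (‖s‖ ^ (-a))).mono' (macInt_aestronglyMeasurable hsl) ?_
  refine (ae_restrict_iff' measurableSet_Ioi).2 (.of_forall fun t ht => ?_)
  rw [norm_mul, Complex.norm_real, Real.norm_eq_abs, abs_of_pos (macWeight_pos ht)]
  exact mul_le_mul_of_nonneg_left
    (norm_cpow_neg_le ha (norm_pos_iff.2 h0) (norm_le_norm_add_half hs (le_of_lt ht)))
    (macWeight_pos ht).le

/-- Differentiation under the integral on the disc of radius `‖s‖ / 2`. The disc may leave the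
half-plane, so the result is a full complex derivative even for imaginary `s`, which corresponds to
real `k`. -/
theorem hasDerivAt_macInt {a : ℝ} (ha : 0 ≤ a) {s : ℂ} (hs : 0 ≤ s.re) (h0 : s ≠ 0) :
    HasDerivAt (macInt a) (-a * macInt (a + 1) s) s := by
  have hn : 0 < ‖s‖ := norm_pos_iff.2 h0
  have hball : ∀ w ∈ Metric.ball s (‖s‖ / 2), ∀ t : ℝ, 0 < t →
      (w + t / 2 : ℂ) ∈ Complex.slitPlane ∧ ‖s‖ / 2 ≤ ‖w + t / 2‖ := by
    intro w hw t ht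
    have h1 : ‖(w + t / 2) - (s + t / 2)‖ < ‖s‖ / 2 := by
      rw [add_sub_add_right_eq_sub]; simpa [dist_eq_norm] using hw
    have h2 := norm_le_norm_add_half hs ht.le
    refine ⟨mem_slitPlane_of_norm_sub_lt (add_half_re_nonneg hs ht.le) (by linarith), ?_⟩
    have h3 := norm_sub_norm_le (s + t / 2) (w + t / 2)
    rw [norm_sub_rev] at h3
    linarith
  have hmem : s ∈ Metric.ball s (‖s‖ / 2) := Metric.mem_ball_self (by positivity)
  have key := hasDerivAt_integral_of_dominated_loc_of_deriv_le (𝕜 := ℂ)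
    (μ := volume.restrict (Ioi (0 : ℝ))) (x₀ := s) (s := Metric.ball s (‖s‖ / 2))
    (F := fun w t => (macWeight t : ℂ) * (w + t / 2) ^ (-(a : ℂ)))
    (F' := fun w t => -a * ((macWeight t : ℂ) * (w + t / 2) ^ (-((a + 1 : ℝ) : ℂ))))
    (bound := fun t => a * (macWeight t * (‖s‖ / 2) ^ (-(a + 1))))
    (Metric.ball_mem_nhds s (by positivity))
    (eventually_of_mem (Metric.ball_mem_nhds s (half_pos hn)) fun w hw =>
      macInt_aestronglyMeasurable fun t ht => (hball w hw t ht).1)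
    (macInt_integrableOn ha hs h0)
    ((macInt_aestronglyMeasurable fun t ht => (hball s hmem t ht).1).const_mul _)
    ((ae_restrict_iff' measurableSet_Ioi).2 (.of_forall fun t ht w hw => by
      rw [norm_mul, norm_neg, Complex.norm_real, Real.norm_eq_abs, abs_of_nonneg ha, norm_mul,
        Complex.norm_real, Real.norm_eq_abs, abs_of_pos (macWeight_pos ht)]
      exact mul_le_mul_of_nonneg_left (mul_le_mul_of_nonneg_left
        (norm_cpow_neg_le (by linarith) (by positivity) (hball w hw t ht).2)
        (macWeight_pos ht).le) ha))
    ((macWeight_integrableOn.mul_const _).const_mul _)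
    ((ae_restrict_iff' measurableSet_Ioi).2 (.of_forall fun t ht w hw => by
      have h1 : HasDerivAt (fun w : ℂ => w + t / 2) 1 w := (hasDerivAt_id w).add_const _
      have := (h1.cpow_const (c := -(a : ℂ)) (hball w hw t ht).1).const_mul (macWeight t : ℂ)
      refine this.congr_deriv ?_
      rw [show -((a + 1 : ℝ) : ℂ) = -(a : ℂ) - 1 by push_cast; ring]
      ring))
  refine key.2.congr_deriv ?_
  rw [integral_const_mul]
  rfl

/-- This is Bessel's equation. The combined integrand is the `t`-derivative of `½ e^{-t} t^{1/2} (s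
+ t/2)^{-3/2}`, which vanishes at `0` and at infinity. -/
theorem macInt_ode {s : ℂ} (hs : 0 ≤ s.re) (h0 : s ≠ 0) :
    3 / 4 * s * macInt (5 / 2) s - 1 / 2 * (1 - 2 * s) * macInt (3 / 2) s - macInt (1 / 2) s = 0 := by
  have hn : 0 < ‖s‖ := norm_pos_iff.2 h0
  have hσ0 : ∀ t : ℝ, 0 ≤ t → (s + t / 2 : ℂ) ≠ 0 := fun t ht h => by
    have := norm_le_norm_add_half hs ht
    rw [h, norm_zero] at this
    exact h0 (norm_le_zero_iff.1 this)
  have i₁ := macInt_integrableOn (a := 1 / 2) (by norm_num) hs h0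
  have i₃ := macInt_integrableOn (a := 3 / 2) (by norm_num) hs h0
  have i₅ := macInt_integrableOn (a := 5 / 2) (by norm_num) hs h0
  have i₅₃ : IntegrableOn (fun t : ℝ =>
      3 / 4 * s * ((macWeight t : ℂ) * (s + t / 2) ^ (-((5 / 2 : ℝ) : ℂ)))
        - 1 / 2 * (1 - 2 * s) * ((macWeight t : ℂ) * (s + t / 2) ^ (-((3 / 2 : ℝ) : ℂ)))) (Ioi 0) :=
    (i₅.const_mul (3 / 4 * s)).sub (i₃.const_mul (1 / 2 * (1 - 2 * s)))
  have hder : ∀ t ∈ Ioi (0 : ℝ), HasDerivAt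
      (fun t : ℝ => 1 / 2 * (((Real.exp (-t) * t ^ (1 / 2 : ℝ) : ℝ) : ℂ)
        * (s + t / 2) ^ (-((3 / 2 : ℝ) : ℂ))))
      (3 / 4 * s * ((macWeight t : ℂ) * (s + t / 2) ^ (-((5 / 2 : ℝ) : ℂ)))
        - 1 / 2 * (1 - 2 * s) * ((macWeight t : ℂ) * (s + t / 2) ^ (-((3 / 2 : ℝ) : ℂ)))
        - (macWeight t : ℂ) * (s + t / 2) ^ (-((1 / 2 : ℝ) : ℂ))) t := by
    intro t ht
    have ht0 : (0 : ℝ) < t := ht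
    have h1 : HasDerivAt (fun t : ℝ => Real.exp (-t) * t ^ (1 / 2 : ℝ))
        (-Real.exp (-t) * t ^ (1 / 2 : ℝ) + Real.exp (-t) * (1 / 2 * t ^ ((1 / 2 : ℝ) - 1))) t := by
      refine (((hasDerivAt_neg t).exp).mul
        (Real.hasDerivAt_rpow_const (p := 1 / 2) (Or.inl ht0.ne'))).congr_deriv (by ring)
    have h2 : HasDerivAt (fun t : ℝ => (s + t / 2 : ℂ)) (1 / 2) t :=
      ((Complex.ofRealCLM.hasDerivAt (x := t)).div_const 2).const_add s |>.congr_deriv (by simp)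
    have h3 := HasDerivAt.comp t ((hasDerivAt_id' (s + t / 2 : ℂ)).cpow_const
      (c := -((3 / 2 : ℝ) : ℂ))
      (mem_slitPlane_of_re_nonneg (add_half_re_nonneg hs ht0.le) (hσ0 t ht0.le))) h2
    refine ((h1.ofReal_comp.mul h3).const_mul (1 / 2 : ℂ)).congr_deriv ?_
    have hne := hσ0 t ht0.le
    have e3 : (s + t / 2 : ℂ) ^ (-((3 / 2 : ℝ) : ℂ)) =
        (s + t / 2) * (s + t / 2 : ℂ) ^ (-((5 / 2 : ℝ) : ℂ)) := by
      rw [← cpow_one_add _ hne]; congr 1; push_cast; ring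
    have e1 : (s + t / 2 : ℂ) ^ (-((1 / 2 : ℝ) : ℂ)) =
        (s + t / 2) * ((s + t / 2) * (s + t / 2 : ℂ) ^ (-((5 / 2 : ℝ) : ℂ))) := by
      rw [← cpow_one_add _ hne, ← cpow_one_add _ hne]; congr 1; push_cast; ring
    have e4 : (s + t / 2 : ℂ) ^ (-((3 / 2 : ℝ) : ℂ) - 1) = (s + t / 2 : ℂ) ^ (-((5 / 2 : ℝ) : ℂ)) := by
      congr 1; push_cast; ring
    have e5 : t ^ (1 / 2 : ℝ) = t * t ^ ((1 / 2 : ℝ) - 1) := by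
      rw [← Real.rpow_one_add' ht0.le (by norm_num)]; norm_num
    rw [e4, e1, e3, e5, macWeight]
    simp only [Function.comp_apply, e3]
    generalize (s + t / 2 : ℂ) ^ (-((5 / 2 : ℝ) : ℂ)) = A
    push_cast
    ring
  have hlim : Tendsto (fun t : ℝ => 1 / 2 * (((Real.exp (-t) * t ^ (1 / 2 : ℝ) : ℝ) : ℂ)
        * (s + t / 2) ^ (-((3 / 2 : ℝ) : ℂ)))) atTop (𝓝 0) := by
    have hr := (tendsto_rpow_mul_exp_neg_mul_atTop_nhds_zero (1 / 2) 1 one_pos).mul_const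
      (1 / 2 * ‖s‖ ^ (-(3 / 2) : ℝ))
    rw [zero_mul] at hr
    refine squeeze_zero_norm' ((eventually_ge_atTop 0).mono fun t ht => ?_) hr
    have hb := norm_cpow_neg_le (a := 3 / 2) (by norm_num) hn (norm_le_norm_add_half hs ht)
    have h3 : 0 ≤ Real.exp (-t) * t ^ (1 / 2 : ℝ) :=
      mul_nonneg (Real.exp_pos _).le (Real.rpow_nonneg ht _)
    rw [norm_mul, norm_mul, Complex.norm_real, Real.norm_eq_abs, abs_of_nonneg h3]
    have : ‖(1 / 2 : ℂ)‖ = 1 / 2 := by norm_num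
    rw [this]
    calc _ ≤ 1 / 2 * (Real.exp (-t) * t ^ (1 / 2 : ℝ) * ‖s‖ ^ (-(3 / 2 : ℝ))) := by gcongr
      _ = _ := by rw [neg_one_mul]; ring
  have hcont : ContinuousWithinAt (fun t : ℝ => 1 / 2 * (((Real.exp (-t) * t ^ (1 / 2 : ℝ) : ℝ) : ℂ)
        * (s + t / 2) ^ (-((3 / 2 : ℝ) : ℂ)))) (Ici 0) 0 := by
    refine ContinuousAt.continuousWithinAt ?_
    refine continuousAt_const.mul (ContinuousAt.mul ?_ ?_)
    · refine Complex.continuous_ofReal.continuousAt.comp ?_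
      exact (Real.continuous_exp.comp continuous_neg).continuousAt.mul
        (Real.continuousAt_rpow_const _ _ (Or.inr (by norm_num)))
    · exact ContinuousAt.cpow (by fun_prop) continuousAt_const
        (mem_slitPlane_of_re_nonneg (add_half_re_nonneg hs le_rfl) (hσ0 0 le_rfl))
  have := integral_Ioi_of_hasDerivAt_of_tendsto hcont hder (i₅₃.sub i₁) hlim
  have e : (∫ t in Ioi (0 : ℝ), (3 / 4 * s * ((macWeight t : ℂ) * (s + t / 2) ^ (-((5 / 2 : ℝ) : ℂ)))
        - 1 / 2 * (1 - 2 * s) * ((macWeight t : ℂ) * (s + t / 2) ^ (-((3 / 2 : ℝ) : ℂ)))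
        - (macWeight t : ℂ) * (s + t / 2) ^ (-((1 / 2 : ℝ) : ℂ)))) =
      3 / 4 * s * macInt (5 / 2) s - 1 / 2 * (1 - 2 * s) * macInt (3 / 2) s - macInt (1 / 2) s := by
    rw [macInt, macInt, macInt, ← integral_const_mul, ← integral_const_mul,
      ← integral_sub (i₅.const_mul _) (i₃.const_mul _), ← integral_sub i₅₃ i₁]
  rw [e] at this
  rw [this]
  simp

theorem norm_macInt_half_le {s : ℂ} (hs : 0 ≤ s.re) (h0 : s ≠ 0) :
    ‖macInt (1 / 2) s‖ ≤ √Real.pi * ‖s‖ ^ (-(1 / 2) : ℝ) := by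
  rw [← integral_macWeight, ← integral_mul_const]
  refine norm_integral_le_of_norm_le (macWeight_integrableOn.mul_const _)
    ((ae_restrict_iff' measurableSet_Ioi).2 (.of_forall fun t ht => ?_))
  rw [norm_mul, Complex.norm_real, Real.norm_eq_abs, abs_of_pos (macWeight_pos ht)]
  exact mul_le_mul_of_nonneg_left
    (norm_cpow_neg_le (by norm_num) (norm_pos_iff.2 h0) (norm_le_norm_add_half hs (le_of_lt ht)))
    (macWeight_pos ht).le

/-- The difference of the integrands contains `(s + t/2)^{-1/2} - s (s + t/2)^{-3/2} = (t/2) (s +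
t/2)^{-3/2}`. This cancellation is what makes `macH₁` of order `|s|^{-2}`. -/
theorem norm_macInt_half_sub_le {s : ℂ} (hs : 0 ≤ s.re) (h0 : s ≠ 0) :
    ‖macInt (1 / 2) s - s * macInt (3 / 2) s‖ ≤ √Real.pi / 4 * ‖s‖ ^ (-(3 / 2) : ℝ) := by
  have hσ0 : ∀ t : ℝ, 0 ≤ t → (s + t / 2 : ℂ) ≠ 0 := fun t ht h => by
    have := norm_le_norm_add_half hs ht
    rw [h, norm_zero] at this
    exact h0 (norm_le_zero_iff.1 this)
  have i₁ := macInt_integrableOn (a := 1 / 2) (by norm_num) hs h0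
  have i₃ := macInt_integrableOn (a := 3 / 2) (by norm_num) hs h0
  rw [macInt, macInt, ← integral_const_mul, ← integral_sub i₁ (i₃.const_mul _),
    show √Real.pi / 4 * ‖s‖ ^ (-(3 / 2) : ℝ) = √Real.pi / 2 * (1 / 2 * ‖s‖ ^ (-(3 / 2) : ℝ)) by ring,
    ← integral_mul_macWeight, ← integral_mul_const]
  refine norm_integral_le_of_norm_le (mul_macWeight_integrableOn.mul_const _)
    ((ae_restrict_iff' measurableSet_Ioi).2 (.of_forall fun t ht => ?_))
  have ht0 : (0 : ℝ) < t := ht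
  have e1 : (s + t / 2 : ℂ) ^ (-((1 / 2 : ℝ) : ℂ)) =
      (s + t / 2) * (s + t / 2 : ℂ) ^ (-((3 / 2 : ℝ) : ℂ)) := by
    rw [← cpow_one_add _ (hσ0 t ht0.le)]; congr 1; push_cast; ring
  have e2 : (macWeight t : ℂ) * (s + t / 2 : ℂ) ^ (-((1 / 2 : ℝ) : ℂ)) -
      s * ((macWeight t : ℂ) * (s + t / 2 : ℂ) ^ (-((3 / 2 : ℝ) : ℂ))) =
      ((t * macWeight t * (1 / 2) : ℝ) : ℂ) * (s + t / 2 : ℂ) ^ (-((3 / 2 : ℝ) : ℂ)) := by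
    rw [e1]; push_cast; ring
  have hp := macWeight_pos ht0
  rw [e2, norm_mul, Complex.norm_real, Real.norm_eq_abs, abs_of_pos (by positivity), mul_assoc]
  exact mul_le_mul_of_nonneg_left (mul_le_mul_of_nonneg_left
    (norm_cpow_neg_le (by norm_num) (norm_pos_iff.2 h0) (norm_le_norm_add_half hs ht0.le))
    (by norm_num)) (by positivity)

/-- Split at `t = |s|` and drop `e^{-t}`: below use `|s + t/2| ≥ |s|`, above use `|s + t/2| ≥ t/2`.
The pieces contribute `2/|s|` and `4/|s|`. Uniformity as `s → 0` is the point. -/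
theorem norm_mul_macInt_three_halves_le {s : ℂ} (hs : 0 ≤ s.re) (h0 : s ≠ 0) :
    ‖s * macInt (3 / 2) s‖ ≤ 6 := by
  set a := ‖s‖ with ha
  have hn : 0 < a := norm_pos_iff.2 h0
  have i₃ := macInt_integrableOn (a := 3 / 2) (by norm_num) hs h0
  have hexp : ∀ t : ℝ, 0 < t → macWeight t ≤ t ^ (-(1 / 2) : ℝ) := fun t ht => by
    rw [macWeight, show (1 / 2 : ℝ) - 1 = -(1 / 2) by norm_num]
    exact mul_le_of_le_one_left (Real.rpow_nonneg ht.le _) (Real.exp_le_one_iff.2 (by linarith))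
  have j₁ : IntegrableOn (fun t : ℝ => t ^ (-(1 / 2) : ℝ)) (Ioc 0 a) :=
    (intervalIntegral.intervalIntegrable_rpow' (by norm_num)).1
  have j₂ : IntegrableOn (fun t : ℝ => t ^ (-2 : ℝ)) (Ioi a) :=
    integrableOn_Ioi_rpow_of_lt (by norm_num) hn
  have b₁ : ‖∫ t in Ioc 0 a, (macWeight t : ℂ) * (s + t / 2) ^ (-((3 / 2 : ℝ) : ℂ))‖ ≤ 2 * a⁻¹ := by
    have : ∫ t in Ioc 0 a, t ^ (-(1 / 2) : ℝ) * a ^ (-(3 / 2) : ℝ) = 2 * a⁻¹ := by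
      rw [integral_mul_const, ← intervalIntegral.integral_of_le hn.le,
        integral_rpow (Or.inl (by norm_num)), Real.zero_rpow (by norm_num), ← Real.rpow_neg_one a,
        sub_zero, div_mul_eq_mul_div, ← Real.rpow_add hn]
      norm_num
      ring
    rw [← this]
    refine norm_integral_le_of_norm_le (j₁.mul_const _)
      ((ae_restrict_iff' measurableSet_Ioc).2 (.of_forall fun t ht => ?_))
    rw [norm_mul, Complex.norm_real, Real.norm_eq_abs, abs_of_pos (macWeight_pos ht.1)]
    exact mul_le_mul (hexp t ht.1)
      (norm_cpow_neg_le (by norm_num) hn (norm_le_norm_add_half hs ht.1.le)) (norm_nonneg _)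
      (Real.rpow_nonneg ht.1.le _)
  have b₂ : ‖∫ t in Ioi a, (macWeight t : ℂ) * (s + t / 2) ^ (-((3 / 2 : ℝ) : ℂ))‖ ≤ 4 * a⁻¹ := by
    have : ∫ t in Ioi a, 4 * t ^ (-2 : ℝ) = 4 * a⁻¹ := by
      rw [integral_const_mul, integral_Ioi_rpow_of_lt (by norm_num) hn, ← Real.rpow_neg_one a]
      norm_num
    rw [← this]
    refine norm_integral_le_of_norm_le (j₂.const_mul _)
      ((ae_restrict_iff' measurableSet_Ioi).2 (.of_forall fun t ht => ?_))
    have ht0 : 0 < t := hn.trans ht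
    rw [norm_mul, Complex.norm_real, Real.norm_eq_abs, abs_of_pos (macWeight_pos ht0)]
    have hb := norm_cpow_neg_le (a := 3 / 2) (by norm_num) (half_pos ht0) (half_le_norm_add_half (t := t) hs)
    have h4 : (t / 2) ^ (-(3 / 2) : ℝ) ≤ 4 * t ^ (-(3 / 2) : ℝ) := by
      rw [Real.div_rpow ht0.le (by norm_num), div_eq_mul_inv, ← Real.rpow_neg (by norm_num), neg_neg,
        mul_comm]
      refine mul_le_mul_of_nonneg_right ?_ (Real.rpow_nonneg ht0.le _)
      calc (2 : ℝ) ^ (3 / 2 : ℝ) ≤ 2 ^ (2 : ℝ) :=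
            Real.rpow_le_rpow_of_exponent_le (by norm_num) (by norm_num)
        _ = 4 := by norm_num
    calc _ ≤ t ^ (-(1 / 2) : ℝ) * (4 * t ^ (-(3 / 2) : ℝ)) :=
          mul_le_mul (hexp t ht0) (hb.trans h4) (norm_nonneg _) (Real.rpow_nonneg ht0.le _)
      _ = 4 * t ^ (-2 : ℝ) := by
          rw [mul_left_comm, ← Real.rpow_add ht0]; norm_num
  have hsplit : macInt (3 / 2) s = (∫ t in Ioc 0 a, (macWeight t : ℂ) * (s + t / 2) ^ (-((3 / 2 : ℝ) : ℂ)))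
      + ∫ t in Ioi a, (macWeight t : ℂ) * (s + t / 2) ^ (-((3 / 2 : ℝ) : ℂ)) := by
    rw [macInt, ← Ioc_union_Ioi_eq_Ioi hn.le]
    exact setIntegral_union Ioc_disjoint_Ioi_same measurableSet_Ioi
      (i₃.mono_set Ioc_subset_Ioi_self) (i₃.mono_set (Ioi_subset_Ioi hn.le))
  rw [norm_mul, hsplit, ← ha]
  calc _ ≤ a * (2 * a⁻¹ + 4 * a⁻¹) :=
        mul_le_mul_of_nonneg_left ((norm_add_le _ _).trans (add_le_add b₁ b₂)) hn.le
    _ = 6 := by field_simp; norm_num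

/-- Both factors lie in the sector `|Im| ≤ Re`, so their product has nonnegative real part. If that
real part were zero, the square `s / w` would be a nonpositive real number, against `Re (s / w) ≥ 0`
and `s / w ≠ 0`. -/
theorem cpow_half_mul_cpow_neg_half {s w : ℂ} (hs : 0 ≤ s.re) (hw : 0 ≤ w.re) (h0 : s ≠ 0)
    (hw0 : w ≠ 0) (hsw : 0 ≤ (s / w).re) :
    0 < (s ^ (1 / 2 : ℂ) * w ^ (-(1 / 2) : ℂ)).re := by
  have hroot : ∀ v : ℂ, 0 ≤ v.re → |(v ^ (1 / 2 : ℂ)).im| ≤ (v ^ (1 / 2 : ℂ)).re := by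
    intro v hv
    have hsq : (v ^ (1 / 2 : ℂ)) ^ 2 = v := by
      rw [one_div, show (2 : ℂ)⁻¹ = ((2 : ℕ) : ℂ)⁻¹ by norm_num]
      exact Complex.cpow_nat_inv_pow v two_ne_zero
    have hre : 0 ≤ (v ^ (1 / 2 : ℂ)).re := by
      rcases eq_or_ne v 0 with rfl | hv0
      · simp
      rw [Complex.cpow_def_of_ne_zero hv0, Complex.exp_re]
      refine mul_nonneg (Real.exp_pos _).le (Real.cos_nonneg_of_neg_pi_div_two_le_of_le ?_ ?_) <;>
      · have h1 := Complex.neg_pi_lt_arg v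
        have h2 := Complex.arg_le_pi v
        simp [Complex.log_im]
        linarith
    have := congrArg Complex.re hsq
    rw [pow_two, Complex.mul_re] at this
    exact abs_le_of_sq_le_sq (by nlinarith) hre
  have hinv : w ^ (-(1 / 2) : ℂ) = (w⁻¹) ^ (1 / 2 : ℂ) := by
    rw [Complex.cpow_neg, Complex.inv_cpow _ _ 
      (Complex.mem_slitPlane_iff_arg.1 (mem_slitPlane_of_re_nonneg hw hw0)).1]
  have hwi : 0 ≤ (w⁻¹).re := by
    rw [Complex.inv_re]; exact div_nonneg hw (Complex.normSq_nonneg _)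
  have ha := hroot s hs
  have hb := hroot _ hwi
  rw [hinv]
  set α := s ^ (1 / 2 : ℂ) with hα
  set β := (w⁻¹) ^ (1 / 2 : ℂ) with hβ
  have hsq : ∀ v : ℂ, (v ^ (1 / 2 : ℂ)) ^ 2 = v := fun v => by
    rw [one_div, show (2 : ℂ)⁻¹ = ((2 : ℕ) : ℂ)⁻¹ by norm_num]
    exact Complex.cpow_nat_inv_pow v two_ne_zero
  have hαβ : (α * β) ^ 2 = s / w := by
    rw [mul_pow, hα, hβ, hsq, hsq, div_eq_mul_inv]
  have hge : 0 ≤ (α * β).re := by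
    rw [Complex.mul_re]
    have : |α.im * β.im| ≤ α.re * β.re := by
      rw [abs_mul]; exact mul_le_mul ha hb (abs_nonneg _) ((abs_nonneg _).trans ha)
    linarith [le_abs_self (α.im * β.im)]
  refine hge.lt_of_ne fun h => ?_
  have h2 := congrArg Complex.re hαβ
  rw [pow_two, Complex.mul_re, ← h] at h2
  have him : (α * β).im = 0 := by nlinarith
  have : α * β = 0 := Complex.ext h.symm him
  rw [this] at hαβ
  have : s / w ≠ 0 := div_ne_zero h0 hw0
  exact this (by rw [← hαβ]; norm_num)

theorem div_add_half_re_nonneg {s : ℂ} (hs : 0 ≤ s.re) {t : ℝ} (ht : 0 ≤ t) :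
    0 ≤ (s / (s + t / 2)).re := by
  have e1 : (s + t / 2 : ℂ).re = s.re + t / 2 := by simp
  have e2 : (s + t / 2 : ℂ).im = s.im := by simp
  rw [Complex.div_re, e1, e2, ← add_div]
  refine div_nonneg ?_ (Complex.normSq_nonneg _)
  nlinarith [mul_self_nonneg s.im, mul_nonneg hs (by linarith : 0 ≤ s.re + t / 2)]

theorem cpow_half_sq (v : ℂ) : (v ^ (1 / 2 : ℂ)) ^ 2 = v := by
  rw [one_div, show (2 : ℂ)⁻¹ = ((2 : ℕ) : ℂ)⁻¹ by norm_num]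
  exact Complex.cpow_nat_inv_pow v two_ne_zero

theorem add_half_ne_zero {s : ℂ} (hs : 0 ≤ s.re) (h0 : s ≠ 0) {t : ℝ} (ht : 0 ≤ t) :
    (s + t / 2 : ℂ) ≠ 0 := fun h => by
  have := norm_le_norm_add_half hs ht
  rw [h, norm_zero] at this
  exact h0 (norm_le_zero_iff.1 this)

theorem cpow_half_mul_macInt_eq {s : ℂ} :
    s ^ (1 / 2 : ℂ) * macInt (1 / 2) s = ∫ t in Ioi (0 : ℝ),
      (macWeight t : ℂ) * (s ^ (1 / 2 : ℂ) * (s + t / 2) ^ (-(1 / 2) : ℂ)) := by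
  rw [macInt, ← integral_const_mul]
  congr 1; ext t
  push_cast
  ring

theorem integrableOn_cpow_half_mul {s : ℂ} (hs : 0 ≤ s.re) (h0 : s ≠ 0) :
    IntegrableOn (fun t : ℝ =>
      (macWeight t : ℂ) * (s ^ (1 / 2 : ℂ) * (s + t / 2) ^ (-(1 / 2) : ℂ))) (Ioi 0) := by
  refine IntegrableOn.congr_fun
    ((macInt_integrableOn (a := 1 / 2) (by norm_num) hs h0).const_mul (s ^ (1 / 2 : ℂ)))
    (fun t _ => ?_) measurableSet_Ioi
  push_cast
  ring

theorem cpow_half_ratio_re_pos {s : ℂ} (hs : 0 ≤ s.re) (h0 : s ≠ 0) {t : ℝ} (ht : 0 ≤ t) :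
    0 < (s ^ (1 / 2 : ℂ) * (s + t / 2) ^ (-(1 / 2) : ℂ)).re :=
  cpow_half_mul_cpow_neg_half hs (add_half_re_nonneg hs ht) h0 (add_half_ne_zero hs h0 ht)
    (div_add_half_re_nonneg hs ht)

/-- Divide `ζ² - 1 = -(t/2)/(s + t/2)` by `ζ + 1`, where `|ζ + 1| ≥ 1` because `Re ζ > 0`. -/
theorem norm_cpow_half_ratio_sub_one_le {s : ℂ} (hs : 0 ≤ s.re) (h0 : s ≠ 0) {t : ℝ} (ht : 0 ≤ t) :
    ‖s ^ (1 / 2 : ℂ) * (s + t / 2) ^ (-(1 / 2) : ℂ) - 1‖ ≤ t / (2 * ‖s‖) := by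
  have hre := cpow_half_ratio_re_pos hs h0 ht
  set ζ := s ^ (1 / 2 : ℂ) * (s + t / 2) ^ (-(1 / 2) : ℂ) with hζ
  have hσ := add_half_ne_zero hs h0 ht
  have hn : 0 < ‖s‖ := norm_pos_iff.2 h0
  have hsq : ζ ^ 2 = s / (s + t / 2) := by
    rw [hζ, mul_pow, cpow_half_sq, Complex.cpow_neg, inv_pow, cpow_half_sq, ← div_eq_mul_inv]
  have hone : 1 ≤ ‖ζ + 1‖ := by
    have := Complex.abs_re_le_norm (ζ + 1)
    rw [Complex.add_re, Complex.one_re, abs_of_pos (by linarith)] at this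
    linarith
  have hprod : (ζ - 1) * (ζ + 1) = -(t / 2 : ℂ) / (s + t / 2) := by
    rw [show (ζ - 1) * (ζ + 1) = ζ ^ 2 - 1 by ring, hsq, div_sub_one hσ]
    congr 1
    ring
  have hnorm : ‖ζ - 1‖ * ‖ζ + 1‖ = t / 2 / ‖s + t / 2‖ := by
    rw [← norm_mul, hprod, norm_div, norm_neg]
    congr 1
    rw [show (t / 2 : ℂ) = ((t / 2 : ℝ) : ℂ) by push_cast; rfl, Complex.norm_real, Real.norm_eq_abs,
      abs_of_nonneg (by linarith)]
  calc ‖ζ - 1‖ ≤ ‖ζ - 1‖ * ‖ζ + 1‖ := le_mul_of_one_le_right (norm_nonneg _) hone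
    _ = t / 2 / ‖s + t / 2‖ := hnorm
    _ ≤ t / 2 / ‖s‖ := div_le_div_of_nonneg_left (by linarith) hn (norm_le_norm_add_half hs ht)
    _ = _ := by rw [div_div]

theorem norm_cpow_half_mul_macInt_sub_le {s : ℂ} (hs : 0 ≤ s.re) (h0 : s ≠ 0) :
    ‖s ^ (1 / 2 : ℂ) * macInt (1 / 2) s - √Real.pi‖ ≤ √Real.pi / (4 * ‖s‖) := by
  have e : (√Real.pi : ℂ) = ∫ t in Ioi (0 : ℝ), (macWeight t : ℂ) := by
    rw [← integral_macWeight]; exact integral_ofReal.symm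
  have hW : IntegrableOn (fun t => (macWeight t : ℂ)) (Ioi 0) := macWeight_integrableOn.ofReal
  rw [cpow_half_mul_macInt_eq, e, ← integral_sub (integrableOn_cpow_half_mul hs h0) hW,
    show √Real.pi / (4 * ‖s‖) = √Real.pi / 2 * (1 / (2 * ‖s‖)) by ring, ← integral_mul_macWeight,
    ← integral_mul_const]
  refine norm_integral_le_of_norm_le (mul_macWeight_integrableOn.mul_const _)
    ((ae_restrict_iff' measurableSet_Ioi).2 (.of_forall fun t ht => ?_))
  have hp := macWeight_pos ht
  have := norm_cpow_half_ratio_sub_one_le hs h0 (le_of_lt ht)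
  rw [← mul_sub_one, norm_mul, Complex.norm_real, Real.norm_eq_abs, abs_of_pos hp]
  calc _ ≤ macWeight t * (t / (2 * ‖s‖)) := mul_le_mul_of_nonneg_left this hp.le
    _ = _ := by ring

/-- After multiplication by `s^{1/2}` the integrand has positive real part. Thus the free Jost
solution never vanishes and may be divided out. -/
theorem macInt_half_ne_zero {s : ℂ} (hs : 0 ≤ s.re) (h0 : s ≠ 0) : macInt (1 / 2) s ≠ 0 := by
  intro h
  have e := cpow_half_mul_macInt_eq (s := s)
  rw [h, mul_zero] at e
  have e' := congrArg Complex.re e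
  have hi := integrableOn_cpow_half_mul hs h0
  have h1 := Complex.reCLM.integral_comp_comm hi
  simp only [Complex.reCLM_apply] at h1
  rw [← h1, Complex.zero_re] at e'
  have hpos : 0 < ∫ t in Ioi (0 : ℝ),
      ((macWeight t : ℂ) * (s ^ (1 / 2 : ℂ) * (s + t / 2) ^ (-(1 / 2) : ℂ))).re := by
    have hp : ∀ t ∈ Ioi (0 : ℝ),
        0 < ((macWeight t : ℂ) * (s ^ (1 / 2 : ℂ) * (s + t / 2) ^ (-(1 / 2) : ℂ))).re :=
      fun t ht => by
        rw [Complex.re_ofReal_mul]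
        exact mul_pos (macWeight_pos ht) (cpow_half_ratio_re_pos hs h0 (le_of_lt ht))
    rw [setIntegral_pos_iff_support_of_nonneg_ae
      ((ae_restrict_iff' measurableSet_Ioi).2 (.of_forall fun t ht => (hp t ht).le)) hi.re]
    refine lt_of_lt_of_le (by simp : (0 : ENNReal) < volume (Ioi (0 : ℝ))) (measure_mono fun t ht =>
      ⟨(hp t ht).ne', ht⟩)
  exact hpos.ne e'

theorem one_le_sqrt_pi : 1 ≤ √Real.pi := by
  rw [Real.one_le_sqrt]; linarith [Real.pi_gt_three]

theorem sqrt_pi_ne_zero : (√Real.pi : ℂ) ≠ 0 :=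
  Complex.ofReal_ne_zero.2 (by linarith [one_le_sqrt_pi])

theorem norm_sqrt_pi : ‖(√Real.pi : ℂ)‖ = √Real.pi := by
  rw [Complex.norm_real, Real.norm_eq_abs, abs_of_nonneg (Real.sqrt_nonneg _)]

/-- `e^s` times the Macdonald function `√(2/π) K₀(s)`. -/
noncomputable def macP (s : ℂ) : ℂ := macInt (1 / 2) s / √Real.pi

/-- The derivative of `macP`. -/
noncomputable def macP₁ (s : ℂ) : ℂ := -(1 / 2) * macInt (3 / 2) s / √Real.pi

/-- `√s e^s` times the Macdonald function `√(2/π) K₀(s)`. -/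
noncomputable def macH (s : ℂ) : ℂ := s ^ (1 / 2 : ℂ) * macP s

/-- The derivative of `macH`. -/
noncomputable def macH₁ (s : ℂ) : ℂ := s ^ (-(1 / 2) : ℂ) * (1 / 2 * macP s + s * macP₁ s)

/-- The Macdonald function `√(2/π) K₀(s)`. -/
noncomputable def macPsi (s : ℂ) : ℂ := Complex.exp (-s) * macP s

/-- The derivative of `macPsi`. -/
noncomputable def macPsi₁ (s : ℂ) : ℂ := Complex.exp (-s) * (macP₁ s - macP s)

theorem hasDerivAt_macP {s : ℂ} (hs : 0 ≤ s.re) (h0 : s ≠ 0) : HasDerivAt macP (macP₁ s) s := by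
  refine ((hasDerivAt_macInt (a := 1 / 2) (by norm_num) hs h0).div_const (√Real.pi : ℂ)).congr_deriv ?_
  rw [macP₁, show (1 / 2 + 1 : ℝ) = 3 / 2 by norm_num]
  push_cast
  ring

theorem hasDerivAt_macP₁ {s : ℂ} (hs : 0 ≤ s.re) (h0 : s ≠ 0) :
    HasDerivAt macP₁ ((macP s - (1 - 2 * s) * macP₁ s) / s) s := by
  refine (((hasDerivAt_macInt (a := 3 / 2) (by norm_num) hs h0).const_mul (-(1 / 2) : ℂ)).div_const
    (√Real.pi : ℂ)).congr_deriv ?_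
  have := macInt_ode hs h0
  rw [macP₁, macP, show (3 / 2 + 1 : ℝ) = 5 / 2 by norm_num]
  have hpi := sqrt_pi_ne_zero
  field_simp
  push_cast
  linear_combination 2 * this

theorem macP_ne_zero {s : ℂ} (hs : 0 ≤ s.re) (h0 : s ≠ 0) : macP s ≠ 0 := div_ne_zero (macInt_half_ne_zero hs h0) sqrt_pi_ne_zero

theorem norm_macP_le {s : ℂ} (hs : 0 ≤ s.re) (h0 : s ≠ 0) : ‖macP s‖ ≤ ‖s‖ ^ (-(1 / 2) : ℝ) := by
  rw [macP, norm_div, norm_sqrt_pi, div_le_iff₀ (by linarith [one_le_sqrt_pi]), mul_comm]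
  exact norm_macInt_half_le hs h0

theorem norm_half_macP_add_le {s : ℂ} (hs : 0 ≤ s.re) (h0 : s ≠ 0) :
    ‖1 / 2 * macP s + s * macP₁ s‖ ≤ 1 / 8 * ‖s‖ ^ (-(3 / 2) : ℝ) := by
  have e : 1 / 2 * macP s + s * macP₁ s =
      (macInt (1 / 2) s - s * macInt (3 / 2) s) / (2 * √Real.pi) := by
    rw [macP, macP₁]; have := sqrt_pi_ne_zero; field_simp; ring
  have h1 := one_le_sqrt_pi
  rw [e, norm_div, norm_mul 2, norm_sqrt_pi, Complex.norm_ofNat, div_le_iff₀ (by positivity)]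
  refine (norm_macInt_half_sub_le hs h0).trans (le_of_eq ?_)
  ring

theorem norm_mul_macP₁_le {s : ℂ} (hs : 0 ≤ s.re) (h0 : s ≠ 0) : ‖s * macP₁ s‖ ≤ 3 := by
  have e : s * macP₁ s = -(s * macInt (3 / 2) s) / (2 * √Real.pi) := by
    rw [macP₁]; have := sqrt_pi_ne_zero; field_simp
  have h1 := one_le_sqrt_pi
  rw [e, norm_div, norm_mul 2, norm_neg, norm_sqrt_pi, Complex.norm_ofNat, div_le_iff₀ (by positivity)]
  have := norm_mul_macInt_three_halves_le hs h0
  linarith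

theorem hasDerivAt_macH {s : ℂ} (hs : 0 ≤ s.re) (h0 : s ≠ 0) : HasDerivAt macH (macH₁ s) s := by
  refine (((hasDerivAt_id' s).cpow_const (c := 1 / 2) (mem_slitPlane_of_re_nonneg hs h0)).mul
    (hasDerivAt_macP hs h0)).congr_deriv ?_
  have e : s ^ (1 / 2 : ℂ) = s * s ^ (-(1 / 2) : ℂ) := by
    rw [← cpow_one_add _ h0]; norm_num
  rw [macH₁, show (1 / 2 - 1 : ℂ) = -(1 / 2) by norm_num, e]
  ring

theorem hasDerivAt_macH₁ {s : ℂ} (hs : 0 ≤ s.re) (h0 : s ≠ 0) : HasDerivAt macH₁ (2 * macH₁ s - macH s / (4 * s ^ 2)) s := by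
  refine (((hasDerivAt_id' s).cpow_const (c := -(1 / 2)) (mem_slitPlane_of_re_nonneg hs h0)).mul
    (((hasDerivAt_macP hs h0).const_mul (1 / 2 : ℂ)).add
      ((hasDerivAt_id' s).mul (hasDerivAt_macP₁ hs h0)))).congr_deriv ?_
  have e : s ^ (-(1 / 2) : ℂ) = s * s ^ (-(1 / 2) - 1 : ℂ) := by
    rw [← cpow_one_add _ h0]; norm_num
  have e' : s ^ (1 / 2 : ℂ) = s * s ^ (-(1 / 2) : ℂ) := by
    rw [← cpow_one_add _ h0]; norm_num
  rw [macH₁, macH, e', e]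
  generalize s ^ (-(1 / 2) - 1 : ℂ) = A
  simp only [Pi.add_apply, Pi.mul_apply]
  field_simp
  ring

theorem macH_ne_zero {s : ℂ} (hs : 0 ≤ s.re) (h0 : s ≠ 0) : macH s ≠ 0 :=
  mul_ne_zero (fun h => h0 (by rw [← cpow_half_sq s, h]; norm_num)) (macP_ne_zero hs h0)

theorem norm_cpow_half {s : ℂ} : ‖s ^ (1 / 2 : ℂ)‖ = ‖s‖ ^ (1 / 2 : ℝ) := by
  rw [← Complex.norm_cpow_real]; norm_num

theorem norm_cpow_neg_half {s : ℂ} : ‖s ^ (-(1 / 2) : ℂ)‖ = ‖s‖ ^ (-(1 / 2) : ℝ) := by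
  rw [← Complex.norm_cpow_real]; norm_num

theorem norm_macH_le {s : ℂ} (hs : 0 ≤ s.re) (h0 : s ≠ 0) : ‖macH s‖ ≤ 1 := by
  rw [macH, norm_mul, norm_cpow_half]
  calc _ ≤ ‖s‖ ^ (1 / 2 : ℝ) * ‖s‖ ^ (-(1 / 2) : ℝ) := by gcongr; exact norm_macP_le hs h0
    _ = 1 := by rw [← Real.rpow_add (norm_pos_iff.2 h0)]; norm_num

theorem norm_macH₁_le {s : ℂ} (hs : 0 ≤ s.re) (h0 : s ≠ 0) : ‖macH₁ s‖ ≤ 1 / (8 * ‖s‖ ^ 2) := by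
  rw [macH₁, norm_mul, norm_cpow_neg_half]
  calc _ ≤ ‖s‖ ^ (-(1 / 2) : ℝ) * (1 / 8 * ‖s‖ ^ (-(3 / 2) : ℝ)) := by
        gcongr; exact norm_half_macP_add_le hs h0
    _ = 1 / 8 * ‖s‖ ^ (-2 : ℝ) := by
        rw [mul_left_comm, ← Real.rpow_add (norm_pos_iff.2 h0)]; norm_num
    _ = _ := by
        rw [Real.rpow_neg (norm_nonneg _), show (2 : ℝ) = ((2 : ℕ) : ℝ) by norm_num, Real.rpow_natCast]
        field_simp

theorem norm_macH_sub_one_le {s : ℂ} (hs : 0 ≤ s.re) (h0 : s ≠ 0) : ‖macH s - 1‖ ≤ 1 / (4 * ‖s‖) := by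
  have h1 := one_le_sqrt_pi
  have e : macH s - 1 = (s ^ (1 / 2 : ℂ) * macInt (1 / 2) s - √Real.pi) / √Real.pi := by
    rw [macH, macP]; have := sqrt_pi_ne_zero; field_simp
  rw [e, norm_div, norm_sqrt_pi, div_le_iff₀ (by linarith)]
  exact (norm_cpow_half_mul_macInt_sub_le hs h0).trans (le_of_eq (by ring))

theorem macPsi_eq {s : ℂ} (h0 : s ≠ 0) : macPsi s = s ^ (-(1 / 2) : ℂ) * (Complex.exp (-s) * macH s) := by
  have : s ^ (-(1 / 2) : ℂ) * s ^ (1 / 2 : ℂ) = 1 := by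
    rw [← Complex.cpow_add _ _ h0]; norm_num
  rw [macH, macPsi]
  linear_combination (-(Complex.exp (-s) * macP s)) * this

theorem hasDerivAt_macPsi {s : ℂ} (hs : 0 ≤ s.re) (h0 : s ≠ 0) : HasDerivAt macPsi (macPsi₁ s) s := by
  refine ((hasDerivAt_neg s).cexp.mul (hasDerivAt_macP hs h0)).congr_deriv ?_
  rw [macPsi₁]; ring

/-- The modified Bessel equation of order zero in the form `(s ψ')' = s ψ`. -/
theorem hasDerivAt_mul_macPsi₁ {s : ℂ} (hs : 0 ≤ s.re) (h0 : s ≠ 0) : HasDerivAt (fun s => s * macPsi₁ s) (s * macPsi s) s := by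
  refine ((hasDerivAt_id' s).mul ((hasDerivAt_neg s).cexp.mul
    ((hasDerivAt_macP₁ hs h0).sub (hasDerivAt_macP hs h0)))).congr_deriv ?_
  rw [macPsi]
  simp only [Pi.sub_apply, Pi.mul_apply]
  field_simp
  ring

theorem norm_exp_neg_le_one {s : ℂ} (hs : 0 ≤ s.re) : ‖Complex.exp (-s)‖ ≤ 1 := by
  rw [Complex.norm_exp, Complex.neg_re]; exact Real.exp_le_one_iff.2 (by linarith)

theorem norm_mul_macPsi₁_le {s : ℂ} (hs : 0 ≤ s.re) (h0 : s ≠ 0) (h2 : ‖s‖ ≤ 2) : ‖s * macPsi₁ s‖ ≤ 5 := by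
  have hP : ‖s * macP s‖ ≤ 2 := by
    rw [norm_mul]
    calc _ ≤ ‖s‖ * ‖s‖ ^ (-(1 / 2) : ℝ) := by gcongr; exact norm_macP_le hs h0
      _ = ‖s‖ ^ (1 / 2 : ℝ) := by
        rw [← Real.rpow_one_add' (norm_nonneg _) (by norm_num)]; norm_num
      _ ≤ 2 ^ (1 : ℝ) := by
        refine (Real.rpow_le_rpow (norm_nonneg _) h2 (by norm_num)).trans ?_
        exact Real.rpow_le_rpow_of_exponent_le (by norm_num) (by norm_num)
      _ = 2 := by norm_num
  rw [macPsi₁, show s * (Complex.exp (-s) * (macP₁ s - macP s)) =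
    Complex.exp (-s) * (s * macP₁ s - s * macP s) by ring, norm_mul]
  calc _ ≤ 1 * ‖s * macP₁ s - s * macP s‖ := by gcongr; exact norm_exp_neg_le_one hs
    _ ≤ ‖s * macP₁ s‖ + ‖s * macP s‖ := by rw [one_mul]; exact norm_sub_le _ _
    _ ≤ 5 := by linarith [norm_mul_macP₁_le hs h0]

/-- Along the ray `s = e^τ σ` with `|σ| = 1`, the `τ`-derivative of `ψ` is `s ψ'(s)`, which is at
most `5`; start from `|ψ(σ)| ≤ 1` and move a distance `|log |s||` in `τ`. -/
theorem norm_macPsi_le {s : ℂ} (hs : 0 ≤ s.re) (h0 : s ≠ 0) (h2 : ‖s‖ ≤ 2) : ‖macPsi s‖ ≤ 5 * (1 + |Real.log ‖s‖|) := by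
  have hn : 0 < ‖s‖ := norm_pos_iff.2 h0
  set σ : ℂ := s / ‖s‖ with hσ
  have hσre : 0 ≤ σ.re := by
    rw [hσ, Complex.div_ofReal_re]; exact div_nonneg hs hn.le
  have hσn : ‖σ‖ = 1 := by
    rw [hσ, norm_div, Complex.norm_real, norm_norm, div_self hn.ne']
  have hpt : ∀ τ : ℝ, 0 ≤ ((Real.exp τ : ℂ) * σ).re ∧ (Real.exp τ : ℂ) * σ ≠ 0 ∧
      ‖(Real.exp τ : ℂ) * σ‖ = Real.exp τ := fun τ => by
    have hnorm : ‖(Real.exp τ : ℂ) * σ‖ = Real.exp τ := by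
      rw [norm_mul, hσn, mul_one, Complex.norm_real, Real.norm_eq_abs, abs_of_pos (Real.exp_pos _)]
    refine ⟨?_, ?_, hnorm⟩
    · rw [Complex.re_ofReal_mul]; exact mul_nonneg (Real.exp_pos _).le hσre
    · rw [← norm_pos_iff, hnorm]; exact Real.exp_pos _
  have hder : ∀ τ : ℝ, HasDerivAt (fun τ : ℝ => macPsi ((Real.exp τ : ℂ) * σ))
      (((Real.exp τ : ℂ) * σ) * macPsi₁ ((Real.exp τ : ℂ) * σ)) τ := fun τ => by
    have h1 : HasDerivAt (fun τ : ℝ => (Real.exp τ : ℂ) * σ) ((Real.exp τ : ℂ) * σ) τ :=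
      (Real.hasDerivAt_exp τ).ofReal_comp.mul_const σ
    exact (HasDerivAt.comp τ (hasDerivAt_macPsi (hpt τ).1 (hpt τ).2.1) h1).congr_deriv (mul_comm _ _)
  have hlog : Real.log ‖s‖ ≤ Real.log 2 := Real.log_le_log hn h2
  have hle2 : ∀ τ ∈ uIcc 0 (Real.log ‖s‖), ‖(Real.exp τ : ℂ) * σ‖ ≤ 2 := fun τ hτ => by
    rw [(hpt τ).2.2]
    calc Real.exp τ ≤ Real.exp (Real.log 2) := Real.exp_le_exp.2
          (hτ.2.trans (max_le (Real.log_nonneg (by norm_num)) hlog))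
      _ = 2 := Real.exp_log (by norm_num)
  have hmv := Convex.norm_image_sub_le_of_norm_hasDerivWithin_le (C := 5)
    (fun τ _ => (hder τ).hasDerivWithinAt)
    (fun τ hτ => norm_mul_macPsi₁_le (hpt τ).1 (hpt τ).2.1 (hle2 τ hτ))
    (convex_uIcc 0 (Real.log ‖s‖)) left_mem_uIcc right_mem_uIcc
  simp only [Real.exp_zero, Complex.ofReal_one, one_mul, sub_zero] at hmv
  have hs' : ((Real.exp (Real.log ‖s‖) : ℝ) : ℂ) * σ = s := by
    rw [Real.exp_log hn, hσ, mul_div_cancel₀]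
    exact Complex.ofReal_ne_zero.2 hn.ne'
  rw [hs'] at hmv
  have h1 : ‖macPsi σ‖ ≤ 1 := by
    have hσ0 : σ ≠ 0 := by rw [← norm_pos_iff, hσn]; exact one_pos
    rw [macPsi, norm_mul]
    have := norm_macP_le hσre hσ0
    rw [hσn, Real.one_rpow] at this
    exact mul_le_one₀ (norm_exp_neg_le_one hσre) (norm_nonneg _) this
  have := norm_le_norm_add_norm_sub' (macPsi s) (macPsi σ)
  rw [Real.norm_eq_abs] at hmv
  linarith [abs_nonneg (Real.log ‖s‖)]

/-! ### Logarithmic weights and the norm of the perturbation -/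

/-- The perturbation is measurable and `x (1 + |log x|) q` is integrable on `(0, ∞)`. -/
structure IsLogIntegrable (q : ℝ → ℝ) : Prop where
  aestronglyMeasurable : AEStronglyMeasurable q (volume.restrict (Ioi 0))
  integrableOn : IntegrableOn (fun x => x * (1 + |Real.log x|) * |q x|) (Ioi 0)

/-- The norm `∫₀^∞ x (1 + |log x|) |q x| dx`. -/
noncomputable def logNorm (q : ℝ → ℝ) : ℝ := ∫ x in Ioi (0 : ℝ), x * (1 + |Real.log x|) * |q x|

/-- The weight `1 + log⁺ x`. -/
noncomputable def logWeight (x : ℝ) : ℝ := 1 + Real.log (max x 1)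

theorem continuous_logWeight : Continuous logWeight :=
  continuous_const.add ((continuous_id.max continuous_const).log fun x =>
    (lt_of_lt_of_le one_pos (le_max_right x 1)).ne')

theorem one_le_logWeight (x : ℝ) : 1 ≤ logWeight x := by
  have := Real.log_nonneg (le_max_right x 1)
  rw [logWeight]; linarith

theorem logWeight_pos (x : ℝ) : 0 < logWeight x := one_pos.trans_le (one_le_logWeight x)

theorem logWeight_mono : Monotone logWeight := fun x y h => by
  have := Real.log_le_log (lt_of_lt_of_le one_pos (le_max_right x 1)) (max_le_max_right 1 h)
  rw [logWeight, logWeight]; linarith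

theorem logWeight_le {x : ℝ} : logWeight x ≤ 1 + |Real.log x| := by
  rw [logWeight]
  rcases le_total x 1 with h | h
  · rw [max_eq_right h, Real.log_one]; linarith [abs_nonneg (Real.log x)]
  · rw [max_eq_left h]; linarith [le_abs_self (Real.log x)]

/-- This makes the kernel of the regular solution, conjugated by `1 + log⁺`, dominated by `y (1 +
|log y|) |q y|` independently of `x`. For `y ≤ 1` use `log (x/y) ≤ log⁺ x + |log y|`; for `y ≥ 1`
use `log (x/y) ≤ log x`. -/
theorem log_div_mul_logWeight_le {x y : ℝ} (hy : 0 < y) (hxy : y ≤ x) :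
    Real.log (x / y) * logWeight y ≤ logWeight x * (1 + |Real.log y|) := by
  have hx : 0 < x := hy.trans_le hxy
  rw [Real.log_div hx.ne' hy.ne']
  have h1 : Real.log x ≤ Real.log (max x 1) := Real.log_le_log hx (le_max_left _ _)
  have h2 : 0 ≤ Real.log (max x 1) := Real.log_nonneg (le_max_right x 1)
  have h3 := abs_nonneg (Real.log y)
  rcases le_total y 1 with h | h
  · have : logWeight y = 1 := by rw [logWeight, max_eq_right h, Real.log_one, add_zero]
    rw [this, logWeight]
    nlinarith [neg_abs_le (Real.log y), mul_nonneg h2 h3]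
  · have e : logWeight y = 1 + |Real.log y| := by
      rw [logWeight, max_eq_left h, abs_of_nonneg (Real.log_nonneg h)]
    rw [e, logWeight]
    refine mul_le_mul_of_nonneg_right ?_ (by linarith)
    linarith [Real.log_nonneg h]

namespace IsLogIntegrable

theorem mul_integrableOn {q : ℝ → ℝ} (hq : IsLogIntegrable q) : IntegrableOn (fun x => x * |q x|) (Ioi 0) := by
  refine hq.integrableOn.mono' ?_ ((ae_restrict_iff' measurableSet_Ioi).2 (.of_forall fun x hx => ?_))
  · exact aestronglyMeasurable_id.mul hq.aestronglyMeasurable.norm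
  · have hx0 : (0 : ℝ) < x := hx
    rw [Real.norm_eq_abs, abs_of_nonneg (by positivity)]
    refine mul_le_mul_of_nonneg_right ?_ (abs_nonneg _)
    nlinarith [abs_nonneg (Real.log x)]

end IsLogIntegrable

theorem logNorm_nonneg (q : ℝ → ℝ) : 0 ≤ logNorm q :=
  setIntegral_nonneg measurableSet_Ioi fun x hx => by
    have hx0 : (0 : ℝ) < x := hx
    positivity

/-! ### The regular solution: integral equation, bounds, dependence on the energy -/

/-- Majorant of the Volterra kernels on `(0, X)`. -/
noncomputable def regBound (q : ℝ → ℝ) (z : ℂ) (X : ℝ) (y : ℝ) : ℝ :=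
  (Ioo 0 X).indicator (fun y => y * (1 + |Real.log y|) * |q y| + ‖z‖ * X) y

theorem integrable_regBound {q : ℝ → ℝ} (hq : IsLogIntegrable q) (z : ℂ) (X : ℝ) :
    Integrable (regBound q z X) := by
  refine (integrable_indicator_iff measurableSet_Ioo).2 (Integrable.add
    (hq.integrableOn.mono_set Ioo_subset_Ioi_self) ?_)
  exact integrableOn_const (by simp)

theorem integral_regBound_le {q : ℝ → ℝ} (hq : IsLogIntegrable q) (z : ℂ) {X : ℝ} (hX : 0 < X) :
    ∫ y, regBound q z X y ≤ logNorm q + ‖z‖ * X ^ 2 := by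
  unfold regBound
  have h1 := hq.integrableOn.mono_set (Ioo_subset_Ioi_self : Ioo 0 X ⊆ Ioi 0)
  have h2 : IntegrableOn (fun _ : ℝ => ‖z‖ * X) (Ioo 0 X) := integrableOn_const (by simp)
  rw [integral_indicator measurableSet_Ioo, integral_add h1 h2]
  refine add_le_add (setIntegral_mono_set hq.integrableOn
    ((ae_restrict_iff' measurableSet_Ioi).2 (.of_forall fun x hx => ?_))
    (Ioo_subset_Ioi_self.eventuallyLE)) ?_
  · have hx0 : (0 : ℝ) < x := hx
    simp only [Pi.zero_apply]
    positivity
  · rw [setIntegral_const]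
    simp [hX.le]
    exact le_of_eq (by ring)

/-- The Volterra kernel `y log (x / y) (q y - z)` of the regular solution on `(0, X]`, conjugated
by the weight `1 + log⁺`. -/
noncomputable def regKernel (q : ℝ → ℝ) (X : ℝ) (z : ℂ) (x y : ℝ) : ℂ :=
  (Ioo 0 X).indicator (fun y => ((y * Real.log (max (min x X / y) 1) * logWeight y
    / logWeight (min x X) : ℝ) : ℂ) * ((q y : ℂ) - z)) y

/-- Two bounds on the same `k`: `y (1 + |log y|)` is used against `q`, while the constant `X` is
used against `z`. Integrated over `(0, X)`, the latter contributes the scale-invariant quantity `‖z‖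
X²`. -/
theorem isKernel_of_le_regBound {q : ℝ → ℝ} (hq : IsLogIntegrable q) {X : ℝ} (z : ℂ)
    {k : ℝ → ℝ → ℝ} (hk : ∀ x, ContinuousOn (k x) (Ioo 0 X))
    (hc : ∀ y ∈ Ioo 0 X, Continuous fun x => k x y) (h0 : ∀ x, ∀ y ∈ Ioo 0 X, 0 ≤ k x y)
    (h1 : ∀ x, ∀ y ∈ Ioo 0 X, k x y ≤ y * (1 + |Real.log y|))
    (h2 : ∀ x, ∀ y ∈ Ioo 0 X, k x y ≤ X) :
    IsKernel (fun x => (Ioo 0 X).indicator fun y => ((k x y : ℝ) : ℂ) * ((q y : ℂ) - z))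
      (regBound q z X) where
  aestronglyMeasurable x := by
    refine (aestronglyMeasurable_indicator_iff measurableSet_Ioo).2 (AEStronglyMeasurable.mul ?_ ?_)
    · exact (Complex.continuous_ofReal.comp_continuousOn (hk x)).aestronglyMeasurable measurableSet_Ioo
    · exact (Complex.continuous_ofReal.comp_aestronglyMeasurable
        (hq.aestronglyMeasurable.mono_measure (Measure.restrict_mono Ioo_subset_Ioi_self le_rfl))).sub
        aestronglyMeasurable_const
  continuous y := by
    by_cases hy : y ∈ Ioo 0 X
    · simp only [indicator_of_mem hy]
      exact (Complex.continuous_ofReal.comp (hc y hy)).mul continuous_const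
    · simp only [indicator_of_notMem hy]
      exact continuous_const
  bound x y := by
    by_cases hy : y ∈ Ioo 0 X
    · simp only [indicator_of_mem hy, regBound]
      rw [norm_mul, Complex.norm_real, Real.norm_eq_abs, abs_of_nonneg (h0 x y hy)]
      have hn : ‖(q y : ℂ) - z‖ ≤ |q y| + ‖z‖ := by
        refine (norm_sub_le _ _).trans ?_
        rw [Complex.norm_real, Real.norm_eq_abs]
      calc k x y * ‖(q y : ℂ) - z‖ ≤ k x y * |q y| + k x y * ‖z‖ := by
            rw [← mul_add]; exact mul_le_mul_of_nonneg_left hn (h0 x y hy)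
        _ ≤ y * (1 + |Real.log y|) * |q y| + X * ‖z‖ := add_le_add
            (mul_le_mul_of_nonneg_right (h1 x y hy) (abs_nonneg _))
            (mul_le_mul_of_nonneg_right (h2 x y hy) (norm_nonneg _))
        _ = _ := by ring
    · simp [indicator_of_notMem hy, regBound]
  integrable := integrable_regBound hq z X

/-- The bound by `X` comes from `y log (x / y) ≤ x - y`. -/
theorem log_max_div_mul_le {x X y : ℝ} (hx : x ≤ X) (hy : y ∈ Ioo 0 X) :
    0 ≤ Real.log (max (x / y) 1) ∧
    y * Real.log (max (x / y) 1) * logWeight y / logWeight x ≤ y * (1 + |Real.log y|) ∧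
    y * Real.log (max (x / y) 1) * logWeight y / logWeight x ≤ X := by
  have hlog : 0 ≤ Real.log (max (x / y) 1) := Real.log_nonneg (le_max_right _ _)
  refine ⟨hlog, ?_⟩
  have hw := logWeight_pos x
  have hX : 0 < X := hy.1.trans hy.2
  rcases le_total x y with h | h
  · have : max (x / y) 1 = 1 := max_eq_right ((div_le_one hy.1).2 h)
    rw [this, Real.log_one]
    constructor
    · simp only [mul_zero, zero_mul, zero_div]
      exact mul_nonneg hy.1.le (by positivity)
    · simpa using hX.le
  · have : max (x / y) 1 = x / y := max_eq_left ((one_le_div hy.1).2 h)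
    rw [this] at hlog ⊢
    constructor
    · rw [div_le_iff₀ hw, mul_assoc, mul_assoc]
      refine mul_le_mul_of_nonneg_left ?_ hy.1.le
      rw [mul_comm (1 + _)]
      exact log_div_mul_logWeight_le hy.1 h
    · rw [div_le_iff₀ hw]
      have h1 : Real.log (x / y) ≤ x / y - 1 :=
        Real.log_le_sub_one_of_pos (div_pos (hy.1.trans_le h) hy.1)
      have h2 : y * Real.log (x / y) ≤ X := by
        calc y * Real.log (x / y) ≤ y * (x / y - 1) := mul_le_mul_of_nonneg_left h1 hy.1.le
          _ = x - y := by have := hy.1.ne'; field_simp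
          _ ≤ X := by linarith [hy.1]
      exact mul_le_mul h2 (logWeight_mono h) (logWeight_pos y).le hX.le

theorem isKernel_regKernel {q : ℝ → ℝ} (hq : IsLogIntegrable q) (X : ℝ) (z : ℂ) : IsKernel (regKernel q X z) (regBound q z X) := by
  refine isKernel_of_le_regBound hq z (k := fun x y => y * Real.log (max (min x X / y) 1) * logWeight y
    / logWeight (min x X)) (fun x => ?_) (fun y hy => ?_) (fun x y hy => ?_) (fun x y hy => ?_)
    (fun x y hy => ?_)
  · refine ContinuousOn.div_const (ContinuousOn.mul (continuousOn_id.mul ?_)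
      continuous_logWeight.continuousOn) _
    refine ContinuousOn.log ?_ fun y _ => (lt_of_lt_of_le one_pos (le_max_right _ 1)).ne'
    have hdiv : ContinuousOn (fun y => min x X / y) (Ioo 0 X) :=
      continuousOn_const.div continuousOn_id fun y hy => hy.1.ne'
    exact hdiv.sup continuousOn_const
  · refine Continuous.div ((continuous_const.mul ?_).mul continuous_const)
      (continuous_logWeight.comp (continuous_id.min continuous_const)) fun x => (logWeight_pos _).ne'
    refine Continuous.log ?_ fun y => (lt_of_lt_of_le one_pos (le_max_right _ 1)).ne'
    exact ((continuous_id.min continuous_const).div_const _).max continuous_const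
  · have := (log_max_div_mul_le (min_le_right x X) hy).1
    have := logWeight_pos y
    have := logWeight_pos (min x X)
    have := hy.1
    positivity
  · exact (log_max_div_mul_le (min_le_right x X) hy).2.1
  · exact (log_max_div_mul_le (min_le_right x X) hy).2.2

theorem isUnit_one_sub_regKernel {q : ℝ → ℝ} (hq : IsLogIntegrable q) {X : ℝ} (hX : 0 < X) (z : ℂ) :
    IsUnit (1 - kernelOp (regKernel q X z)) ∧ ‖Ring.inverse (1 - kernelOp (regKernel q X z))‖
      ≤ 2 * Real.exp (2 * (logNorm q + ‖z‖ * X ^ 2)) := by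
  have h := (isKernel_regKernel hq X z).isUnit_one_sub_of_lower (fun x y hxy => by
    unfold regKernel
    by_cases hy : y ∈ Ioo 0 X
    · have : max (min x X / y) 1 = 1 :=
        max_eq_right ((div_le_one hy.1).2 ((min_le_left _ _).trans hxy))
      simp [indicator_of_mem hy, this]
    · simp [indicator_of_notMem hy])
  refine ⟨h.1, h.2.trans ?_⟩
  have := integral_regBound_le hq z hX
  gcongr

/-- The kernel is affine in `z`, so its first-order expansion is exact and the remainder majorants
can be taken to be zero. -/
theorem differentiableAt_kernelOp_of_affine {q : ℝ → ℝ} (hq : IsLogIntegrable q) {X : ℝ} {k : ℝ → ℝ → ℝ}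
    (hk : ∀ z, IsKernel (fun x => (Ioo 0 X).indicator fun y => ((k x y : ℝ) : ℂ) * ((q y : ℂ) - z))
      (regBound q z X)) (z : ℂ) :
    DifferentiableAt ℂ (fun z => kernelOp fun x =>
      (Ioo 0 X).indicator fun y => ((k x y : ℝ) : ℂ) * ((q y : ℂ) - z)) z := by
  -- The `z`-derivative `-k` is the difference of the kernels at `z = 1` and `z = 0`, from which it
  -- inherits measurability, continuity and a majorant.
  have h1 : IsKernel (fun x => (Ioo 0 X).indicator fun y => -((k x y : ℝ) : ℂ))
      (fun y => regBound q 1 X y + regBound q 0 X y) := by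
    have e : ∀ x y, (Ioo 0 X).indicator (fun y => -((k x y : ℝ) : ℂ)) y =
        (Ioo 0 X).indicator (fun y => ((k x y : ℝ) : ℂ) * ((q y : ℂ) - 1)) y -
        (Ioo 0 X).indicator (fun y => ((k x y : ℝ) : ℂ) * ((q y : ℂ) - 0)) y := fun x y => by
      by_cases hy : y ∈ Ioo 0 X
      · simp only [indicator_of_mem hy]; ring
      · simp [indicator_of_notMem hy]
    exact
    { aestronglyMeasurable := fun x => (((hk 1).aestronglyMeasurable x).sub
        ((hk 0).aestronglyMeasurable x)).congr (.of_forall fun y => (e x y).symm)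
      continuous := fun y => (((hk 1).continuous y).sub ((hk 0).continuous y)).congr
        fun x => (e x y).symm
      bound := fun x y => by
        rw [e]; exact (norm_sub_le _ _).trans (add_le_add ((hk 1).bound x y) ((hk 0).bound x y))
      integrable := (integrable_regBound hq 1 X).add (integrable_regBound hq 0 X) }
  have := hasDerivWithinAt_kernelOp (S := univ) (κ₀ := z) (σ := fun _ => 0) (τ := fun _ => 0)
    (K := fun z x => (Ioo 0 X).indicator fun y => ((k x y : ℝ) : ℂ) * ((q y : ℂ) - z))
    (mem_univ z) (fun z _ => hk z) h1 (integrable_zero _ _ _) aestronglyMeasurable_const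
    (fun _ => le_rfl) (fun _ => le_rfl) (fun w _ x y => by
      refine le_of_eq_of_le (b := ‖(0 : ℂ)‖) (congrArg _ ?_) (by simp)
      by_cases hy : y ∈ Ioo 0 X
      · simp only [indicator_of_mem hy]; ring
      · simp [indicator_of_notMem hy])
  exact differentiableWithinAt_univ.1
    (HasDerivWithinAt.differentiableWithinAt (F := (ℝ →ᵇ ℂ) →L[ℂ] (ℝ →ᵇ ℂ)) this)

/-- The function `1 / (1 + log⁺ (min x X))`. -/
noncomputable def invLogWeight (X : ℝ) : ℝ →ᵇ ℂ :=
  BoundedContinuousFunction.ofNormedAddCommGroup (fun x => (((logWeight (min x X))⁻¹ : ℝ) : ℂ))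
    (Complex.continuous_ofReal.comp ((continuous_logWeight.comp
      (continuous_id.min continuous_const)).inv₀ fun _ => (logWeight_pos _).ne')) 1 fun x => by
    rw [Complex.norm_real, norm_inv, Real.norm_eq_abs, abs_of_pos (logWeight_pos _)]
    exact inv_le_one_of_one_le₀ (one_le_logWeight _)

theorem integral_regKernel_mul (q : ℝ → ℝ) {X : ℝ} (z : ℂ) (x : ℝ) (w : ℝ → ℂ) :
    ∫ y, regKernel q X z x y * w y = (((logWeight (min x X))⁻¹ : ℝ) : ℂ) *
      ∫ y in Ioo 0 (min x X), ((y * Real.log (min x X / y) : ℝ) : ℂ) * ((q y : ℂ) - z)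
        * (logWeight y * w y) := by
  have hsub : Ioo 0 (min x X) ⊆ Ioo 0 X := Ioo_subset_Ioo_right (min_le_right _ _)
  have e : ∀ y, regKernel q X z x y * w y = (Ioo 0 X).indicator (fun y =>
      ((y * Real.log (max (min x X / y) 1) * logWeight y
    / logWeight (min x X) : ℝ) : ℂ) * ((q y : ℂ) - z) * w y) y := fun y => by
    by_cases hy : y ∈ Ioo 0 X
    · simp [regKernel, indicator_of_mem hy]
    · simp [regKernel, indicator_of_notMem hy]
  simp_rw [e]
  rw [integral_indicator measurableSet_Ioo, ← integral_const_mul,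
    setIntegral_eq_of_subset_of_forall_sdiff_eq_zero measurableSet_Ioo hsub ?_]
  · refine setIntegral_congr_fun measurableSet_Ioo fun y hy => ?_
    have : max (min x X / y) 1 = min x X / y := max_eq_left ((one_le_div hy.1).2 hy.2.le)
    simp only [this]
    push_cast
    ring
  · intro y hy
    have hle : min x X ≤ y := by
      by_contra! h
      exact hy.2 ⟨hy.1.1, h⟩
    have : max (min x X / y) 1 = 1 := max_eq_right ((div_le_one hy.1.1).2 hle)
    simp [this]

/-- The integral equation of the regular solution, divided by `√x`, on `(-∞, X]`. -/
structure IsRegVolterra (q : ℝ → ℝ) (X : ℝ) (z : ℂ) (v : ℝ → ℂ) : Prop where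
  continuousOn : ContinuousOn v (Iic X)
  bounded : ∃ M, ∀ x ≤ X, ‖v x‖ ≤ M
  eq : ∀ x ≤ X, v x = 1 + ∫ y in Ioo 0 x, ((y * Real.log (x / y) : ℝ) : ℂ) * ((q y : ℂ) - z) * v y

theorem IsRegVolterra.mono {q : ℝ → ℝ} {X Y : ℝ} {z : ℂ} {v : ℝ → ℂ} (h : IsRegVolterra q X z v)
    (hY : Y ≤ X) : IsRegVolterra q Y z v where
  continuousOn := h.continuousOn.mono (Iic_subset_Iic.2 hY)
  bounded := h.bounded.imp fun _ hM x hx => hM x (hx.trans hY)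
  eq x hx := h.eq x (hx.trans hY)

/-- The weighted solution of the integral equation on `(0, X]`. -/
noncomputable def regSolOn (q : ℝ → ℝ) (X : ℝ) (z : ℂ) : ℝ →ᵇ ℂ :=
  Ring.inverse (1 - kernelOp (regKernel q X z)) (invLogWeight X)

theorem logWeight_ne_zero (x : ℝ) : (logWeight x : ℂ) ≠ 0 :=
  Complex.ofReal_ne_zero.2 (logWeight_pos x).ne'

theorem isRegVolterra_regSolOn {q : ℝ → ℝ} (hq : IsLogIntegrable q) {X : ℝ} (hX : 0 < X) (z : ℂ) :
    IsRegVolterra q X z fun x => logWeight x * regSolOn q X z x where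
  continuousOn := ((Complex.continuous_ofReal.comp continuous_logWeight).mul
    (regSolOn q X z).continuous).continuousOn
  bounded := ⟨logWeight X * ‖regSolOn q X z‖, fun x hx => by
    rw [norm_mul, Complex.norm_real, Real.norm_eq_abs, abs_of_pos (logWeight_pos x)]
    exact mul_le_mul (logWeight_mono hx) ((regSolOn q X z).norm_coe_le_norm x) (norm_nonneg _)
      (logWeight_pos X).le⟩
  eq x hx := by
    have h := (eq_inverse_one_sub_apply_iff (isUnit_one_sub_regKernel hq hX z).1
      (u := regSolOn q X z) (b := invLogWeight X)).1 rfl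
    have h2 := congrArg (fun u : ℝ →ᵇ ℂ => u x) h
    simp only [BoundedContinuousFunction.add_apply] at h2
    rw [(isKernel_regKernel hq X z).kernelOp_apply, integral_regKernel_mul, min_eq_left hx] at h2
    have e : invLogWeight X x = (((logWeight (min x X))⁻¹ : ℝ) : ℂ) := rfl
    rw [e, min_eq_left hx] at h2
    have hw := logWeight_ne_zero x
    rw [h2]
    push_cast
    field_simp

/-- Freezing `v` beyond `X` and dividing by the weight gives a bounded continuous fixed point, which
is unique because `1 - T` is invertible. -/
theorem IsRegVolterra.eq_regSolOn {q : ℝ → ℝ} (hq : IsLogIntegrable q) {X : ℝ} (hX : 0 < X) {z : ℂ}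
    {v : ℝ → ℂ} (h : IsRegVolterra q X z v) {x : ℝ} (hx : x ≤ X) :
    v x = logWeight x * regSolOn q X z x := by
  obtain ⟨M, hM⟩ := h.bounded
  let u : ℝ →ᵇ ℂ := BoundedContinuousFunction.ofNormedAddCommGroup
    (fun x => v (min x X) / logWeight (min x X))
    ((h.continuousOn.comp_continuous (continuous_id.min continuous_const) fun x =>
      min_le_right x X).div (Complex.continuous_ofReal.comp (continuous_logWeight.comp
        (continuous_id.min continuous_const))) fun x => logWeight_ne_zero _) M fun x => by
    rw [norm_div, Complex.norm_real, Real.norm_eq_abs, abs_of_pos (logWeight_pos _)]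
    exact (div_le_self (norm_nonneg _) (one_le_logWeight _)).trans (hM _ (min_le_right _ _))
  have hu : u = regSolOn q X z := by
    refine (eq_inverse_one_sub_apply_iff (isUnit_one_sub_regKernel hq hX z).1).2 ?_
    ext x
    simp only [BoundedContinuousFunction.add_apply]
    rw [(isKernel_regKernel hq X z).kernelOp_apply, integral_regKernel_mul]
    have e : ∫ y in Ioo 0 (min x X), ((y * Real.log (min x X / y) : ℝ) : ℂ) * ((q y : ℂ) - z)
        * (logWeight y * u y) = v (min x X) - 1 := by
      rw [h.eq _ (min_le_right x X), add_sub_cancel_left]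
      refine setIntegral_congr_fun measurableSet_Ioo fun y hy => ?_
      have hy' : min y X = y := min_eq_left (hy.2.le.trans (min_le_right _ _))
      have : u y = v y / logWeight y := by
        change v (min y X) / logWeight (min y X) = _
        rw [hy']
      simp only [this, mul_div_cancel₀ _ (logWeight_ne_zero y)]
    rw [e]
    change v (min x X) / logWeight (min x X) = (((logWeight (min x X))⁻¹ : ℝ) : ℂ) + _
    push_cast
    ring
  have := congrArg (fun w : ℝ →ᵇ ℂ => w x) hu
  have e2 : u x = v x / logWeight x := by
    change v (min x X) / logWeight (min x X) = _
    rw [min_eq_left hx]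
  simp only [e2] at this
  rw [← this, mul_div_cancel₀ _ (logWeight_ne_zero x)]

/-- The regular solution divided by `√(π x / 2)`. -/
noncomputable def regV (q : ℝ → ℝ) (z : ℂ) (x : ℝ) : ℂ := logWeight x * regSolOn q (max x 1) z x


/-- Solutions on different intervals agree on the smaller one, so the endpoint `max x 1` in the
definition is immaterial. -/
theorem regV_eq {q : ℝ → ℝ} (hq : IsLogIntegrable q) (z : ℂ) {x X : ℝ} (hX : 0 < X) (hx : x ≤ X) :
    regV q z x = logWeight x * regSolOn q X z x := by
  have h1 : 0 < max x 1 := lt_of_lt_of_le one_pos (le_max_right _ _)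
  have hY : 0 < min X (max x 1) := lt_min hX h1
  have hxY : x ≤ min X (max x 1) := le_min hx (le_max_left _ _)
  have a := ((isRegVolterra_regSolOn hq hX z).mono (min_le_left X (max x 1))).eq_regSolOn hq hY hxY
  have b := ((isRegVolterra_regSolOn hq h1 z).mono (min_le_right X (max x 1))).eq_regSolOn hq hY hxY
  rw [a, regV, b]

theorem isRegVolterra_regV {q : ℝ → ℝ} (hq : IsLogIntegrable q) (z : ℂ) {X : ℝ} (hX : 0 < X) :
    IsRegVolterra q X z (regV q z) := by
  have h := isRegVolterra_regSolOn hq hX z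
  have e : ∀ x ≤ X, regV q z x = logWeight x * regSolOn q X z x := fun x hx => regV_eq hq z hX hx
  refine ⟨h.continuousOn.congr e, h.bounded.imp fun M hM x hx => by rw [e x hx]; exact hM x hx,
    fun x hx => ?_⟩
  rw [e x hx]
  refine (h.eq x hx).trans (congrArg _ (setIntegral_congr_fun measurableSet_Ioo fun y hy => ?_))
  simp only [e y (hy.2.le.trans hx)]

theorem continuous_regV {q : ℝ → ℝ} (hq : IsLogIntegrable q) (z : ℂ) : Continuous (regV q z) := by
  refine continuous_iff_continuousAt.2 fun x => ?_
  have hX : 0 < max x 0 + 1 := by positivity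
  exact (isRegVolterra_regV hq z hX).continuousOn.continuousAt
    (Iic_mem_nhds (by linarith [le_max_left x 0]))

theorem regV_volterra {q : ℝ → ℝ} (hq : IsLogIntegrable q) (z : ℂ) (x : ℝ) :
    regV q z x = 1 + ∫ y in Ioo 0 x,
      ((y * Real.log (x / y) : ℝ) : ℂ) * ((q y : ℂ) - z) * regV q z y :=
  (isRegVolterra_regV hq z (lt_of_lt_of_le one_pos (le_max_right x 1))).eq x (le_max_left _ _)

theorem regV_of_nonpos {q : ℝ → ℝ} (hq : IsLogIntegrable q) (z : ℂ) {x : ℝ} (hx : x ≤ 0) :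
    regV q z x = 1 := by
  rw [regV_volterra hq, Ioo_eq_empty (not_lt.2 hx)]; simp

theorem norm_invLogWeight_le (X : ℝ) : ‖invLogWeight X‖ ≤ 1 :=
  BoundedContinuousFunction.norm_ofNormedAddCommGroup_le _ zero_le_one _

theorem norm_regV_le {q : ℝ → ℝ} (hq : IsLogIntegrable q) (z : ℂ) {x X : ℝ} (hX : 0 < X)
    (hx : x ≤ X) :
    ‖regV q z x‖ ≤ 2 * Real.exp (2 * (logNorm q + ‖z‖ * X ^ 2)) * logWeight x := by
  rw [regV_eq hq z hX hx, norm_mul, Complex.norm_real, Real.norm_eq_abs,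
    abs_of_pos (logWeight_pos x), mul_comm]
  refine mul_le_mul_of_nonneg_right ?_ (logWeight_pos x).le
  refine ((regSolOn q X z).norm_coe_le_norm x).trans ?_
  refine (ContinuousLinearMap.le_opNorm _ _).trans ?_
  calc _ ≤ 2 * Real.exp (2 * (logNorm q + ‖z‖ * X ^ 2)) * 1 :=
        mul_le_mul (isUnit_one_sub_regKernel hq hX z).2 (norm_invLogWeight_le X) (norm_nonneg _)
          (by positivity)
    _ = _ := mul_one _

/-- The two kernels differ by `z' - z` times a factor at most `X` on an interval of length `X`; the
resolvent identity does the rest. -/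
theorem norm_regV_sub_le {q : ℝ → ℝ} (hq : IsLogIntegrable q) (z z' : ℂ) {X : ℝ} (hX : 0 < X) :
    ‖regV q z X - regV q z' X‖ ≤ 2 * Real.exp (2 * (logNorm q + ‖z‖ * X ^ 2)) *
      (‖z - z'‖ * X ^ 2) * (2 * Real.exp (2 * (logNorm q + ‖z'‖ * X ^ 2))) * logWeight X := by
  rw [regV_eq hq z hX le_rfl, regV_eq hq z' hX le_rfl, ← mul_sub, norm_mul, Complex.norm_real,
    Real.norm_eq_abs, abs_of_pos (logWeight_pos X), mul_comm]
  refine mul_le_mul_of_nonneg_right ?_ (logWeight_pos X).le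
  have hT : ‖kernelOp (regKernel q X z) - kernelOp (regKernel q X z')‖ ≤ ‖z - z'‖ * X ^ 2 := by
    have hint : Integrable ((Ioo 0 X).indicator fun _ : ℝ => ‖z - z'‖ * X) :=
      (integrable_indicator_iff measurableSet_Ioo).2 (integrableOn_const (by simp))
    refine ((isKernel_regKernel hq X z).norm_kernelOp_sub_le (isKernel_regKernel hq X z') hint
      fun x y => ?_).trans ?_
    · by_cases hy : y ∈ Ioo 0 X
      · simp only [regKernel, indicator_of_mem hy]
        have h := log_max_div_mul_le (min_le_right x X) hy
        have hk0 : 0 ≤ y * Real.log (max (min x X / y) 1) * logWeight y / logWeight (min x X) := by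
          have := h.1
          have := logWeight_pos y
          have := logWeight_pos (min x X)
          have := hy.1
          positivity
        rw [← mul_sub, sub_sub_sub_cancel_left, norm_mul, Complex.norm_real, Real.norm_eq_abs,
          abs_of_nonneg hk0, norm_sub_rev, mul_comm]
        exact mul_le_mul_of_nonneg_left h.2.2 (norm_nonneg _)
      · simp [regKernel, indicator_of_notMem hy]
    · rw [integral_indicator measurableSet_Ioo, setIntegral_const]
      simp [hX.le]
      exact le_of_eq (by ring)
  have h1 := isUnit_one_sub_regKernel hq hX z
  have h2 := isUnit_one_sub_regKernel hq hX z'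
  have hsub : ‖regSolOn q X z - regSolOn q X z'‖ ≤ 2 * Real.exp (2 * (logNorm q + ‖z‖ * X ^ 2)) *
      (‖z - z'‖ * X ^ 2) * (2 * Real.exp (2 * (logNorm q + ‖z'‖ * X ^ 2))) * 1 := by
    have : regSolOn q X z - regSolOn q X z' = (Ring.inverse (1 - kernelOp (regKernel q X z)) -
      Ring.inverse (1 - kernelOp (regKernel q X z'))) (invLogWeight X) := rfl
    rw [this]
    refine (ContinuousLinearMap.le_opNorm _ _).trans ?_
    refine mul_le_mul ?_ (norm_invLogWeight_le X) (norm_nonneg _) (by positivity)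
    refine (norm_inverse_one_sub_sub_le h1.1 h2.1).trans ?_
    refine mul_le_mul (mul_le_mul h1.2 hT (norm_nonneg _) (by positivity)) h2.2 (norm_nonneg _)
      (by positivity)
  rw [mul_one] at hsub
  exact ((regSolOn q X z - regSolOn q X z').norm_coe_le_norm X).trans hsub

theorem differentiableAt_regSolOn {q : ℝ → ℝ} (hq : IsLogIntegrable q) {X : ℝ} (hX : 0 < X) (z : ℂ) :
    DifferentiableAt ℂ (regSolOn q X) z := by
  have hT : DifferentiableAt ℂ (fun z => kernelOp (regKernel q X z)) z :=
    differentiableAt_kernelOp_of_affine hq (isKernel_regKernel hq X) z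
  have h1 := differentiableWithinAt_inverse_one_sub (S := univ) hT.differentiableWithinAt
    (isUnit_one_sub_regKernel hq hX z).1
  exact (differentiableWithinAt_univ.1 h1).clm_apply (differentiableAt_const _)

theorem differentiableAt_regV {q : ℝ → ℝ} (hq : IsLogIntegrable q) {X : ℝ} (hX : 0 < X) (z : ℂ) :
    DifferentiableAt ℂ (fun z => regV q z X) z := by
  have h := differentiableAt_regSolOn hq hX z
  have h2 : DifferentiableAt ℂ (fun z => logWeight X * regSolOn q X z X) z :=
    ((BoundedContinuousFunction.evalCLM ℂ X).differentiableAt.comp z h).const_mul _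
  exact h2.congr_of_eventuallyEq (.of_forall fun w => regV_eq hq w hX le_rfl)

/-- `x v'(x)` for the regular solution `√(π x / 2) v(x)`. -/
noncomputable def regP (q : ℝ → ℝ) (z : ℂ) (x : ℝ) : ℂ :=
  ∫ y in Ioo 0 x, (y : ℂ) * ((q y : ℂ) - z) * regV q z y

/-- The kernel of the functional defining `regP`. -/
noncomputable def regPKernel (q : ℝ → ℝ) (X : ℝ) (z : ℂ) (_ y : ℝ) : ℂ :=
  (Ioo 0 X).indicator (fun y => ((y * logWeight y / logWeight X : ℝ) : ℂ) * ((q y : ℂ) - z)) y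

theorem isKernel_regPKernel {q : ℝ → ℝ} (hq : IsLogIntegrable q) (X : ℝ) (z : ℂ) :
    IsKernel (regPKernel q X z) (regBound q z X) := by
  refine isKernel_of_le_regBound hq z (k := fun _ y => y * logWeight y / logWeight X)
    (fun x => (continuous_id.mul continuous_logWeight).continuousOn.div_const _)
    (fun y hy => continuous_const) (fun x y hy => ?_) (fun x y hy => ?_)
    (fun x y hy => ?_)
  · have := logWeight_pos y
    have := logWeight_pos X
    have := hy.1
    positivity
  · rw [div_le_iff₀ (logWeight_pos X), mul_assoc]
    refine mul_le_mul_of_nonneg_left ?_ hy.1.le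
    calc logWeight y ≤ (1 + |Real.log y|) * 1 := by rw [mul_one]; exact logWeight_le
      _ ≤ _ := mul_le_mul_of_nonneg_left (one_le_logWeight X) (by positivity)
  · rw [div_le_iff₀ (logWeight_pos X)]
    exact mul_le_mul hy.2.le (logWeight_mono hy.2.le) (logWeight_pos y).le (hy.1.trans hy.2).le

/-- Since the kernel does not depend on its first variable, the operator acts as a functional and
may be evaluated at any point; `0` is a dummy. -/
theorem regP_eq {q : ℝ → ℝ} (hq : IsLogIntegrable q) {X : ℝ} (hX : 0 < X) (z : ℂ) :
    regP q z X = logWeight X * kernelOp (regPKernel q X z) (regSolOn q X z) 0 := by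
  rw [(isKernel_regPKernel hq X z).kernelOp_apply, regP, ← integral_indicator measurableSet_Ioo,
    ← integral_const_mul]
  congr 1; ext y
  by_cases hy : y ∈ Ioo 0 X
  · simp only [regPKernel, indicator_of_mem hy]
    rw [regV_eq hq z hX hy.2.le]
    have := logWeight_ne_zero X
    push_cast
    field_simp
  · simp [regPKernel, indicator_of_notMem hy]

theorem differentiableAt_regP {q : ℝ → ℝ} (hq : IsLogIntegrable q) {X : ℝ} (hX : 0 < X) (z : ℂ) :
    DifferentiableAt ℂ (fun z => regP q z X) z := by
  have hT : DifferentiableAt ℂ (fun z => kernelOp (regPKernel q X z)) z :=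
    differentiableAt_kernelOp_of_affine hq (isKernel_regPKernel hq X) z
  have h := hT.clm_apply (differentiableAt_regSolOn hq hX z)
  have h2 : DifferentiableAt ℂ (fun z => logWeight X *
      kernelOp (regPKernel q X z) (regSolOn q X z) 0) z :=
    ((BoundedContinuousFunction.evalCLM ℂ (0 : ℝ)).differentiableAt.comp z h).const_mul _
  exact h2.congr_of_eventuallyEq (.of_forall fun w => regP_eq hq hX w)

theorem norm_regP_le {q : ℝ → ℝ} (hq : IsLogIntegrable q) {X : ℝ} (hX : 0 < X) (z : ℂ) :
    ‖regP q z X‖ ≤ (logNorm q + ‖z‖ * X ^ 2) *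
      (2 * Real.exp (2 * (logNorm q + ‖z‖ * X ^ 2))) * logWeight X := by
  rw [regP_eq hq hX, norm_mul, Complex.norm_real, Real.norm_eq_abs,
    abs_of_pos (logWeight_pos X), mul_comm]
  refine mul_le_mul_of_nonneg_right ?_ (logWeight_pos X).le
  refine ((kernelOp (regPKernel q X z) (regSolOn q X z)).norm_coe_le_norm 0).trans ?_
  refine (ContinuousLinearMap.le_opNorm _ _).trans ?_
  have h1 := (isKernel_regPKernel hq X z).norm_kernelOp_le.trans (integral_regBound_le hq z hX)
  have h0 := logNorm_nonneg q
  refine mul_le_mul h1 ?_ (norm_nonneg _) (by positivity)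
  refine (ContinuousLinearMap.le_opNorm _ _).trans ?_
  calc _ ≤ 2 * Real.exp (2 * (logNorm q + ‖z‖ * X ^ 2)) * 1 :=
        mul_le_mul (isUnit_one_sub_regKernel hq hX z).2 (norm_invLogWeight_le X) (norm_nonneg _)
          (by positivity)
    _ = _ := mul_one _

/-! ### The regular solution: differential equation and behaviour at the origin -/

theorem intervalIntegrable_of_Ioo {n : ℝ → ℂ} (hn : ∀ X, IntegrableOn n (Ioo 0 X)) {s t : ℝ}
    (hs : 0 ≤ s) (ht : 0 ≤ t) : IntervalIntegrable n volume s t := by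
  have h : ∀ t, 0 ≤ t → IntervalIntegrable n volume 0 t := fun t ht => by
    rw [intervalIntegrable_iff_integrableOn_Ioo_of_le ht]; exact hn t
  exact (h s hs).symm.trans (h t ht)

theorem setIntegral_Ioo_sub {n : ℝ → ℂ} (hn : ∀ X, IntegrableOn n (Ioo 0 X)) {s t : ℝ}
    (hs : 0 ≤ s) (ht : 0 ≤ t) :
    (∫ y in Ioo 0 t, n y) - ∫ y in Ioo 0 s, n y = ∫ y in s..t, n y := by
  rw [← integral_Ioc_eq_integral_Ioo, ← integral_Ioc_eq_integral_Ioo,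
    ← intervalIntegral.integral_of_le hs, ← intervalIntegral.integral_of_le ht]
  exact intervalIntegral.integral_interval_sub_left (intervalIntegrable_of_Ioo hn le_rfl ht)
    (intervalIntegrable_of_Ioo hn le_rfl hs)

theorem setIntegral_log_div_mul {n : ℝ → ℂ} (hn : ∀ X, IntegrableOn n (Ioo 0 X))
    (hl : ∀ X, IntegrableOn (fun y => (Real.log y : ℂ) * n y) (Ioo 0 X)) {x : ℝ} (hx : 0 < x) :
    ∫ y in Ioo 0 x, ((Real.log (x / y) : ℝ) : ℂ) * n y =
      (Real.log x : ℂ) * (∫ y in Ioo 0 x, n y) - ∫ y in Ioo 0 x, (Real.log y : ℂ) * n y := by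
  rw [← integral_const_mul, ← integral_sub ((hn x).const_mul _) (hl x)]
  refine setIntegral_congr_fun measurableSet_Ioo fun y hy => ?_
  simp only [Real.log_div hx.ne' hy.1.ne']
  push_cast
  ring

/-- Write `log (x / y) = log x - log y` and apply the general differentiation lemma with `B = log`.
-/
theorem hasDerivAt_log_convolution {n : ℝ → ℂ} (hn : ∀ X, IntegrableOn n (Ioo 0 X))
    (hl : ∀ X, IntegrableOn (fun y => (Real.log y : ℂ) * n y) (Ioo 0 X)) {x : ℝ} (hx : 0 < x) :
    HasDerivAt (fun x => ∫ y in Ioo 0 x, ((Real.log (x / y) : ℝ) : ℂ) * n y)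
      ((∫ y in Ioo 0 x, n y) / x) x := by
  have h := hasDerivAt_mul_primitive_sub (B := fun x => (Real.log x : ℂ))
    (B' := fun x => ((x⁻¹ : ℝ) : ℂ)) (n := n)
    (N := fun x => ∫ y in Ioo 0 x, n y) (N₂ := fun x => ∫ y in Ioo 0 x, (Real.log y : ℂ) * n y)
    isOpen_Ioi (convex_Ioi 0) hx (fun t ht => (Real.hasDerivAt_log (ne_of_gt ht)).ofReal_comp)
    (Complex.continuous_ofReal.comp_continuousOn
      (continuousOn_id.inv₀ fun t ht => ne_of_gt ht))
    (fun s hs t ht => intervalIntegrable_of_Ioo hn (le_of_lt hs) (le_of_lt ht))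
    (fun s hs t ht => setIntegral_Ioo_sub hn (le_of_lt hs) (le_of_lt ht))
    (fun s hs t ht => setIntegral_Ioo_sub hl (le_of_lt hs) (le_of_lt ht))
  refine (h.congr_deriv ?_).congr_of_eventuallyEq ?_
  · push_cast; ring
  · filter_upwards [Ioi_mem_nhds hx] with t ht
    exact setIntegral_log_div_mul hn hl ht

theorem integrableOn_log_mul {q : ℝ → ℝ} (hq : IsLogIntegrable q) (c X : ℝ) :
    IntegrableOn (fun y => (1 + |Real.log y|) * (y * (|q y| + c))) (Ioo 0 X) := by
  have h1 := hq.integrableOn.mono_set (Ioo_subset_Ioi_self : Ioo 0 X ⊆ Ioi 0)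
  have hc : Continuous fun y => (y + |y * Real.log y|) * c :=
    (continuous_id.add Real.continuous_mul_log.abs).mul continuous_const
  have h2 : IntegrableOn (fun y => (y + |y * Real.log y|) * c) (Ioo 0 X) :=
    (hc.integrableOn_Icc (a := 0) (b := X)).mono_set Ioo_subset_Icc_self
  refine IntegrableOn.congr_fun (h1.add h2) (fun y hy => ?_) measurableSet_Ioo
  simp only [Pi.add_apply, abs_mul, abs_of_pos hy.1]
  ring

theorem integrableOn_of_norm_le_log {q : ℝ → ℝ} (hq : IsLogIntegrable q) (c : ℝ) {X : ℝ} {g : ℝ → ℂ}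
    (hm : AEStronglyMeasurable g (volume.restrict (Ioo 0 X))) {M : ℝ}
    (hb : ∀ y ∈ Ioo 0 X, ‖g y‖ ≤ M * ((1 + |Real.log y|) * (y * (|q y| + c)))) :
    IntegrableOn g (Ioo 0 X) :=
  ((integrableOn_log_mul hq c X).const_mul M).mono' hm
    ((ae_restrict_iff' measurableSet_Ioo).2 (.of_forall hb))

theorem aestronglyMeasurable_mul_sub {q : ℝ → ℝ} (hq : IsLogIntegrable q) (z : ℂ) (X : ℝ) :
    AEStronglyMeasurable (fun y : ℝ => (y : ℂ) * ((q y : ℂ) - z)) (volume.restrict (Ioo 0 X)) :=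
  Complex.continuous_ofReal.aestronglyMeasurable.mul
    ((Complex.continuous_ofReal.comp_aestronglyMeasurable (hq.aestronglyMeasurable.mono_measure
      (Measure.restrict_mono Ioo_subset_Ioi_self le_rfl))).sub aestronglyMeasurable_const)

theorem norm_mul_sub_mul_regV_le {q : ℝ → ℝ} (hq : IsLogIntegrable q) (z : ℂ) (X : ℝ) :
    ∃ M, 0 ≤ M ∧ ∀ y ∈ Ioo 0 X, ‖(y : ℂ) * ((q y : ℂ) - z) * regV q z y‖ ≤
      M * (y * (|q y| + ‖z‖)) := by
  obtain ⟨M, hM⟩ := (isRegVolterra_regV hq z (lt_of_lt_of_le one_pos (le_max_right X 1))).bounded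
  have hM0 : 0 ≤ M := (norm_nonneg _).trans (hM 0 (zero_le_one.trans (le_max_right X 1)))
  refine ⟨M, hM0, fun y hy => ?_⟩
  rw [norm_mul, norm_mul, Complex.norm_real, Real.norm_eq_abs, abs_of_pos hy.1]
  have hn : ‖(q y : ℂ) - z‖ ≤ |q y| + ‖z‖ := by
    refine (norm_sub_le _ _).trans ?_
    rw [Complex.norm_real, Real.norm_eq_abs]
  have hv := hM y (hy.2.le.trans (le_max_left X 1))
  have := hy.1.le
  calc _ ≤ y * (|q y| + ‖z‖) * M := by gcongr
    _ = _ := mul_comm _ _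

theorem regV_source_integrableOn {q : ℝ → ℝ} (hq : IsLogIntegrable q) (z : ℂ) (X : ℝ) :
    IntegrableOn (fun y : ℝ => (y : ℂ) * ((q y : ℂ) - z) * regV q z y) (Ioo 0 X) := by
  obtain ⟨M, hM0, hM⟩ := norm_mul_sub_mul_regV_le hq z X
  refine integrableOn_of_norm_le_log hq ‖z‖ ((aestronglyMeasurable_mul_sub hq z X).mul
    (continuous_regV hq z).aestronglyMeasurable) (M := M) fun y hy => (hM y hy).trans ?_
  refine mul_le_mul_of_nonneg_left ?_ hM0
  have := hy.1.le
  exact le_mul_of_one_le_left (by positivity) (by linarith [abs_nonneg (Real.log y)])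

theorem log_mul_regV_source_integrableOn {q : ℝ → ℝ} (hq : IsLogIntegrable q) (z : ℂ) (X : ℝ) :
    IntegrableOn (fun y : ℝ => (Real.log y : ℂ) * ((y : ℂ) * ((q y : ℂ) - z) * regV q z y))
      (Ioo 0 X) := by
  obtain ⟨M, hM0, hM⟩ := norm_mul_sub_mul_regV_le hq z X
  refine integrableOn_of_norm_le_log hq ‖z‖
    ((Complex.measurable_ofReal.comp Real.measurable_log).aestronglyMeasurable.mul
      ((aestronglyMeasurable_mul_sub hq z X).mul
    (continuous_regV hq z).aestronglyMeasurable)) (M := M) fun y hy => ?_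
  rw [norm_mul, Complex.norm_real, Real.norm_eq_abs]
  have := hy.1.le
  calc _ ≤ (1 + |Real.log y|) * (M * (y * (|q y| + ‖z‖))) := by
        gcongr
        · linarith
        · exact hM y hy
    _ = _ := by ring

theorem hasDerivAt_regV {q : ℝ → ℝ} (hq : IsLogIntegrable q) (z : ℂ) {x : ℝ} (hx : 0 < x) :
    HasDerivAt (regV q z) (regP q z x / x) x := by
  have h := (hasDerivAt_log_convolution (regV_source_integrableOn hq z)
    (log_mul_regV_source_integrableOn hq z) hx).const_add 1
  refine h.congr_of_eventuallyEq (.of_forall fun t => ?_)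
  rw [regV_volterra hq]
  refine congrArg _ (integral_congr_ae (.of_forall fun y => ?_))
  simp only
  push_cast
  ring

theorem regP_sub {q : ℝ → ℝ} (hq : IsLogIntegrable q) (z : ℂ) {s t : ℝ} (hs : 0 ≤ s) (ht : 0 ≤ t) :
    regP q z t - regP q z s = ∫ y in s..t, (y : ℂ) * ((q y : ℂ) - z) * regV q z y :=
  setIntegral_Ioo_sub (regV_source_integrableOn hq z) hs ht

theorem absolutelyContinuous_regP {q : ℝ → ℝ} (hq : IsLogIntegrable q) (z : ℂ) {a b : ℝ}
    (ha : 0 ≤ a) (hb : 0 ≤ b) : AbsolutelyContinuousOnInterval (regP q z) a b := by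
  have h := absolutelyContinuousOnInterval_integral
    (intervalIntegrable_of_Ioo (regV_source_integrableOn hq z) ha hb) (left_mem_uIcc (a := a) (b := b))
  refine ((absolutelyContinuousOnInterval_const (regP q z a) a b).add h).congr fun x hx => ?_
  have hx0 : 0 ≤ x := (le_min ha hb).trans hx.1
  simp only [Pi.add_apply]
  rw [← regP_sub hq z ha hx0]
  ring

theorem ae_hasDerivAt_regP {q : ℝ → ℝ} (hq : IsLogIntegrable q) (z : ℂ) :
    ∀ᵐ x : ℝ, 0 < x → HasDerivAt (regP q z) ((x : ℂ) * ((q x : ℂ) - z) * regV q z x) x := by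
  have h : ∀ᵐ x : ℝ, ∀ n : ℕ, x ∈ uIcc (0 : ℝ) n → ∀ c ∈ uIcc (0 : ℝ) n,
      HasDerivAt (fun x => ∫ y in c..x, (y : ℂ) * ((q y : ℂ) - z) * regV q z y)
        ((x : ℂ) * ((q x : ℂ) - z) * regV q z x) x :=
    ae_all_iff.2 fun n => (intervalIntegrable_of_Ioo (regV_source_integrableOn hq z) le_rfl
      n.cast_nonneg).ae_hasDerivAt_integral
  filter_upwards [h] with x hx hx0
  obtain ⟨n, hn⟩ := exists_nat_gt x
  have h0 := hx n (by rw [uIcc_of_le n.cast_nonneg]; exact ⟨hx0.le, hn.le⟩) 0 left_mem_uIcc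
  refine h0.congr_of_eventuallyEq ?_
  filter_upwards [Ioi_mem_nhds hx0] with t ht
  rw [← regP_sub hq z le_rfl (le_of_lt ht)]
  simp [regP]

theorem continuousOn_regP_div {q : ℝ → ℝ} (hq : IsLogIntegrable q) (z : ℂ) :
    ContinuousOn (fun x : ℝ => regP q z x / x) (Ioi 0) := fun x hx => by
  have hx0 : (0 : ℝ) < x := hx
  have h := (absolutelyContinuous_regP hq z le_rfl (by linarith : 0 ≤ x + 1)).continuousOn
  rw [uIcc_of_le (by linarith)] at h
  exact ((h.continuousAt (Icc_mem_nhds hx0 (by linarith))).div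
    Complex.continuous_ofReal.continuousAt
    (Complex.ofReal_ne_zero.2 hx0.ne')).continuousWithinAt

/-- The matter is integrability of `v' = regP / x` down to `0`. It is dominated by a multiple of
`g₁(x) = x⁻¹ ∫₀ˣ y (|q| + |z|) dy`. -/
theorem absolutelyContinuous_regV {q : ℝ → ℝ} (hq : IsLogIntegrable q) (z : ℂ) :
    AbsolutelyContinuousOnInterval (regV q z) 0 1 := by
  obtain ⟨M, hM0, hM⟩ := norm_mul_sub_mul_regV_le hq z 1
  set n : ℝ → ℂ := fun y => ((y * (|q y| + ‖z‖) : ℝ) : ℂ) with hn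
  have hmeas : ∀ X, AEStronglyMeasurable n (volume.restrict (Ioo 0 X)) := fun X => by
    refine Complex.continuous_ofReal.comp_aestronglyMeasurable (aestronglyMeasurable_id.mul
      ((hq.aestronglyMeasurable.mono_measure
      (Measure.restrict_mono Ioo_subset_Ioi_self le_rfl)).norm.add aestronglyMeasurable_const))
  have hnorm : ∀ y, 0 < y → ‖n y‖ = y * (|q y| + ‖z‖) := fun y hy => by
    rw [hn, Complex.norm_real, Real.norm_eq_abs, abs_of_nonneg (by positivity)]
  have hn1 : ∀ X, IntegrableOn n (Ioo 0 X) := fun X =>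
    integrableOn_of_norm_le_log hq ‖z‖ (hmeas X) (M := 1) fun y hy => by
      rw [hnorm y hy.1, one_mul]
      have := hy.1.le
      exact le_mul_of_one_le_left (by positivity) (by linarith [abs_nonneg (Real.log y)])
  have hl : ∀ X, IntegrableOn (fun y => (Real.log y : ℂ) * n y) (Ioo 0 X) := fun X =>
    integrableOn_of_norm_le_log hq ‖z‖
      ((Complex.measurable_ofReal.comp Real.measurable_log).aestronglyMeasurable.mul (hmeas X))
      (M := 1) fun y hy => by
      rw [norm_mul, Complex.norm_real, Real.norm_eq_abs, hnorm y hy.1, one_mul]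
      have := hy.1.le
      gcongr
      linarith
  set V : ℝ → ℂ := fun x => ∫ y in Ioo 0 x, ((Real.log (x / y) : ℝ) : ℂ) * n y with hV
  have hNre : ∀ x, ∫ y in Ioo 0 x, n y = ((∫ y in Ioo 0 x, y * (|q y| + ‖z‖) : ℝ) : ℂ) := fun x =>
    integral_ofReal
  have hVre : ∀ x, V x = ((∫ y in Ioo 0 x, Real.log (x / y) * (y * (|q y| + ‖z‖)) : ℝ) : ℂ) :=
    fun x => by
      refine Eq.trans (integral_congr_ae (.of_forall fun y => ?_)) integral_ofReal
      simp [hn]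
  set g₁ : ℝ → ℝ := fun x => (∫ y in Ioo 0 x, y * (|q y| + ‖z‖)) / x with hg₁
  have hN0 : ∀ x, 0 ≤ ∫ y in Ioo 0 x, y * (|q y| + ‖z‖) := fun x =>
    setIntegral_nonneg measurableSet_Ioo fun y hy => by have := hy.1.le; positivity
  have hV0 : ∀ x, 0 < x → 0 ≤ (V x).re := fun x hx => by
    rw [hVre, Complex.ofReal_re]
    refine setIntegral_nonneg measurableSet_Ioo fun y hy => ?_
    have := Real.log_nonneg ((one_le_div hy.1).2 hy.2.le)
    have := hy.1.le
    positivity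
  have hVd : ∀ x, 0 < x → HasDerivAt (fun x => (V x).re) (g₁ x) x := fun x hx => by
    have h := hasDerivAt_log_convolution hn1 hl hx
    rw [hNre, ← Complex.ofReal_div] at h
    simpa using! Complex.reCLM.hasFDerivAt.comp_hasDerivAt x h
  have hg₁c : ContinuousOn g₁ (Ioi 0) := by
    intro x hx
    have hx0 : (0 : ℝ) < x := hx
    have hac := absolutelyContinuousOnInterval_integral
      (intervalIntegrable_of_Ioo hn1 le_rfl (by linarith : 0 ≤ x + 1)) (left_mem_uIcc (a := 0))
    have hc := hac.continuousOn
    rw [uIcc_of_le (by linarith)] at hc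
    have hc' := hc.continuousAt (Icc_mem_nhds hx0 (by linarith))
    have hc2 : ContinuousAt (fun x => ∫ y in Ioo 0 x, n y) x := by
      refine hc'.congr ?_
      filter_upwards [Ioi_mem_nhds hx0] with t ht
      rw [← setIntegral_Ioo_sub hn1 le_rfl (le_of_lt ht)]
      simp
    simp_rw [hNre] at hc2
    have hc3 := Complex.continuous_re.continuousAt.comp hc2
    exact (hc3.div continuousAt_id hx0.ne').continuousWithinAt
  -- `g₁ ≥ 0` has the nonnegative primitive `V(x) = ∫₀ˣ log (x/y) y (|q| + |z|) dy`, finite by the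
  -- logarithmic moment at `0`, so the integral of `g₁` over `(ε, 1)` is at most `V 1` for every
  -- `ε`.
  have hg₁int : IntegrableOn g₁ (Ioc 0 1) := by
    have hsub : ∀ i : ℕ, Icc (1 / ((i : ℝ) + 1)) 1 ⊆ Ioi 0 := fun i x hx =>
      lt_of_lt_of_le (by positivity) hx.1
    have hint : ∀ i : ℕ, IntegrableOn g₁ (Icc (1 / ((i : ℝ) + 1)) 1) := fun i =>
      (hg₁c.mono (hsub i)).integrableOn_Icc
    refine integrableOn_Ioc_of_intervalIntegral_norm_bounded_left (l := atTop) (I := (V 1).re)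
      (fun i : ℕ => (hint i).mono_set Ioc_subset_Icc_self)
      (by simpa using! tendsto_one_div_add_atTop_nhds_zero_nat (𝕜 := ℝ)) (.of_forall fun i => ?_)
    have hpos : (0 : ℝ) < 1 / ((i : ℝ) + 1) := by positivity
    have hle : 1 / ((i : ℝ) + 1) ≤ 1 := by
      rw [div_le_one (by positivity)]; linarith [i.cast_nonneg (α := ℝ)]
    have : ∀ x ∈ Ioc (1 / ((i : ℝ) + 1)) 1, ‖g₁ x‖ = g₁ x := fun x hx => by
      rw [Real.norm_eq_abs, abs_of_nonneg (div_nonneg (hN0 x) (hpos.le.trans hx.1.le))]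
    rw [setIntegral_congr_fun measurableSet_Ioc this, ← intervalIntegral.integral_of_le hle,
      intervalIntegral.integral_eq_sub_of_hasDerivAt (f := fun x => (V x).re)
        (fun x hx => hVd x (by rw [uIcc_of_le hle] at hx; exact hsub i hx))
        ((intervalIntegrable_iff_integrableOn_Icc_of_le hle).2 (hint i))]
    linarith [hV0 _ hpos]
  have hint : IntervalIntegrable (fun x : ℝ => regP q z x / x) volume 0 1 := by
    rw [intervalIntegrable_iff_integrableOn_Ioc_of_le zero_le_one]
    refine (hg₁int.const_mul M).mono' (((continuousOn_regP_div hq z).mono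
      Ioc_subset_Ioi_self).aestronglyMeasurable measurableSet_Ioc)
      ((ae_restrict_iff' measurableSet_Ioc).2 (.of_forall fun x hx => ?_))
    have hx0 := hx.1
    rw [norm_div, Complex.norm_real, Real.norm_eq_abs, abs_of_pos hx0, hg₁, ← mul_div_assoc]
    refine div_le_div_of_nonneg_right ?_ hx0.le
    rw [regP, ← integral_const_mul]
    have hreal : IntegrableOn (fun y => y * (|q y| + ‖z‖)) (Ioo 0 x) := by
      refine IntegrableOn.congr_fun (hn1 x).re (fun y _ => ?_) measurableSet_Ioo
      simp [hn]
    refine norm_integral_le_of_norm_le (hreal.const_mul M)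
      ((ae_restrict_iff' measurableSet_Ioo).2 (.of_forall fun y hy => ?_))
    exact hM y ⟨hy.1, hy.2.trans_le hx.2⟩
  refine ((absolutelyContinuousOnInterval_const (1 : ℂ) 0 1).add
    (absolutelyContinuousOnInterval_integral hint left_mem_uIcc)).congr fun x hx => ?_
  rw [uIcc_of_le zero_le_one] at hx
  have := intervalIntegral.integral_eq_sub_of_hasDeriv_right_of_le (a := 0) (b := x) hx.1
    (continuous_regV hq z).continuousOn
    (fun t ht => (hasDerivAt_regV hq z ht.1).hasDerivWithinAt)
    (hint.mono_set (by rw [uIcc_of_le hx.1, uIcc_of_le zero_le_one]; exact Icc_subset_Icc_right hx.2))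
  simp only [Pi.add_apply]
  rw [this, regV_of_nonpos hq z le_rfl]
  ring

/-- The function `√(π x / 2) v(x)`. -/
noncomputable def regPhi (q : ℝ → ℝ) (z : ℂ) (x : ℝ) : ℂ :=
  (Real.sqrt (Real.pi * x / 2) : ℂ) * regV q z x

/-- The derivative of `regPhi`. -/
noncomputable def regPhi₁ (q : ℝ → ℝ) (z : ℂ) (x : ℝ) : ℂ :=
  ((Real.sqrt (Real.pi * x / 2) / x : ℝ) : ℂ) * (regV q z x / 2 + regP q z x)

theorem hasDerivAt_sqrt_pi_mul {x : ℝ} (hx : 0 < x) :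
    HasDerivAt (fun x => Real.sqrt (Real.pi * x / 2)) (Real.sqrt (Real.pi * x / 2) / (2 * x)) x := by
  have hpi := Real.pi_pos
  have h : HasDerivAt (fun x => Real.pi * x / 2) (Real.pi / 2) x := by
    simpa using ((hasDerivAt_id x).const_mul Real.pi).div_const 2
  have hp : 0 < Real.pi * x / 2 := by positivity
  refine (h.sqrt hp.ne').congr_deriv ?_
  have hs := Real.sq_sqrt hp.le
  have hs0 := (Real.sqrt_pos.2 hp).ne'
  field_simp
  rw [hs]
  ring

theorem hasDerivAt_regPhi {q : ℝ → ℝ} (hq : IsLogIntegrable q) (z : ℂ) {x : ℝ} (hx : 0 < x) :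
    HasDerivAt (regPhi q z) (regPhi₁ q z x) x := by
  refine ((hasDerivAt_sqrt_pi_mul hx).ofReal_comp.mul (hasDerivAt_regV hq z hx)).congr_deriv ?_
  have := Complex.ofReal_ne_zero.2 hx.ne'
  rw [regPhi₁]
  push_cast
  field_simp

theorem isSolution_regPhi {q : ℝ → ℝ} (hq : IsLogIntegrable q) (z : ℂ) :
    IsSolution q z (regPhi q z) := by
  have hsd : ∀ x, 0 < x → HasDerivAt (fun x => ((Real.sqrt (Real.pi * x / 2) / x : ℝ) : ℂ))
      ((-(Real.sqrt (Real.pi * x / 2) / (2 * x ^ 2)) : ℝ) : ℂ) x := fun x hx => by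
    refine (((hasDerivAt_sqrt_pi_mul hx).div (hasDerivAt_id x) hx.ne').congr_deriv ?_).ofReal_comp
    simp only [id]
    field_simp
    ring
  refine .of_hasDerivAt (fun x hx => hasDerivAt_regPhi hq z hx) (fun a b ha hab => ?_) ?_
  · have hb := ha.trans_le hab
    refine AbsolutelyContinuousOnInterval.cmul (.of_hasDerivAt
      (fun x hx => hsd x (uIcc_subset_Ioi ha hb hx)) ?_) ?_
    · refine Complex.continuous_ofReal.comp_continuousOn (ContinuousOn.neg (ContinuousOn.div ?_ ?_ ?_))
      · exact (by fun_prop : Continuous fun x => Real.sqrt (Real.pi * x / 2)).continuousOn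
      · fun_prop
      · intro x hx
        have : (0 : ℝ) < x := uIcc_subset_Ioi ha hb hx
        positivity
    · have h1 : AbsolutelyContinuousOnInterval (regV q z) a b :=
        .of_hasDerivAt (fun x hx => hasDerivAt_regV hq z (uIcc_subset_Ioi ha hb hx))
          ((continuousOn_regP_div hq z).mono (uIcc_subset_Ioi ha hb))
      refine ((h1.cmul (absolutelyContinuousOnInterval_const (1 / 2 : ℂ) a b)).add
        (absolutelyContinuous_regP hq z ha.le hb.le)).congr fun x _ => ?_
      simp only [Pi.add_apply]
      ring
  · filter_upwards [ae_hasDerivAt_regP hq z] with x hp hx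
    refine ((hsd x hx).mul (((hasDerivAt_regV hq z hx).div_const 2).add (hp hx))).congr_deriv ?_
    have := Complex.ofReal_ne_zero.2 hx.ne'
    rw [regPhi]
    simp only [Pi.add_apply]
    push_cast
    field_simp
    ring

theorem isRegularSolution_regPhi {q : ℝ → ℝ} (hq : IsLogIntegrable q) (z : ℂ) :
    IsRegularSolution q z (regPhi q z) where
  isSolution := isSolution_regPhi hq z
  regular := ⟨regV q z, absolutelyContinuous_regV hq z, regV_of_nonpos hq z le_rfl, fun _ _ _ => rfl⟩

/-! ### The Jost solution as a perturbation of the free one -/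

/-- The free Jost solution `e^{-κ x} h(κ x)`. -/
noncomputable def jG (κ : ℂ) (x : ℝ) : ℂ := Complex.exp (-(κ * x)) * macH (κ * x)

/-- The derivative of the free Jost solution. -/
noncomputable def jG₁ (κ : ℂ) (x : ℝ) : ℂ :=
  κ * (Complex.exp (-(κ * x)) * (macH₁ (κ * x) - macH (κ * x)))

/-- A primitive of `1 / jG²`. -/
noncomputable def jB (κ : ℂ) (x : ℝ) : ℂ := ∫ t in (1 : ℝ)..x, ((jG κ t) ^ 2)⁻¹

/-- The squared ratio of two values of the free Jost solution. -/
noncomputable def jE (κ : ℂ) (t y : ℝ) : ℂ := (jG κ y / jG κ t) ^ 2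

/-- The Volterra kernel `∫ₓ^y (jG y / jG t)² dt`. -/
noncomputable def jD (κ : ℂ) (x y : ℝ) : ℂ := (jG κ y) ^ 2 * (jB κ y - jB κ x)

theorem mul_ofReal_re_nonneg {κ : ℂ} (hκ : 0 ≤ κ.re) {x : ℝ} (hx : 0 ≤ x) : 0 ≤ (κ * x).re := by
  rw [Complex.re_mul_ofReal]; exact mul_nonneg hκ hx

theorem mul_ofReal_ne_zero {κ : ℂ} (h0 : κ ≠ 0) {x : ℝ} (hx : 0 < x) : κ * x ≠ 0 :=
  mul_ne_zero h0 (Complex.ofReal_ne_zero.2 hx.ne')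

theorem norm_mul_ofReal {κ : ℂ} {x : ℝ} (hx : 0 ≤ x) : ‖κ * x‖ = ‖κ‖ * x := by
  rw [norm_mul, Complex.norm_real, Real.norm_eq_abs, abs_of_nonneg hx]

theorem jG_ne_zero {κ : ℂ} (hκ : 0 ≤ κ.re) (h0 : κ ≠ 0) {x : ℝ} (hx : 0 < x) : jG κ x ≠ 0 :=
  mul_ne_zero (Complex.exp_ne_zero _)
    (macH_ne_zero (mul_ofReal_re_nonneg hκ hx.le) (mul_ofReal_ne_zero h0 hx))

theorem hasDerivAt_const_mul_ofReal (κ : ℂ) (x : ℝ) : HasDerivAt (fun x : ℝ => κ * x) κ x := by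
  simpa using! (Complex.ofRealCLM.hasDerivAt (x := x)).const_mul κ

theorem hasDerivAt_jG {κ : ℂ} (hκ : 0 ≤ κ.re) (h0 : κ ≠ 0) {x : ℝ} (hx : 0 < x) :
    HasDerivAt (jG κ) (jG₁ κ x) x := by
  have h1 := hasDerivAt_const_mul_ofReal κ x
  have h2 := HasDerivAt.comp x (hasDerivAt_macH (mul_ofReal_re_nonneg hκ hx.le)
    (mul_ofReal_ne_zero h0 hx)) h1
  refine (h1.fun_neg.cexp.mul h2).congr_deriv ?_
  rw [jG₁]
  simp only [Function.comp_apply]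
  ring

theorem hasDerivAt_jG₁ {κ : ℂ} (hκ : 0 ≤ κ.re) (h0 : κ ≠ 0) {x : ℝ} (hx : 0 < x) :
    HasDerivAt (jG₁ κ) ((κ ^ 2 - 1 / (4 * (x : ℂ) ^ 2)) * jG κ x) x := by
  have h1 := hasDerivAt_const_mul_ofReal κ x
  have hs := mul_ofReal_re_nonneg hκ hx.le
  have hs0 := mul_ofReal_ne_zero h0 hx
  have h2 := HasDerivAt.comp x (hasDerivAt_macH hs hs0) h1
  have h3 := HasDerivAt.comp x (hasDerivAt_macH₁ hs hs0) h1
  refine ((h1.fun_neg.cexp.mul (h3.sub h2)).const_mul κ).congr_deriv ?_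
  have hx0 := Complex.ofReal_ne_zero.2 hx.ne'
  rw [jG]
  simp only [Function.comp_apply, Pi.sub_apply]
  field_simp
  ring

theorem continuousOn_jG {κ : ℂ} (hκ : 0 ≤ κ.re) (h0 : κ ≠ 0) : ContinuousOn (jG κ) (Ioi 0) :=
  fun _ hx => (hasDerivAt_jG hκ h0 hx).continuousAt.continuousWithinAt

theorem continuousOn_inv_jG_sq {κ : ℂ} (hκ : 0 ≤ κ.re) (h0 : κ ≠ 0) :
    ContinuousOn (fun t => ((jG κ t) ^ 2)⁻¹) (Ioi 0) :=
  ((continuousOn_jG hκ h0).pow 2).inv₀ fun _ hx => pow_ne_zero 2 (jG_ne_zero hκ h0 hx)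

theorem intervalIntegrable_inv_jG_sq {κ : ℂ} (hκ : 0 ≤ κ.re) (h0 : κ ≠ 0) {a b : ℝ} (ha : 0 < a)
    (hb : 0 < b) : IntervalIntegrable (fun t => ((jG κ t) ^ 2)⁻¹) volume a b :=
  ((continuousOn_inv_jG_sq hκ h0).mono (uIcc_subset_Ioi ha hb)).intervalIntegrable

theorem hasDerivAt_jB {κ : ℂ} (hκ : 0 ≤ κ.re) (h0 : κ ≠ 0) {x : ℝ} (hx : 0 < x) :
    HasDerivAt (jB κ) ((jG κ x) ^ 2)⁻¹ x :=
  intervalIntegral.integral_hasDerivAt_right (intervalIntegrable_inv_jG_sq hκ h0 one_pos hx)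
    ((continuousOn_inv_jG_sq hκ h0).stronglyMeasurableAtFilter isOpen_Ioi x hx)
    ((continuousOn_inv_jG_sq hκ h0).continuousAt (Ioi_mem_nhds hx))

theorem continuousOn_jB {κ : ℂ} (hκ : 0 ≤ κ.re) (h0 : κ ≠ 0) : ContinuousOn (jB κ) (Ioi 0) :=
  fun _ hx => (hasDerivAt_jB hκ h0 hx).continuousAt.continuousWithinAt

theorem jD_eq_integral {κ : ℂ} (hκ : 0 ≤ κ.re) (h0 : κ ≠ 0) {x y : ℝ} (hx : 0 < x) (hy : 0 < y) :
    jD κ x y = ∫ t in x..y, jE κ t y := by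
  have h : jB κ y - jB κ x = ∫ t in x..y, ((jG κ t) ^ 2)⁻¹ :=
    intervalIntegral.integral_interval_sub_left (intervalIntegrable_inv_jG_sq hκ h0 one_pos hy)
      (intervalIntegrable_inv_jG_sq hκ h0 one_pos hx)
  rw [jD, h, ← intervalIntegral.integral_const_mul]
  congr 1; ext t
  rw [jE, div_pow, div_eq_mul_inv]

theorem norm_jD_le {κ : ℂ} (hκ : 0 ≤ κ.re) (h0 : κ ≠ 0) {a C x y : ℝ} (ha : 0 < a) (hx : a ≤ x)
    (hxy : x ≤ y) (hC : ∀ t y, a ≤ t → t ≤ y → ‖jE κ t y‖ ≤ C) : ‖jD κ x y‖ ≤ C * y := by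
  have hx0 := ha.trans_le hx
  have hC0 : 0 ≤ C := (norm_nonneg _).trans (hC a a le_rfl le_rfl)
  rw [jD_eq_integral hκ h0 hx0 (hx0.trans_le hxy)]
  refine (intervalIntegral.norm_integral_le_of_norm_le_const (C := C) fun t ht => ?_).trans ?_
  · rw [uIoc_of_le hxy] at ht
    exact hC t y (hx.trans ht.1.le) ht.2
  · rw [abs_of_nonneg (by linarith)]
    exact mul_le_mul_of_nonneg_left (by linarith) hC0

theorem half_le_norm_macH {s : ℂ} (hs : 0 ≤ s.re) (h : 1 / 2 ≤ ‖s‖) : 1 / 2 ≤ ‖macH s‖ := by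
  have h0 : s ≠ 0 := norm_pos_iff.1 (by linarith)
  have h1 := norm_macH_sub_one_le hs h0
  have h2 : 1 / (4 * ‖s‖) ≤ 1 / 2 := by
    rw [div_le_div_iff₀ (by linarith) (by norm_num)]; linarith
  have h3 := norm_sub_norm_le (1 : ℂ) (macH s)
  rw [norm_one, norm_sub_rev] at h3
  linarith

theorem jE_eq (κ : ℂ) (t y : ℝ) : jE κ t y =
    Complex.exp (-(κ * (y - t : ℝ))) ^ 2 * (macH (κ * y) / macH (κ * t)) ^ 2 := by
  have : Complex.exp (-(κ * (y - t : ℝ))) = Complex.exp (-(κ * y)) / Complex.exp (-(κ * t)) := by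
    rw [← Complex.exp_sub]; congr 1; push_cast; ring
  rw [this, jE, jG, jG, ← mul_pow]
  congr 1
  rw [mul_div_mul_comm]

theorem norm_jE_le_of_le {κ : ℂ} (hκ : 0 ≤ κ.re) (h0 : κ ≠ 0) {t y c : ℝ} (ht : 0 < t) (hty : t ≤ y)
    (hc : 0 < c) (h : c ≤ ‖macH (κ * t)‖) : ‖jE κ t y‖ ≤ (c⁻¹) ^ 2 := by
  have hy := ht.trans_le hty
  rw [jE_eq, norm_mul, norm_pow, norm_pow, norm_div]
  have h1 : ‖Complex.exp (-(κ * (y - t : ℝ)))‖ ≤ 1 :=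
    norm_exp_neg_le_one (mul_ofReal_re_nonneg hκ (by linarith))
  have h2 := norm_macH_le (mul_ofReal_re_nonneg hκ hy.le) (mul_ofReal_ne_zero h0 hy)
  calc _ ≤ 1 ^ 2 * (1 / c) ^ 2 := by gcongr
    _ = _ := by rw [one_pow, one_mul, one_div]

/-- Only `|h(κt)|` needs a lower bound: compactness for `t` up to `max a (1/‖κ‖)`, and `|h| ≥ 1/2`
beyond, since `h → 1`. The constant depends on `κ` and is used for qualitative statements only. -/
theorem exists_norm_jE_le {κ : ℂ} (hκ : 0 ≤ κ.re) (h0 : κ ≠ 0) {a : ℝ} (ha : 0 < a) :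
    ∃ C, ∀ t y, a ≤ t → t ≤ y → ‖jE κ t y‖ ≤ C := by
  have hn : 0 < ‖κ‖ := norm_pos_iff.2 h0
  have hcont : ContinuousOn (fun t : ℝ => (macH (κ * t))⁻¹) (Icc a (max a (1 / ‖κ‖))) := fun t ht => by
    have ht0 := ha.trans_le ht.1
    have hs := mul_ofReal_re_nonneg hκ ht0.le
    have hs0 := mul_ofReal_ne_zero h0 ht0
    exact (ContinuousAt.inv₀ (HasDerivAt.comp t (hasDerivAt_macH hs hs0)
      (hasDerivAt_const_mul_ofReal κ t)).continuousAt (macH_ne_zero hs hs0)).continuousWithinAt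
  obtain ⟨M, hM⟩ := isCompact_Icc.exists_bound_of_continuousOn hcont
  have hM0 : 0 ≤ M := (norm_nonneg _).trans (hM a ⟨le_rfl, le_max_left _ _⟩)
  -- `(M + 2)⁻¹` is below both `M⁻¹`-type bounds on the compact part and the value `1/2` on the
  -- rest.
  refine ⟨((M + 2)⁻¹⁻¹) ^ 2, fun t y ht hty => ?_⟩
  have ht0 := ha.trans_le ht
  refine norm_jE_le_of_le hκ h0 ht0 hty (by positivity) ?_
  rcases le_total t (max a (1 / ‖κ‖)) with h | h
  · have h1 := hM t ⟨ht, h⟩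
    have hp : 0 < ‖macH (κ * t)‖ := norm_pos_iff.2
      (macH_ne_zero (mul_ofReal_re_nonneg hκ ht0.le) (mul_ofReal_ne_zero h0 ht0))
    rw [norm_inv] at h1
    rw [inv_le_comm₀ (by positivity) hp]
    linarith
  · have h1 : 1 ≤ ‖κ * t‖ := by
      rw [norm_mul_ofReal ht0.le]
      have := (le_max_right a (1 / ‖κ‖)).trans h
      rw [div_le_iff₀ hn] at this
      linarith
    refine le_trans ?_ (half_le_norm_macH (mul_ofReal_re_nonneg hκ ht0.le) (by linarith))
    rw [one_div]
    exact inv_anti₀ (by norm_num) (by linarith)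

/-- The majorant of the Volterra kernel of the Jost solution on `[a, ∞)`. -/
noncomputable def jostBound (q : ℝ → ℝ) (a C : ℝ) (y : ℝ) : ℝ :=
  (Ioi a).indicator (fun y => C * (y * |q y|)) y

theorem integrable_jostBound {q : ℝ → ℝ} (hq : IsLogIntegrable q) {a : ℝ} (ha : 0 < a) (C : ℝ) :
    Integrable (jostBound q a C) :=
  (integrable_indicator_iff measurableSet_Ioi).2
    ((hq.mul_integrableOn.mono_set (Ioi_subset_Ioi ha.le)).const_mul C)

theorem integral_jostBound (q : ℝ → ℝ) (a C : ℝ) :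
    ∫ y, jostBound q a C y = C * ∫ y in Ioi a, y * |q y| := by
  unfold jostBound
  rw [integral_indicator measurableSet_Ioi, integral_const_mul]

/-- The Volterra kernel of the Jost solution on `[a, ∞)`. -/
noncomputable def jostKernel (q : ℝ → ℝ) (a : ℝ) (κ : ℂ) (x y : ℝ) : ℂ :=
  (Ioi a).indicator (fun y => jD κ (min (max x a) y) y * q y) y

theorem aestronglyMeasurable_ofReal_Ioi {q : ℝ → ℝ} (hq : IsLogIntegrable q) {a : ℝ} (ha : 0 ≤ a) :
    AEStronglyMeasurable (fun y => (q y : ℂ)) (volume.restrict (Ioi a)) :=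
  Complex.continuous_ofReal.comp_aestronglyMeasurable
    (hq.aestronglyMeasurable.mono_measure (Measure.restrict_mono (Ioi_subset_Ioi ha) le_rfl))

theorem isKernel_of_le_jostBound {q : ℝ → ℝ} (hq : IsLogIntegrable q) {a C : ℝ} (ha : 0 < a)
    {k : ℝ → ℝ → ℂ} (hk : ∀ x, ContinuousOn (k x) (Ioi a))
    (hc : ∀ y ∈ Ioi a, Continuous fun x => k x y) (hb : ∀ x, ∀ y ∈ Ioi a, ‖k x y‖ ≤ C * y) :
    IsKernel (fun x => (Ioi a).indicator fun y => k x y * q y) (jostBound q a C) where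
  aestronglyMeasurable x := (aestronglyMeasurable_indicator_iff measurableSet_Ioi).2
    (((hk x).aestronglyMeasurable measurableSet_Ioi).mul (aestronglyMeasurable_ofReal_Ioi hq ha.le))
  continuous y := by
    by_cases hy : y ∈ Ioi a
    · simp only [indicator_of_mem hy]
      exact (hc y hy).mul continuous_const
    · simp only [indicator_of_notMem hy]
      exact continuous_const
  bound x y := by
    by_cases hy : y ∈ Ioi a
    · simp only [indicator_of_mem hy, jostBound]
      rw [norm_mul, Complex.norm_real, Real.norm_eq_abs, ← mul_assoc]
      exact mul_le_mul_of_nonneg_right (hb x y hy) (abs_nonneg _)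
    · simp [indicator_of_notMem hy, jostBound]
  integrable := integrable_jostBound hq ha C

theorem isKernel_jostKernel {q : ℝ → ℝ} (hq : IsLogIntegrable q) {κ : ℂ} (hκ : 0 ≤ κ.re)
    (h0 : κ ≠ 0) {a C : ℝ} (ha : 0 < a) (hC : ∀ t y, a ≤ t → t ≤ y → ‖jE κ t y‖ ≤ C) :
    IsKernel (jostKernel q a κ) (jostBound q a C) := by
  have hsub : Ioi a ⊆ Ioi 0 := Ioi_subset_Ioi ha.le
  have hmem : ∀ x, ∀ y ∈ Ioi a, a ≤ min (max x a) y := fun x y hy =>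
    le_min (le_max_right _ _) (le_of_lt hy)
  refine isKernel_of_le_jostBound hq ha (k := fun x y => jD κ (min (max x a) y) y)
    (fun x => ?_) (fun y hy => ?_) (fun x y hy => ?_)
  · refine (((continuousOn_jG hκ h0).mono hsub).pow 2).mul (((continuousOn_jB hκ h0).mono hsub).sub ?_)
    exact (continuousOn_jB hκ h0).comp (continuous_const.min continuous_id).continuousOn
      fun y hy => ha.trans_le (hmem x y hy)
  · refine continuous_const.mul (continuous_const.sub ?_)
    exact (continuousOn_jB hκ h0).comp_continuous
      ((continuous_id.max continuous_const).min continuous_const)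
      fun x => ha.trans_le (hmem x y hy)
  · exact norm_jD_le hκ h0 ha (hmem x y hy) (min_le_right _ _) hC

theorem isUnit_one_sub_jostKernel {q : ℝ → ℝ} (hq : IsLogIntegrable q) {κ : ℂ} (hκ : 0 ≤ κ.re)
    (h0 : κ ≠ 0) {a C : ℝ} (ha : 0 < a) (hC : ∀ t y, a ≤ t → t ≤ y → ‖jE κ t y‖ ≤ C) :
    IsUnit (1 - kernelOp (jostKernel q a κ)) ∧ ‖Ring.inverse (1 - kernelOp (jostKernel q a κ))‖
      ≤ 2 * Real.exp (2 * (C * ∫ y in Ioi a, y * |q y|)) := by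
  rw [← integral_jostBound]
  refine (isKernel_jostKernel hq hκ h0 ha hC).isUnit_one_sub_of_upper fun x y hxy => ?_
  unfold jostKernel
  by_cases hy : y ∈ Ioi a
  · have : min (max x a) y = y := min_eq_right (hxy.trans (le_max_left _ _))
    simp [this, jD]
  · simp [indicator_of_notMem hy]

theorem integral_jostKernel_mul (q : ℝ → ℝ) (a : ℝ) (κ : ℂ) (x : ℝ) (w : ℝ → ℂ) :
    ∫ y, jostKernel q a κ x y * w y =
      ∫ y in Ioi (max x a), jD κ (max x a) y * q y * w y := by
  have hsub : Ioi (max x a) ⊆ Ioi a := Ioi_subset_Ioi (le_max_right _ _)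
  have e : ∀ y, jostKernel q a κ x y * w y = (Ioi a).indicator (fun y =>
      jD κ (min (max x a) y) y * q y * w y) y := fun y => by
    by_cases hy : y ∈ Ioi a
    · simp [jostKernel, indicator_of_mem hy]
    · simp [jostKernel, indicator_of_notMem hy]
  simp_rw [e]
  rw [integral_indicator measurableSet_Ioi,
    setIntegral_eq_of_subset_of_forall_sdiff_eq_zero measurableSet_Ioi hsub ?_]
  · refine setIntegral_congr_fun measurableSet_Ioi fun y hy => ?_
    have : min (max x a) y = max x a := min_eq_left (le_of_lt hy)
    simp only [this]
  · intro y hy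
    have : min (max x a) y = y := min_eq_right (not_lt.1 hy.2)
    simp [this, jD]

/-- The integral equation of the Jost solution, divided by the free one, on `[a, ∞)`. -/
structure IsJostVolterra (q : ℝ → ℝ) (a : ℝ) (κ : ℂ) (m : ℝ → ℂ) : Prop where
  continuousOn : ContinuousOn m (Ici a)
  bounded : ∃ M, ∀ x, a ≤ x → ‖m x‖ ≤ M
  eq : ∀ x, a ≤ x → m x = 1 + ∫ y in Ioi x, jD κ x y * q y * m y

theorem IsJostVolterra.mono {q : ℝ → ℝ} {a b : ℝ} {κ : ℂ} {m : ℝ → ℂ} (h : IsJostVolterra q a κ m)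
    (hb : a ≤ b) : IsJostVolterra q b κ m where
  continuousOn := h.continuousOn.mono (Ici_subset_Ici.2 hb)
  bounded := h.bounded.imp fun _ hM x hx => hM x (hb.trans hx)
  eq x hx := h.eq x (hb.trans hx)

/-- The solution of the integral equation on `[a, ∞)`. -/
noncomputable def jostSolOn (q : ℝ → ℝ) (a : ℝ) (κ : ℂ) : ℝ →ᵇ ℂ :=
  Ring.inverse (1 - kernelOp (jostKernel q a κ)) 1

theorem isJostVolterra_jostSolOn {q : ℝ → ℝ} (hq : IsLogIntegrable q) {κ : ℂ} (hκ : 0 ≤ κ.re)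
    (h0 : κ ≠ 0) {a : ℝ} (ha : 0 < a) : IsJostVolterra q a κ (jostSolOn q a κ) where
  continuousOn := (jostSolOn q a κ).continuous.continuousOn
  bounded := ⟨_, fun x _ => (jostSolOn q a κ).norm_coe_le_norm x⟩
  eq x hx := by
    obtain ⟨C, hC⟩ := exists_norm_jE_le hκ h0 ha
    have h := (eq_inverse_one_sub_apply_iff (isUnit_one_sub_jostKernel hq hκ h0 ha hC).1
      (u := jostSolOn q a κ) (b := 1)).1 rfl
    have h2 := congrArg (fun u : ℝ →ᵇ ℂ => u x) h
    simp only [BoundedContinuousFunction.add_apply] at h2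
    rw [(isKernel_jostKernel hq hκ h0 ha hC).kernelOp_apply, integral_jostKernel_mul,
      max_eq_left hx] at h2
    exact h2

/-- Extended by its value at `a` to the left of `a`, a solution becomes the unique bounded fixed
point. -/
theorem IsJostVolterra.eq_jostSolOn {q : ℝ → ℝ} (hq : IsLogIntegrable q) {κ : ℂ} (hκ : 0 ≤ κ.re)
    (h0 : κ ≠ 0) {a : ℝ} (ha : 0 < a) {m : ℝ → ℂ} (h : IsJostVolterra q a κ m) {x : ℝ} (hx : a ≤ x) :
    m x = jostSolOn q a κ x := by
  obtain ⟨C, hC⟩ := exists_norm_jE_le hκ h0 ha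
  obtain ⟨M, hM⟩ := h.bounded
  let u : ℝ →ᵇ ℂ := BoundedContinuousFunction.ofNormedAddCommGroup
    (fun x => m (max x a)) (h.continuousOn.comp_continuous (continuous_id.max continuous_const)
      fun x => le_max_right x a) M fun x => hM _ (le_max_right _ _)
  have hu : u = jostSolOn q a κ := by
    refine (eq_inverse_one_sub_apply_iff (isUnit_one_sub_jostKernel hq hκ h0 ha hC).1).2 ?_
    ext x
    simp only [BoundedContinuousFunction.add_apply]
    rw [(isKernel_jostKernel hq hκ h0 ha hC).kernelOp_apply, integral_jostKernel_mul]
    refine (h.eq _ (le_max_right x a)).trans (congrArg (1 + ·)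
      (setIntegral_congr_fun measurableSet_Ioi fun y hy => ?_))
    have : u y = m y := by
      change m (max y a) = m y
      rw [max_eq_left ((le_max_right x a).trans (le_of_lt hy))]
    simp only [this]
  have := congrArg (fun w : ℝ →ᵇ ℂ => w x) hu
  rw [← this]
  change m x = m (max x a)
  rw [max_eq_left hx]

/-- The quotient of the Jost solution and the free Jost solution. -/
noncomputable def jostM (q : ℝ → ℝ) (κ : ℂ) (x : ℝ) : ℂ := jostSolOn q (min x 1) κ x

/-- The left endpoint is immaterial: the integral over `(x, ∞)` never sees it. -/
theorem jostM_eq {q : ℝ → ℝ} (hq : IsLogIntegrable q) {κ : ℂ} (hκ : 0 ≤ κ.re)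
    (h0 : κ ≠ 0) {a x : ℝ} (ha : 0 < a) (hx : a ≤ x) : jostM q κ x = jostSolOn q a κ x := by
  have h1 : 0 < min x 1 := lt_min (ha.trans_le hx) one_pos
  have hY : 0 < max a (min x 1) := ha.trans_le (le_max_left _ _)
  have hxY : max a (min x 1) ≤ x := max_le hx (min_le_left _ _)
  rw [((isJostVolterra_jostSolOn hq hκ h0 ha).mono (le_max_left a (min x 1))).eq_jostSolOn
    hq hκ h0 hY hxY, jostM,
    ((isJostVolterra_jostSolOn hq hκ h0 h1).mono (le_max_right a (min x 1))).eq_jostSolOn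
    hq hκ h0 hY hxY]

theorem isJostVolterra_jostM {q : ℝ → ℝ} (hq : IsLogIntegrable q) {κ : ℂ} (hκ : 0 ≤ κ.re)
    (h0 : κ ≠ 0) {a : ℝ} (ha : 0 < a) : IsJostVolterra q a κ (jostM q κ) := by
  have h := isJostVolterra_jostSolOn hq hκ h0 ha
  have e : ∀ x, a ≤ x → jostM q κ x = jostSolOn q a κ x := fun x hx => jostM_eq hq hκ h0 ha hx
  refine ⟨h.continuousOn.congr e, h.bounded.imp fun M hM x hx => by rw [e x hx]; exact hM x hx,
    fun x hx => ?_⟩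
  rw [e x hx]
  refine (h.eq x hx).trans (congrArg _ (setIntegral_congr_fun measurableSet_Ioi fun y hy => ?_))
  simp only [e y (hx.trans (le_of_lt hy))]

theorem norm_jG_le {κ : ℂ} (hκ : 0 ≤ κ.re) (h0 : κ ≠ 0) {x : ℝ} (hx : 0 < x) : ‖jG κ x‖ ≤ 1 := by
  rw [jG, norm_mul]
  exact mul_le_one₀ (norm_exp_neg_le_one (mul_ofReal_re_nonneg hκ hx.le)) (norm_nonneg _)
    (norm_macH_le (mul_ofReal_re_nonneg hκ hx.le) (mul_ofReal_ne_zero h0 hx))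

theorem integrableOn_mul_mul_of_norm_le {q : ℝ → ℝ} (hq : IsLogIntegrable q) {a C M : ℝ} (ha : 0 < a)
    {c m : ℝ → ℂ} (hc : ContinuousOn c (Ioi a)) (hm : ContinuousOn m (Ioi a))
    (hC : ∀ y ∈ Ioi a, ‖c y‖ ≤ C * y) (hM : ∀ y ∈ Ioi a, ‖m y‖ ≤ M) :
    IntegrableOn (fun y => c y * q y * m y) (Ioi a) ∧
      ‖∫ y in Ioi a, c y * q y * m y‖ ≤ C * M * ∫ y in Ioi a, y * |q y| := by
  have hi := (hq.mul_integrableOn.mono_set (Ioi_subset_Ioi ha.le)).const_mul (C * M)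
  have hb : ∀ᵐ y ∂volume.restrict (Ioi a), ‖c y * q y * m y‖ ≤ C * M * (y * |q y|) :=
    (ae_restrict_iff' measurableSet_Ioi).2 (.of_forall fun y hy => by
      have h1 := (norm_nonneg _).trans (hC y hy)
      rw [norm_mul, norm_mul, Complex.norm_real, Real.norm_eq_abs]
      calc ‖c y‖ * |q y| * ‖m y‖ ≤ (C * y) * |q y| * M :=
            mul_le_mul (mul_le_mul_of_nonneg_right (hC y hy) (abs_nonneg _)) (hM y hy)
              (norm_nonneg _) (mul_nonneg h1 (abs_nonneg _))
        _ = _ := by ring)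
  refine ⟨hi.mono' (((hc.aestronglyMeasurable measurableSet_Ioi).mul
    (aestronglyMeasurable_ofReal_Ioi hq ha.le)).mul (hm.aestronglyMeasurable measurableSet_Ioi)) hb, ?_⟩
  rw [← integral_const_mul]
  exact norm_integral_le_of_norm_le hi hb

theorem continuousOn_jostM {q : ℝ → ℝ} (hq : IsLogIntegrable q) {κ : ℂ} (hκ : 0 ≤ κ.re)
    (h0 : κ ≠ 0) : ContinuousOn (jostM q κ) (Ioi 0) := fun x hx => by
  have hx0 : (0 : ℝ) < x := hx
  exact ((isJostVolterra_jostM hq hκ h0 (half_pos hx0)).continuousOn.continuousAt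
    (Ici_mem_nhds (half_lt_self hx0))).continuousWithinAt

/-- The integral `∫ₓ^∞ jG² q m`. -/
noncomputable def jostN (q : ℝ → ℝ) (κ : ℂ) (x : ℝ) : ℂ :=
  ∫ y in Ioi x, jG κ y ^ 2 * q y * jostM q κ y

/-- The derivative of `jostM`. -/
noncomputable def jostM₁ (q : ℝ → ℝ) (κ : ℂ) (x : ℝ) : ℂ :=
  -∫ y in Ioi x, jE κ x y * q y * jostM q κ y

theorem jostM₁_eq (q : ℝ → ℝ) (κ : ℂ) (x : ℝ) : jostM₁ q κ x = (jG κ x ^ 2)⁻¹ * -jostN q κ x := by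
  rw [jostM₁, jostN, mul_neg, ← integral_const_mul]
  congr 2; ext y
  rw [jE, div_pow, div_eq_mul_inv]
  ring

theorem integrableOn_jostN {q : ℝ → ℝ} (hq : IsLogIntegrable q) {κ : ℂ} (hκ : 0 ≤ κ.re)
    (h0 : κ ≠ 0) {x : ℝ} (hx : 0 < x) :
    IntegrableOn (fun y => jG κ y ^ 2 * q y * jostM q κ y) (Ioi x) := by
  obtain ⟨M, hM⟩ := (isJostVolterra_jostM hq hκ h0 hx).bounded
  refine (integrableOn_mul_mul_of_norm_le hq (C := 1 / x) hx
    (c := fun y => jG κ y ^ 2)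
    (((continuousOn_jG hκ h0).mono (Ioi_subset_Ioi hx.le)).pow 2)
    ((continuousOn_jostM hq hκ h0).mono (Ioi_subset_Ioi hx.le)) (fun y hy => ?_)
    fun y hy => hM y (le_of_lt hy)).1
  have hy : x < y := hy
  rw [norm_pow]
  refine (pow_le_one₀ (norm_nonneg _) (norm_jG_le hκ h0 (hx.trans hy))).trans ?_
  rw [one_div_mul_eq_div, one_le_div hx]
  exact hy.le

theorem jostN_sub {q : ℝ → ℝ} (hq : IsLogIntegrable q) {κ : ℂ} (hκ : 0 ≤ κ.re)
    (h0 : κ ≠ 0) {x y : ℝ} (hx : 0 < x) (hy : 0 < y) :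
    jostN q κ x - jostN q κ y = ∫ t in x..y, jG κ t ^ 2 * q t * jostM q κ t :=
  intervalIntegral.integral_Ioi_sub_Ioi' (integrableOn_jostN hq hκ h0 hx)
    (integrableOn_jostN hq hκ h0 hy)

theorem intervalIntegrable_of_Ioi {f : ℝ → ℂ} {a b c : ℝ} (hf : IntegrableOn f (Ioi c))
    (ha : c ≤ a) (hb : c ≤ b) : IntervalIntegrable f volume a b := by
  rw [intervalIntegrable_iff]
  exact hf.mono_set fun x hx => (le_min ha hb).trans_lt hx.1

theorem absolutelyContinuous_jostN {q : ℝ → ℝ} (hq : IsLogIntegrable q) {κ : ℂ} (hκ : 0 ≤ κ.re)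
    (h0 : κ ≠ 0) {a b : ℝ} (ha : 0 < a) (hb : 0 < b) :
    AbsolutelyContinuousOnInterval (jostN q κ) a b := by
  have hm : 0 < min a b := lt_min ha hb
  refine ((absolutelyContinuousOnInterval_const (jostN q κ a) a b).sub
    (absolutelyContinuousOnInterval_integral (intervalIntegrable_of_Ioi
      (integrableOn_jostN hq hκ h0 hm) (min_le_left _ _) (min_le_right _ _))
      (left_mem_uIcc (a := a)))).congr fun x hx => ?_
  simp only [Pi.sub_apply]
  rw [← jostN_sub hq hκ h0 ha (uIcc_subset_Ioi ha hb hx)]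
  ring

theorem ae_hasDerivAt_jostN {q : ℝ → ℝ} (hq : IsLogIntegrable q) {κ : ℂ} (hκ : 0 ≤ κ.re)
    (h0 : κ ≠ 0) :
    ∀ᵐ x : ℝ, 0 < x → HasDerivAt (jostN q κ) (-(jG κ x ^ 2 * q x * jostM q κ x)) x := by
  have hpos : ∀ n : ℕ, (0 : ℝ) < 1 / ((n : ℝ) + 1) := fun n => by positivity
  have hle : ∀ n : ℕ, 1 / ((n : ℝ) + 1) ≤ 1 := fun n => by
    rw [div_le_one (by positivity)]; linarith [n.cast_nonneg (α := ℝ)]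
  have hle' : ∀ n : ℕ, 1 ≤ (n : ℝ) + 1 := fun n => by linarith [n.cast_nonneg (α := ℝ)]
  have h : ∀ᵐ x : ℝ, ∀ n : ℕ, x ∈ uIcc (1 / ((n : ℝ) + 1)) (n + 1) →
      ∀ c ∈ uIcc (1 / ((n : ℝ) + 1)) (n + 1),
      HasDerivAt (fun x => ∫ y in c..x, jG κ y ^ 2 * q y * jostM q κ y)
        (jG κ x ^ 2 * q x * jostM q κ x) x :=
    ae_all_iff.2 fun n => (intervalIntegrable_of_Ioi (integrableOn_jostN hq hκ h0 (hpos n)) le_rfl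
      ((hle n).trans (hle' n))).ae_hasDerivAt_integral
  filter_upwards [h] with x hx hx0
  obtain ⟨n, hn⟩ := exists_nat_gt (max x (1 / x))
  have h1 : x < n := (le_max_left _ _).trans_lt hn
  have h2 : 1 / x < n := (le_max_right _ _).trans_lt hn
  have h3 : 1 / ((n : ℝ) + 1) ≤ x := by
    rw [div_lt_iff₀ hx0] at h2
    rw [div_le_iff₀ (by positivity)]
    nlinarith
  have hd := hx n (by rw [uIcc_of_le ((hle n).trans (hle' n))]; exact ⟨h3, by linarith⟩) 1
    (by rw [uIcc_of_le ((hle n).trans (hle' n))]; exact ⟨hle n, hle' n⟩)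
  refine (hd.const_sub (jostN q κ 1)).congr_of_eventuallyEq ?_
  filter_upwards [Ioi_mem_nhds hx0] with t ht
  rw [← jostN_sub hq hκ h0 one_pos ht]
  ring

/-- `D(x,y) = G(y)² (B y - B x)` has the form treated by the general differentiation lemma, with `n
= G² q m`. -/
theorem hasDerivAt_jostM {q : ℝ → ℝ} (hq : IsLogIntegrable q) {κ : ℂ} (hκ : 0 ≤ κ.re)
    (h0 : κ ≠ 0) {x : ℝ} (hx : 0 < x) : HasDerivAt (jostM q κ) (jostM₁ q κ x) x := by
  set a := x / 2 with ha'
  have ha : 0 < a := half_pos hx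
  have hV := isJostVolterra_jostM hq hκ h0 ha
  obtain ⟨M, hM⟩ := hV.bounded
  obtain ⟨C, hC⟩ := exists_norm_jE_le hκ h0 ha
  set n : ℝ → ℂ := fun y => jG κ y ^ 2 * q y * jostM q κ y with hn
  have hsub : Ioi a ⊆ Ioi 0 := Ioi_subset_Ioi ha.le
  have hpos : ∀ t ∈ Ioi a, (0 : ℝ) < t := fun t ht => hsub ht
  have hNi : ∀ t ∈ Ioi a, IntegrableOn n (Ioi t) := fun t ht =>
    integrableOn_jostN hq hκ h0 (hpos t ht)
  -- Normalising the primitive to vanish at `a` turns this integrand into `D(a, y) q m`, whose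
  -- kernel is bounded by `C y`.
  have hBi : IntegrableOn (fun y => (jB κ y - jB κ a) * n y) (Ioi a) := by
    refine ((integrableOn_mul_mul_of_norm_le hq (C := C) ha (c := jD κ a) (m := jostM q κ)
      ((((continuousOn_jG hκ h0).mono hsub).pow 2).mul
        (((continuousOn_jB hκ h0).mono hsub).sub continuousOn_const))
      ((continuousOn_jostM hq hκ h0).mono hsub) (fun y hy => norm_jD_le hκ h0 ha le_rfl (le_of_lt hy) hC)
      fun y hy => hM y (le_of_lt hy)).1).congr_fun (fun y _ => ?_) measurableSet_Ioi
    simp only [jD, hn]; ring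
  have hBi' : ∀ t ∈ Ioi a, IntegrableOn (fun y => (jB κ y - jB κ a) * n y) (Ioi t) := fun t ht =>
    hBi.mono_set (Ioi_subset_Ioi (le_of_lt ht))
  have key := hasDerivAt_mul_primitive_sub (B := fun t => jB κ t - jB κ a)
    (B' := fun t => (jG κ t ^ 2)⁻¹) (n := n) (N := fun t => -∫ y in Ioi t, n y)
    (N₂ := fun t => -∫ y in Ioi t, (jB κ y - jB κ a) * n y) isOpen_Ioi (convex_Ioi a)
    (half_lt_self hx) (fun t ht => (hasDerivAt_jB hκ h0 (hpos t ht)).sub_const _)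
    ((continuousOn_inv_jG_sq hκ h0).mono hsub)
    (fun s hs t ht => intervalIntegrable_of_Ioi (integrableOn_jostN hq hκ h0 ha)
      (le_of_lt hs) (le_of_lt ht))
    (fun s hs t ht => by
      rw [← intervalIntegral.integral_Ioi_sub_Ioi' (hNi s hs) (hNi t ht)]; ring)
    (fun s hs t ht => by
      rw [← intervalIntegral.integral_Ioi_sub_Ioi' (hBi' s hs) (hBi' t ht)]; ring)
  refine ((key.const_add 1).congr_deriv ?_).congr_of_eventuallyEq ?_
  · rw [jostM₁_eq]; rfl
  · filter_upwards [Ioi_mem_nhds (half_lt_self hx)] with t ht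
    rw [hV.eq t (le_of_lt ht)]
    congr 1
    have e : ∀ y, jD κ t y * q y * jostM q κ y =
        (jB κ y - jB κ a) * n y - (jB κ t - jB κ a) * n y := fun y => by
      simp only [jD, hn]; ring
    simp_rw [e]
    rw [integral_sub (hBi' t ht) ((hNi t ht).const_mul _), integral_const_mul]
    ring

/-- The Jost solution. -/
noncomputable def jostFn (q : ℝ → ℝ) (κ : ℂ) (x : ℝ) : ℂ := jG κ x * jostM q κ x

/-- The derivative of `jostFn`. -/
noncomputable def jostFn₁ (q : ℝ → ℝ) (κ : ℂ) (x : ℝ) : ℂ :=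
  jG₁ κ x * jostM q κ x + jG κ x * jostM₁ q κ x

theorem hasDerivAt_jostFn {q : ℝ → ℝ} (hq : IsLogIntegrable q) {κ : ℂ} (hκ : 0 ≤ κ.re)
    (h0 : κ ≠ 0) {x : ℝ} (hx : 0 < x) : HasDerivAt (jostFn q κ) (jostFn₁ q κ x) x :=
  (hasDerivAt_jG hκ h0 hx).mul (hasDerivAt_jostM hq hκ h0 hx)

/-- In this form the derivative is composed of absolutely continuous factors; only `jostN` involves
`q`, and only as a primitive. -/
theorem jostFn₁_eq (q : ℝ → ℝ) {κ : ℂ} (hκ : 0 ≤ κ.re)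
    (h0 : κ ≠ 0) {x : ℝ} (hx : 0 < x) :
    jostFn₁ q κ x = jG₁ κ x * jostM q κ x - (jG κ x)⁻¹ * jostN q κ x := by
  have := jG_ne_zero hκ h0 hx
  rw [jostFn₁, jostM₁_eq]
  field_simp
  ring

theorem isSolution_jostFn {q : ℝ → ℝ} (hq : IsLogIntegrable q) {κ : ℂ} (hκ : 0 ≤ κ.re)
    (h0 : κ ≠ 0) : IsSolution q (-κ ^ 2) (jostFn q κ) := by
  refine .of_hasDerivAt (fun x hx => hasDerivAt_jostFn hq hκ h0 hx) (fun a b ha hab => ?_) ?_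
  · have hb := ha.trans_le hab
    have hsub := uIcc_subset_Ioi ha hb
    have c₁ : ContinuousOn (jG₁ κ) (uIcc a b) := fun x hx =>
      (hasDerivAt_jG₁ hκ h0 (hsub hx)).continuousAt.continuousWithinAt
    have c₂ : ContinuousOn (jostM₁ q κ) (uIcc a b) := by
      refine ContinuousOn.congr (((continuousOn_inv_jG_sq hκ h0).mono hsub).mul
        (absolutelyContinuous_jostN hq hκ h0 ha hb).continuousOn.neg) fun x _ => ?_
      exact jostM₁_eq q κ x
    have c₀ := (continuousOn_jG hκ h0).mono hsub
    have h1 : AbsolutelyContinuousOnInterval (jG₁ κ) a b :=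
      .of_hasDerivAt (fun x hx => hasDerivAt_jG₁ hκ h0 (hsub hx))
        (ContinuousOn.mul (ContinuousOn.sub continuousOn_const (ContinuousOn.div continuousOn_const
          (by fun_prop) fun x hx => mul_ne_zero (by norm_num)
            (pow_ne_zero 2 (Complex.ofReal_ne_zero.2 (ne_of_gt (hsub hx)))))) c₀)
    have h2 : AbsolutelyContinuousOnInterval (jostM q κ) a b :=
      .of_hasDerivAt (fun x hx => hasDerivAt_jostM hq hκ h0 (hsub hx)) c₂
    have h3 : AbsolutelyContinuousOnInterval (fun x => (jG κ x)⁻¹) a b :=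
      .of_hasDerivAt (fun x hx => (hasDerivAt_jG hκ h0 (hsub hx)).inv (jG_ne_zero hκ h0 (hsub hx)))
        (c₁.neg.div (c₀.pow 2) fun x hx => pow_ne_zero 2 (jG_ne_zero hκ h0 (hsub hx)))
    refine ((h1.cmul h2).sub (h3.cmul (absolutelyContinuous_jostN hq hκ h0 ha hb))).congr
      fun x hx => ?_
    rw [jostFn₁_eq q hκ h0 (hsub hx)]
    rfl
  · filter_upwards [ae_hasDerivAt_jostN hq hκ h0] with x hN hx
    have hG := jG_ne_zero hκ h0 hx
    have h := ((hasDerivAt_jG₁ hκ h0 hx).mul (hasDerivAt_jostM hq hκ h0 hx)).sub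
      (((hasDerivAt_jG hκ h0 hx).fun_inv hG).mul (hN hx))
    refine (h.congr_deriv ?_).congr_of_eventuallyEq ?_
    · have := Complex.ofReal_ne_zero.2 hx.ne'
      rw [jostM₁_eq, jostFn]
      field_simp
      ring
    · filter_upwards [Ioi_mem_nhds hx] with t ht
      rw [jostFn₁_eq q hκ h0 ht]
      rfl

theorem tendsto_jostM {q : ℝ → ℝ} (hq : IsLogIntegrable q) {κ : ℂ} (hκ : 0 ≤ κ.re)
    (h0 : κ ≠ 0) : Tendsto (jostM q κ) atTop (𝓝 1) ∧ Tendsto (jostM₁ q κ) atTop (𝓝 0) := by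
  obtain ⟨C, hC⟩ := exists_norm_jE_le hκ h0 one_pos
  have hV := isJostVolterra_jostM hq hκ h0 one_pos
  obtain ⟨M, hM⟩ := hV.bounded
  have hC0 : 0 ≤ C := (norm_nonneg _).trans (hC 1 1 le_rfl le_rfl)
  have ht : Tendsto (fun x : ℝ => C * M * ∫ y in Ioi x, y * |q y|) atTop (𝓝 0) := by
    simpa using (tendsto_integral_Ioi_zero (f := fun y => y * |q y|) (μ := volume)
      tendsto_id).const_mul (C * M)
  constructor
  · rw [tendsto_iff_norm_sub_tendsto_zero]
    refine squeeze_zero' (.of_forall fun x => norm_nonneg _) ?_ ht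
    filter_upwards [eventually_ge_atTop 1] with x hx
    have hx0 : 0 < x := one_pos.trans_le hx
    have hsub : Ioi x ⊆ Ioi 0 := Ioi_subset_Ioi hx0.le
    rw [hV.eq x hx, add_sub_cancel_left]
    exact (integrableOn_mul_mul_of_norm_le hq hx0 ((((continuousOn_jG hκ h0).mono hsub).pow 2).mul
        (((continuousOn_jB hκ h0).mono hsub).sub continuousOn_const))
      ((continuousOn_jostM hq hκ h0).mono hsub)
      (fun y hy => norm_jD_le hκ h0 one_pos hx (le_of_lt hy) hC)
      fun y hy => hM y (hx.trans (le_of_lt hy))).2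
  · rw [tendsto_zero_iff_norm_tendsto_zero]
    refine squeeze_zero' (.of_forall fun x => norm_nonneg _) ?_ ht
    filter_upwards [eventually_ge_atTop 1] with x hx
    have hx0 : 0 < x := one_pos.trans_le hx
    have hsub : Ioi x ⊆ Ioi 0 := Ioi_subset_Ioi hx0.le
    rw [jostM₁, norm_neg]
    refine (integrableOn_mul_mul_of_norm_le hq hx0 (c := jE κ x)
      ((((continuousOn_jG hκ h0).mono hsub).div_const _).pow 2)
      ((continuousOn_jostM hq hκ h0).mono hsub) (fun y hy => ?_)
      fun y hy => hM y (hx.trans (le_of_lt hy))).2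
    have hy : x < y := hy
    exact (hC x y hx hy.le).trans (le_mul_of_one_le_right hC0 (hx.trans hy.le))

theorem tendsto_macH {κ : ℂ} (hκ : 0 ≤ κ.re) (h0 : κ ≠ 0) :
    Tendsto (fun x : ℝ => macH (κ * x)) atTop (𝓝 1) ∧
      Tendsto (fun x : ℝ => macH₁ (κ * x)) atTop (𝓝 0) := by
  have hn : 0 < ‖κ‖ := norm_pos_iff.2 h0
  have ht : Tendsto (fun x : ℝ => 1 / (4 * (‖κ‖ * x))) atTop (𝓝 0) := by
    refine Tendsto.div_atTop tendsto_const_nhds ?_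
    exact (tendsto_id.const_mul_atTop hn).const_mul_atTop (by norm_num)
  have ht₁ : Tendsto (fun x : ℝ => 1 / (8 * (‖κ‖ * x) ^ 2)) atTop (𝓝 0) := by
    refine Tendsto.div_atTop tendsto_const_nhds ?_
    exact ((tendsto_pow_atTop two_ne_zero).comp (tendsto_id.const_mul_atTop hn)).const_mul_atTop
      (by norm_num)
  constructor
  · rw [tendsto_iff_norm_sub_tendsto_zero]
    refine squeeze_zero' (.of_forall fun x => norm_nonneg _) ?_ ht
    filter_upwards [eventually_gt_atTop 0] with x hx
    have := norm_macH_sub_one_le (mul_ofReal_re_nonneg hκ hx.le) (mul_ofReal_ne_zero h0 hx)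
    rwa [norm_mul_ofReal hx.le] at this
  · rw [tendsto_zero_iff_norm_tendsto_zero]
    refine squeeze_zero' (.of_forall fun x => norm_nonneg _) ?_ ht₁
    filter_upwards [eventually_gt_atTop 0] with x hx
    have := norm_macH₁_le (mul_ofReal_re_nonneg hκ hx.le) (mul_ofReal_ne_zero h0 hx)
    rwa [norm_mul_ofReal hx.le] at this

theorem isJostSolution_jostFn {q : ℝ → ℝ} (hq : IsLogIntegrable q) {k : ℂ} (hk : 0 ≤ k.im)
    (hk0 : k ≠ 0) : IsJostSolution q k (jostFn q (-(Complex.I * k))) := by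
  obtain ⟨κ, hκd⟩ : ∃ κ, κ = -(Complex.I * k) := ⟨_, rfl⟩
  rw [← hκd]
  have hκ : 0 ≤ κ.re := by simpa [hκd] using hk
  have h0 : κ ≠ 0 := hκd ▸ neg_ne_zero.2 (mul_ne_zero Complex.I_ne_zero hk0)
  have hIk : Complex.I * k = -κ := by rw [hκd, neg_neg]
  have hk2 : k ^ 2 = -κ ^ 2 := by
    rw [hκd, neg_sq, mul_pow, Complex.I_sq]; ring
  obtain ⟨hm, hm₁⟩ := tendsto_jostM hq hκ h0
  obtain ⟨hH, hH₁⟩ := tendsto_macH hκ h0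
  refine ⟨hk2 ▸ isSolution_jostFn hq hκ h0, ?_, ?_⟩
  · have := hH.mul hm
    rw [one_mul] at this
    refine this.congr fun x => ?_
    have := Complex.exp_ne_zero (-(κ * x))
    rw [hIk, jostFn, jG, neg_mul]
    field_simp
  · have := ((hH.sub hH₁).mul hm).sub ((hH.mul hm₁).const_mul (1 / κ))
    simp only [sub_zero, mul_one, mul_zero] at this
    refine this.congr' ?_
    filter_upwards [eventually_gt_atTop 0] with x hx
    have := Complex.exp_ne_zero (-(κ * x))
    rw [hIk, (hasDerivAt_jostFn hq hκ h0 hx).deriv, jostFn₁, jG₁, jG, neg_mul]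
    field_simp
    ring

/-! ### Dependence of the Jost kernel on the spectral parameter -/

/-- The intersection of a disc around `κ₀` with the closed right half-plane. -/
def halfDisc (κ₀ : ℂ) : Set ℂ := {κ | 0 ≤ κ.re ∧ ‖κ - κ₀‖ ≤ ‖κ₀‖ / 2}

theorem convex_halfDisc (κ₀ : ℂ) : Convex ℝ (halfDisc κ₀) := by
  have : halfDisc κ₀ = {c | 0 ≤ c.re} ∩ Metric.closedBall κ₀ (‖κ₀‖ / 2) := by
    ext κ; simp [halfDisc, dist_eq_norm]
  rw [this]
  exact (convex_halfSpace_re_ge 0).inter (convex_closedBall κ₀ (‖κ₀‖ / 2))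

theorem norm_le_two_mul_of_mem_halfDisc {κ₀ κ : ℂ} (h : κ ∈ halfDisc κ₀) : ‖κ₀‖ ≤ 2 * ‖κ‖ := by
  have h1 := norm_sub_norm_le κ₀ κ
  rw [norm_sub_rev] at h1
  linarith [h.2]

theorem ne_zero_of_mem_halfDisc {κ₀ κ : ℂ} (h0 : κ₀ ≠ 0) (h : κ ∈ halfDisc κ₀) : κ ≠ 0 := by
  have := norm_le_two_mul_of_mem_halfDisc h
  have := norm_pos_iff.2 h0
  exact norm_pos_iff.1 (by linarith)

theorem half_le_norm_mul_of_mem_halfDisc {κ₀ κ : ℂ} (h0 : κ₀ ≠ 0) (h : κ ∈ halfDisc κ₀) {t : ℝ}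
    (ht : 1 / ‖κ₀‖ ≤ t) : 1 / 2 ≤ ‖κ * t‖ := by
  have h1 := norm_le_two_mul_of_mem_halfDisc h
  have h2 := norm_pos_iff.2 h0
  have ht0 : 0 < t := (one_div_pos.2 h2).trans_le ht
  rw [norm_mul_ofReal ht0.le]
  rw [div_le_iff₀ h2] at ht
  nlinarith

/-- The quotient `h' / h`. -/
noncomputable def macR (s : ℂ) : ℂ := macH₁ s / macH s

theorem norm_macR_le {s : ℂ} (hs : 0 ≤ s.re) (h : 1 / 2 ≤ ‖s‖) : ‖macR s‖ ≤ 1 / (4 * ‖s‖ ^ 2) := by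
  have hp : 0 < ‖s‖ := by linarith
  have h1 := norm_macH₁_le hs (norm_pos_iff.1 hp)
  have h2 := half_le_norm_macH hs h
  rw [macR, norm_div]
  calc ‖macH₁ s‖ / ‖macH s‖ ≤ (1 / (8 * ‖s‖ ^ 2)) / (1 / 2) := by gcongr
    _ = _ := by field_simp; norm_num

theorem norm_macR_le_one {s : ℂ} (hs : 0 ≤ s.re) (h : 1 / 2 ≤ ‖s‖) : ‖macR s‖ ≤ 1 := by
  refine (norm_macR_le hs h).trans ?_
  rw [div_le_one (by positivity)]
  nlinarith

/-- Riccati equation for the logarithmic derivative of `h`. -/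
theorem hasDerivAt_macR {s : ℂ} (hs : 0 ≤ s.re) (h0 : s ≠ 0) :
    HasDerivAt macR (2 * macR s - 1 / (4 * s ^ 2) - macR s ^ 2) s := by
  have hH := macH_ne_zero hs h0
  refine ((hasDerivAt_macH₁ hs h0).div (hasDerivAt_macH hs h0) hH).congr_deriv ?_
  rw [macR]
  field_simp

theorem norm_deriv_macR_le {s : ℂ} (hs : 0 ≤ s.re) (h : 1 / 2 ≤ ‖s‖) :
    ‖2 * macR s - 1 / (4 * s ^ 2) - macR s ^ 2‖ ≤ 4 := by
  have h1 := norm_macR_le_one hs h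
  have hp : 0 < ‖s‖ := by linarith
  have h2 : ‖1 / (4 * s ^ 2)‖ ≤ 1 := by
    rw [norm_div, norm_mul, norm_pow, norm_one, div_le_one (mul_pos (by norm_num) (by positivity))]
    norm_num
    nlinarith
  have h3 : ‖macR s ^ 2‖ ≤ 1 := by
    rw [norm_pow]; exact pow_le_one₀ (norm_nonneg _) h1
  have h4 : ‖2 * macR s‖ ≤ 2 := by
    rw [norm_mul]; norm_num; linarith
  calc _ ≤ ‖2 * macR s‖ + ‖1 / (4 * s ^ 2)‖ + ‖macR s ^ 2‖ :=
        (norm_sub_le _ _).trans (add_le_add_left (norm_sub_le _ _) _)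
    _ ≤ _ := by linarith

/-- The logarithmic derivative of `jG κ y` with respect to `κ`. -/
noncomputable def jR (κ : ℂ) (y : ℝ) : ℂ := y * (macR (κ * y) - 1)

/-- The derivative of `jR κ y` with respect to `κ`. -/
noncomputable def jR₁ (κ : ℂ) (y : ℝ) : ℂ :=
  y ^ 2 * (2 * macR (κ * y) - 1 / (4 * (κ * y) ^ 2) - macR (κ * y) ^ 2)

theorem hasDerivAt_jR {κ : ℂ} (hκ : 0 ≤ κ.re) (h0 : κ ≠ 0) {y : ℝ} (hy : 0 < y) :
    HasDerivAt (fun κ => jR κ y) (jR₁ κ y) κ := by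
  have h1 : HasDerivAt (fun κ : ℂ => κ * y) (y : ℂ) κ := by
    simpa using (hasDerivAt_id κ).mul_const (y : ℂ)
  have h := (((hasDerivAt_macR (mul_ofReal_re_nonneg hκ hy.le) (mul_ofReal_ne_zero h0 hy)).comp κ
    h1).sub_const 1).const_mul (y : ℂ)
  refine h.congr_deriv ?_
  rw [jR₁]; ring

theorem hasDerivAt_jG_param {κ : ℂ} (hκ : 0 ≤ κ.re) (h0 : κ ≠ 0) {y : ℝ} (hy : 0 < y) :
    HasDerivAt (fun κ => jG κ y) (jR κ y * jG κ y) κ := by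
  have h1 : HasDerivAt (fun κ : ℂ => κ * y) (y : ℂ) κ := by
    simpa using (hasDerivAt_id κ).mul_const (y : ℂ)
  have hs := mul_ofReal_re_nonneg hκ hy.le
  have hs0 := mul_ofReal_ne_zero h0 hy
  have h2 := (hasDerivAt_macH hs hs0).comp κ h1
  refine (h1.fun_neg.cexp.mul h2).congr_deriv ?_
  have := macH_ne_zero hs hs0
  rw [jR, macR, jG]
  simp only [Function.comp_apply]
  field_simp
  ring

/-- `G` depends only on the product `κy`, hence `y ∂/∂y = κ ∂/∂κ` on it. -/
theorem jG₁_eq {κ : ℂ} (hκ : 0 ≤ κ.re) (h0 : κ ≠ 0) {y : ℝ} (hy : 0 < y) :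
    y * jG₁ κ y = κ * (jR κ y * jG κ y) := by
  have := macH_ne_zero (mul_ofReal_re_nonneg hκ hy.le) (mul_ofReal_ne_zero h0 hy)
  have e : macR (κ * y) - 1 = (macH₁ (κ * y) - macH (κ * y)) * (macH (κ * y))⁻¹ := by
    rw [macR, sub_mul, mul_inv_cancel₀ this, div_eq_mul_inv]
  rw [jR, jG, jG₁, e]
  linear_combination -(κ * y * Complex.exp (-(κ * y)) * (macH₁ (κ * y) - macH (κ * y))) *
    mul_inv_cancel₀ this

theorem hasDerivAt_jE_param {κ : ℂ} (hκ : 0 ≤ κ.re) (h0 : κ ≠ 0) {t y : ℝ} (ht : 0 < t)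
    (hy : 0 < y) :
    HasDerivAt (fun κ => jE κ t y) (2 * (jR κ y - jR κ t) * jE κ t y) κ := by
  have hG := jG_ne_zero hκ h0 ht
  refine (((hasDerivAt_jG_param hκ h0 hy).fun_div (hasDerivAt_jG_param hκ h0 ht) hG).fun_pow 2).congr_deriv ?_
  rw [jE]
  push_cast
  field_simp

theorem hasDerivAt_jE_deriv_param {κ : ℂ} (hκ : 0 ≤ κ.re) (h0 : κ ≠ 0) {t y : ℝ} (ht : 0 < t)
    (hy : 0 < y) :
    HasDerivAt (fun κ => 2 * (jR κ y - jR κ t) * jE κ t y)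
      ((2 * (jR₁ κ y - jR₁ κ t) + 4 * (jR κ y - jR κ t) ^ 2) * jE κ t y) κ := by
  refine ((((hasDerivAt_jR hκ h0 hy).fun_sub (hasDerivAt_jR hκ h0 ht)).const_mul 2).fun_mul
    (hasDerivAt_jE_param hκ h0 ht hy)).congr_deriv ?_
  ring

section bounds

variable {κ₀ κ : ℂ} {t y : ℝ}

theorem norm_jE_le_four (h0 : κ₀ ≠ 0) (h : κ ∈ halfDisc κ₀) (ht : 1 / ‖κ₀‖ ≤ t) (hty : t ≤ y) :
    ‖jE κ t y‖ ≤ 4 := by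
  have ht0 : 0 < t := (one_div_pos.2 (norm_pos_iff.2 h0)).trans_le ht
  refine (norm_jE_le_of_le h.1 (ne_zero_of_mem_halfDisc h0 h) ht0 hty one_half_pos
    (half_le_norm_macH (mul_ofReal_re_nonneg h.1 ht0.le)
      (half_le_norm_mul_of_mem_halfDisc h0 h ht))).trans (by norm_num)

theorem norm_jR_le (h0 : κ₀ ≠ 0) (h : κ ∈ halfDisc κ₀) (ht : 1 / ‖κ₀‖ ≤ t) : ‖jR κ t‖ ≤ 2 * t := by
  have ht0 : 0 < t := (one_div_pos.2 (norm_pos_iff.2 h0)).trans_le ht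
  have h1 := norm_macR_le_one (mul_ofReal_re_nonneg h.1 ht0.le)
    (half_le_norm_mul_of_mem_halfDisc h0 h ht)
  have h2 := norm_sub_le (macR (κ * t)) 1
  rw [norm_one] at h2
  rw [jR, norm_mul, Complex.norm_real, Real.norm_eq_abs, abs_of_pos ht0, mul_comm]
  exact mul_le_mul_of_nonneg_right (by linarith) ht0.le

theorem norm_jR₁_le (h0 : κ₀ ≠ 0) (h : κ ∈ halfDisc κ₀) (ht : 1 / ‖κ₀‖ ≤ t) :
    ‖jR₁ κ t‖ ≤ 4 * t ^ 2 := by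
  have ht0 : 0 < t := (one_div_pos.2 (norm_pos_iff.2 h0)).trans_le ht
  have h1 := norm_deriv_macR_le (mul_ofReal_re_nonneg h.1 ht0.le)
    (half_le_norm_mul_of_mem_halfDisc h0 h ht)
  rw [jR₁, norm_mul, norm_pow, Complex.norm_real, Real.norm_eq_abs, abs_of_pos ht0, mul_comm]
  exact mul_le_mul_of_nonneg_right h1 (by positivity)

theorem norm_jE_deriv_le (h0 : κ₀ ≠ 0) (h : κ ∈ halfDisc κ₀) (ht : 1 / ‖κ₀‖ ≤ t) (hty : t ≤ y) :
    ‖2 * (jR κ y - jR κ t) * jE κ t y‖ ≤ 32 * y := by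
  have hE := norm_jE_le_four h0 h ht hty
  have ht0 : 0 < t := (one_div_pos.2 (norm_pos_iff.2 h0)).trans_le ht
  have h1 : ‖jR κ y - jR κ t‖ ≤ 4 * y := by
    linarith [norm_sub_le (jR κ y) (jR κ t), norm_jR_le h0 h ht, norm_jR_le h0 h (ht.trans hty)]
  rw [norm_mul, norm_mul]
  norm_num
  nlinarith [norm_nonneg (jE κ t y), norm_nonneg (jR κ y - jR κ t)]

theorem norm_jE_deriv2_le (h0 : κ₀ ≠ 0) (h : κ ∈ halfDisc κ₀) (ht : 1 / ‖κ₀‖ ≤ t) (hty : t ≤ y) :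
    ‖(2 * (jR₁ κ y - jR₁ κ t) + 4 * (jR κ y - jR κ t) ^ 2) * jE κ t y‖ ≤ 320 * y ^ 2 := by
  have hE := norm_jE_le_four h0 h ht hty
  have ht0 : 0 < t := (one_div_pos.2 (norm_pos_iff.2 h0)).trans_le ht
  have h1 : ‖jR κ y - jR κ t‖ ≤ 4 * y := by
    linarith [norm_sub_le (jR κ y) (jR κ t), norm_jR_le h0 h ht, norm_jR_le h0 h (ht.trans hty)]
  have ht2 : t ^ 2 ≤ y ^ 2 := by gcongr
  have h2 : ‖jR₁ κ y - jR₁ κ t‖ ≤ 8 * y ^ 2 := by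
    linarith [norm_sub_le (jR₁ κ y) (jR₁ κ t), norm_jR₁_le h0 h ht, norm_jR₁_le h0 h (ht.trans hty)]
  have h3 : ‖2 * (jR₁ κ y - jR₁ κ t) + 4 * (jR κ y - jR κ t) ^ 2‖ ≤ 80 * y ^ 2 := by
    refine (norm_add_le _ _).trans ?_
    rw [norm_mul, norm_mul, norm_pow]
    norm_num
    have : ‖jR κ y - jR κ t‖ ^ 2 ≤ (4 * y) ^ 2 := by gcongr
    nlinarith
  rw [norm_mul]
  calc _ ≤ (80 * y ^ 2) * 4 := mul_le_mul h3 hE (norm_nonneg _) (by positivity)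
    _ = _ := by ring

end bounds

/-- Mean value inequality applied twice along the segment, first to `f'` and then to `f` minus its
linear part. -/
theorem norm_sub_sub_mul_le_of_hasDerivAt {f f' f'' : ℂ → ℂ} {B : Set ℂ} (hB : Convex ℝ B) {K : ℝ}
    (hf : ∀ κ ∈ B, HasDerivAt f (f' κ) κ) (hf' : ∀ κ ∈ B, HasDerivAt f' (f'' κ) κ)
    (hK : ∀ κ ∈ B, ‖f'' κ‖ ≤ K) {a b : ℂ} (ha : a ∈ B) (hb : b ∈ B) :
    ‖f b - f a - (b - a) * f' a‖ ≤ K * ‖b - a‖ ^ 2 := by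
  have hK0 : 0 ≤ K := (norm_nonneg _).trans (hK a ha)
  have hseg : segment ℝ a b ⊆ B := hB.segment_subset ha hb
  have h := (convex_segment a b).norm_image_sub_le_of_norm_hasDerivWithin_le
    (f := fun z => f z - z * f' a) (f' := fun z => f' z - f' a) (C := K * ‖b - a‖)
    (fun z hz => by
      refine (((hf z (hseg hz)).fun_sub ((hasDerivAt_id z).mul_const (f' a))).congr_deriv
        ?_).hasDerivWithinAt
      simp)
    (fun z hz => by
      refine (hB.norm_image_sub_le_of_norm_hasDerivWithin_le
        (fun w hw => (hf' w hw).hasDerivWithinAt) hK ha (hseg hz)).trans ?_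
      exact mul_le_mul_of_nonneg_left (norm_sub_le_of_mem_segment hz) hK0)
    (left_mem_segment ℝ a b) (right_mem_segment ℝ a b)
  refine le_trans (le_of_eq ?_) (h.trans (le_of_eq ?_))
  · congr 1; ring
  · ring

theorem hasDerivAt_jE_left {κ : ℂ} (hκ : 0 ≤ κ.re) (h0 : κ ≠ 0) {t : ℝ} (ht : 0 < t) (y : ℝ) :
    HasDerivAt (fun t => jE κ t y) (-(2 * (κ / t) * jR κ t * jE κ t y)) t := by
  have hG := jG_ne_zero hκ h0 ht
  have ht0 := Complex.ofReal_ne_zero.2 ht.ne'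
  have e : jG₁ κ t = κ / t * (jR κ t * jG κ t) := by
    rw [div_mul_eq_mul_div, ← jG₁_eq hκ h0 ht]; field_simp
  refine (((hasDerivAt_const t (jG κ y)).fun_div (hasDerivAt_jG hκ h0 ht) hG).fun_pow 2).congr_deriv ?_
  rw [jE, e]
  push_cast
  field_simp
  ring

theorem continuousOn_jE {κ : ℂ} (hκ : 0 ≤ κ.re) (h0 : κ ≠ 0) (y : ℝ) :
    ContinuousOn (fun t => jE κ t y) (Ioi 0) :=
  fun _ ht => (hasDerivAt_jE_left hκ h0 ht y).continuousAt.continuousWithinAt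

theorem continuousOn_jR {κ : ℂ} (hκ : 0 ≤ κ.re) (h0 : κ ≠ 0) :
    ContinuousOn (jR κ) (Ioi 0) := fun t ht => by
  have h := (hasDerivAt_macR (mul_ofReal_re_nonneg hκ (le_of_lt ht)) (mul_ofReal_ne_zero h0 ht)).comp t
    (hasDerivAt_const_mul_ofReal κ t)
  exact (Complex.continuous_ofReal.continuousAt.mul (h.continuousAt.sub
    continuousAt_const)).continuousWithinAt

theorem jE_self {κ : ℂ} (hκ : 0 ≤ κ.re) (h0 : κ ≠ 0) {y : ℝ} (hy : 0 < y) : jE κ y y = 1 := by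
  rw [jE, div_self (jG_ne_zero hκ h0 hy), one_pow]

/-- The derivative of `jD κ x y` with respect to `κ`. -/
noncomputable def jD₁ (κ : ℂ) (x y : ℝ) : ℂ :=
  2 * jR κ y * jD κ x y + (y - x * jE κ x y - jD κ x y) / κ

/-- Differentiating under the integral and estimating termwise would give `O(y²)`. Homogeneity
instead evaluates `∫ 2 R(t) E(t,y) dt` by the fundamental theorem applied to `t E(t,y)`, leaving
only `D` and boundary terms divided by `κ`. -/
theorem integral_jE_deriv {κ : ℂ} (hκ : 0 ≤ κ.re) (h0 : κ ≠ 0) {x y : ℝ} (hx : 0 < x) (hy : 0 < y) :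
    ∫ t in x..y, 2 * (jR κ y - jR κ t) * jE κ t y = jD₁ κ x y := by
  have hsub := uIcc_subset_Ioi hx hy
  have iE : IntervalIntegrable (fun t => jE κ t y) volume x y :=
    ((continuousOn_jE hκ h0 y).mono hsub).intervalIntegrable
  have iRE : IntervalIntegrable (fun t => 2 * jR κ t * jE κ t y) volume x y :=
    (((continuousOn_jR hκ h0).const_mul 2 |>.mul (continuousOn_jE hκ h0 y)).mono hsub).intervalIntegrable
  have h1 : ∫ t in x..y, (jE κ t y - κ * (2 * jR κ t * jE κ t y)) = y * jE κ y y - x * jE κ x y := by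
    refine intervalIntegral.integral_eq_sub_of_hasDerivAt (f := fun t : ℝ => t * jE κ t y)
      (fun t ht => ?_) (iE.sub (iRE.const_mul κ))
    have ht0 : (0 : ℝ) < t := hsub ht
    refine ((hasDerivAt_id t).ofReal_comp.fun_mul (hasDerivAt_jE_left hκ h0 ht0 y)).congr_deriv ?_
    have := Complex.ofReal_ne_zero.2 ht0.ne'
    simp only [id]
    push_cast
    field_simp
    ring
  rw [intervalIntegral.integral_sub iE (iRE.const_mul κ), intervalIntegral.integral_const_mul,
    ← jD_eq_integral hκ h0 hx hy, jE_self hκ h0 hy] at h1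
  have e : ∀ t, 2 * (jR κ y - jR κ t) * jE κ t y = 2 * jR κ y * jE κ t y - 2 * jR κ t * jE κ t y :=
    fun t => by ring
  simp_rw [e]
  rw [intervalIntegral.integral_sub (iE.const_mul _) iRE, intervalIntegral.integral_const_mul,
    ← jD_eq_integral hκ h0 hx hy, jD₁]
  field_simp
  linear_combination h1

section bounds

variable {κ₀ κ : ℂ} {x y : ℝ}

/-- From `∂E/∂t = 2κ (1 - h'/h) E` one gets `D = (1 - E(x,y))/(2κ) + ∫ (h'/h) E`, and `|h'/h| ≤
1/(4|κt|²)` is integrable at infinity. The bound does not depend on `y` and persists for imaginary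
`κ`, where `E` does not decay. -/
theorem norm_jD_le_div (h0 : κ₀ ≠ 0) (h : κ ∈ halfDisc κ₀) (hx : 1 / ‖κ₀‖ ≤ x) (hxy : x ≤ y) :
    ‖jD κ x y‖ ≤ 5 / ‖κ‖ := by
  have hn₀ := norm_pos_iff.2 h0
  have hk0 := ne_zero_of_mem_halfDisc h0 h
  have hn := norm_pos_iff.2 hk0
  have hx0 : 0 < x := (one_div_pos.2 hn₀).trans_le hx
  have hy0 := hx0.trans_le hxy
  have hsub := uIcc_subset_Ioi hx0 hy0
  have cE := (continuousOn_jE h.1 hk0 y).mono hsub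
  have cR : ContinuousOn (fun t : ℝ => macR (κ * t)) (uIcc x y) := fun t ht =>
    (HasDerivAt.comp t (hasDerivAt_macR (mul_ofReal_re_nonneg h.1 (le_of_lt (hsub ht)))
      (mul_ofReal_ne_zero hk0 (hsub ht)))
      (hasDerivAt_const_mul_ofReal κ t)).continuousAt.continuousWithinAt
  have h1 : ∫ t in x..y, 2 * κ * (jE κ t y - macR (κ * t) * jE κ t y) = jE κ y y - jE κ x y := by
    refine intervalIntegral.integral_eq_sub_of_hasDerivAt (f := fun t : ℝ => jE κ t y)
      (fun t ht => ?_) ((cE.sub (cR.mul cE)).const_mul _).intervalIntegrable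
    have ht0 : (0 : ℝ) < t := hsub ht
    refine (hasDerivAt_jE_left h.1 hk0 ht0 y).congr_deriv ?_
    have := Complex.ofReal_ne_zero.2 ht0.ne'
    rw [jR]
    field_simp
    ring
  rw [intervalIntegral.integral_const_mul, intervalIntegral.integral_sub cE.intervalIntegrable
    (cR.fun_mul cE).intervalIntegrable, ← jD_eq_integral h.1 hk0 hx0 hy0, jE_self h.1 hk0 hy0] at h1
  have h2 : ‖∫ t in x..y, macR (κ * t) * jE κ t y‖ ≤ ‖κ₀‖ / ‖κ‖ ^ 2 := by
    have hd : ∀ t ∈ uIcc x y, HasDerivAt (fun t : ℝ => -(1 / ‖κ‖ ^ 2 * t⁻¹)) (1 / ‖κ‖ ^ 2 * (t ^ 2)⁻¹) t :=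
      fun t ht => by
        refine (((hasDerivAt_inv (ne_of_gt (hsub ht))).const_mul (1 / ‖κ‖ ^ 2)).fun_neg).congr_deriv ?_
        ring
    have hi : IntervalIntegrable (fun t : ℝ => 1 / ‖κ‖ ^ 2 * (t ^ 2)⁻¹) volume x y := by
      refine ContinuousOn.intervalIntegrable (continuousOn_const.mul (ContinuousOn.inv₀ (by fun_prop)
        fun t ht => pow_ne_zero 2 (ne_of_gt (hsub ht))))
    refine (intervalIntegral.norm_integral_le_of_norm_le hxy (.of_forall fun t ht => ?_) hi).trans ?_
    · have ht0 : 0 < t := hx0.trans ht.1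
      have hE := norm_jE_le_four h0 h (hx.trans ht.1.le) ht.2
      have hR := norm_macR_le (mul_ofReal_re_nonneg h.1 ht0.le)
        (half_le_norm_mul_of_mem_halfDisc h0 h (hx.trans ht.1.le))
      rw [norm_mul]
      refine (mul_le_mul hR hE (norm_nonneg _) (by positivity)).trans (le_of_eq ?_)
      rw [norm_mul_ofReal ht0.le]
      field_simp
    · rw [intervalIntegral.integral_eq_sub_of_hasDerivAt hd hi]
      have h3 : x⁻¹ ≤ ‖κ₀‖ := by
        rw [inv_le_comm₀ hx0 hn₀]; simpa using hx
      have h4 : 0 < y⁻¹ := inv_pos.2 hy0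
      have h5 : 0 < 1 / ‖κ‖ ^ 2 := by positivity
      rw [div_eq_mul_one_div ‖κ₀‖]
      nlinarith
  have h3 : jD κ x y = (1 - jE κ x y) / (2 * κ) + ∫ t in x..y, macR (κ * t) * jE κ t y := by
    field_simp
    linear_combination h1
  have hE := norm_jE_le_four h0 h hx hxy
  have h4 : ‖(1 - jE κ x y) / (2 * κ)‖ ≤ (5 / 2) / ‖κ‖ := by
    rw [norm_div, norm_mul]
    have := norm_sub_le 1 (jE κ x y)
    rw [norm_one] at this
    rw [div_div]
    norm_num
    gcongr
    linarith
  have h5 : ‖κ₀‖ / ‖κ‖ ^ 2 ≤ 2 / ‖κ‖ := by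
    rw [div_le_div_iff₀ (by positivity) hn]
    nlinarith [norm_le_two_mul_of_mem_halfDisc h]
  calc ‖jD κ x y‖ ≤ (5 / 2) / ‖κ‖ + 2 / ‖κ‖ := by
        rw [h3]; exact (norm_add_le _ _).trans (add_le_add h4 (h2.trans h5))
    _ = (9 / 2) / ‖κ‖ := by ring
    _ ≤ _ := by gcongr; norm_num

/-- The first term gives `2 · 2y · 5/‖κ‖`, the second `9y/‖κ‖`; with `‖κ₀‖ ≤ 2‖κ‖` the total `29`
becomes at most `60`. Growth is linear in `y`, matching the integrability of `y |q y|`. -/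
theorem norm_jD₁_le (h0 : κ₀ ≠ 0) (h : κ ∈ halfDisc κ₀) (hx : 1 / ‖κ₀‖ ≤ x) (hxy : x ≤ y) :
    ‖jD₁ κ x y‖ ≤ 60 / ‖κ₀‖ * y := by
  have hn₀ := norm_pos_iff.2 h0
  have hk0 := ne_zero_of_mem_halfDisc h0 h
  have hn := norm_pos_iff.2 hk0
  have hx0 : 0 < x := (one_div_pos.2 hn₀).trans_le hx
  have hy0 := hx0.trans_le hxy
  have hR := norm_jR_le h0 h (hx.trans hxy)
  have hD := norm_jD_le_div h0 h hx hxy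
  have hE := norm_jE_le_four h0 h hx hxy
  have hD' : ‖jD κ x y‖ ≤ 4 * y := norm_jD_le h.1 hk0 (one_div_pos.2 hn₀) hx hxy
    fun t y ht hty => norm_jE_le_four h0 h ht hty
  have h1 : ‖(y : ℂ) - x * jE κ x y - jD κ x y‖ ≤ 9 * y := by
    refine (norm_sub_le _ _).trans ((add_le_add_left (norm_sub_le _ _) _).trans ?_)
    rw [norm_mul, Complex.norm_real, Complex.norm_real, Real.norm_eq_abs, Real.norm_eq_abs,
      abs_of_pos hx0, abs_of_pos hy0]
    nlinarith [norm_nonneg (jE κ x y)]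
  have h2 : ‖jD₁ κ x y‖ ≤ 29 * y / ‖κ‖ := by
    rw [jD₁]
    refine (norm_add_le _ _).trans ?_
    rw [norm_mul, norm_mul, norm_div]
    calc _ ≤ ‖(2 : ℂ)‖ * (2 * y) * (5 / ‖κ‖) + 9 * y / ‖κ‖ := by gcongr
      _ = _ := by norm_num; ring
  refine h2.trans ?_
  rw [div_mul_eq_mul_div, div_le_div_iff₀ hn hn₀]
  nlinarith [norm_le_two_mul_of_mem_halfDisc h]

end bounds

theorem norm_jE_taylor_le {κ₀ κ₁ κ₂ : ℂ} (h0 : κ₀ ≠ 0) (h₁ : κ₁ ∈ halfDisc κ₀)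
    (h₂ : κ₂ ∈ halfDisc κ₀) {t y : ℝ} (ht : 1 / ‖κ₀‖ ≤ t) (hty : t ≤ y) :
    ‖jE κ₂ t y - jE κ₁ t y - (κ₂ - κ₁) * (2 * (jR κ₁ y - jR κ₁ t) * jE κ₁ t y)‖
      ≤ 320 * y ^ 2 * ‖κ₂ - κ₁‖ ^ 2 := by
  have ht0 : 0 < t := (one_div_pos.2 (norm_pos_iff.2 h0)).trans_le ht
  have hy0 := ht0.trans_le hty
  exact norm_sub_sub_mul_le_of_hasDerivAt (f := fun κ => jE κ t y)
    (f' := fun κ => 2 * (jR κ y - jR κ t) * jE κ t y) (convex_halfDisc κ₀)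
    (fun κ h => hasDerivAt_jE_param h.1 (ne_zero_of_mem_halfDisc h0 h) ht0 hy0)
    (fun κ h => hasDerivAt_jE_deriv_param h.1 (ne_zero_of_mem_halfDisc h0 h) ht0 hy0)
    (fun κ h => norm_jE_deriv2_le h0 h ht hty) h₁ h₂

theorem norm_jE_sub_le {κ₀ κ₁ κ₂ : ℂ} (h0 : κ₀ ≠ 0) (h₁ : κ₁ ∈ halfDisc κ₀)
    (h₂ : κ₂ ∈ halfDisc κ₀) {t y : ℝ} (ht : 1 / ‖κ₀‖ ≤ t) (hty : t ≤ y) :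
    ‖jE κ₂ t y - jE κ₁ t y‖ ≤ 32 * y * ‖κ₂ - κ₁‖ := by
  have ht0 : 0 < t := (one_div_pos.2 (norm_pos_iff.2 h0)).trans_le ht
  exact (convex_halfDisc κ₀).norm_image_sub_le_of_norm_hasDerivWithin_le (f := fun κ => jE κ t y)
    (fun κ h => (hasDerivAt_jE_param h.1 (ne_zero_of_mem_halfDisc h0 h) ht0
      (ht0.trans_le hty)).hasDerivWithinAt)
    (fun κ h => norm_jE_deriv_le h0 h ht hty) h₁ h₂

/-- The factor `y³` is too large for integration against `q`; the estimate serves only to identify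
the pointwise derivative and to feed the dominated-convergence argument. -/
theorem norm_jD_taylor_le {κ₀ κ₁ κ₂ : ℂ} (h0 : κ₀ ≠ 0) (h₁ : κ₁ ∈ halfDisc κ₀)
    (h₂ : κ₂ ∈ halfDisc κ₀) {x y : ℝ} (hx : 1 / ‖κ₀‖ ≤ x) (hxy : x ≤ y) :
    ‖jD κ₂ x y - jD κ₁ x y - (κ₂ - κ₁) * jD₁ κ₁ x y‖ ≤ 320 * y ^ 3 * ‖κ₂ - κ₁‖ ^ 2 := by
  have hx0 : 0 < x := (one_div_pos.2 (norm_pos_iff.2 h0)).trans_le hx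
  have hy0 := hx0.trans_le hxy
  have hsub := uIcc_subset_Ioi hx0 hy0
  have k₁ := ne_zero_of_mem_halfDisc h0 h₁
  have k₂ := ne_zero_of_mem_halfDisc h0 h₂
  have c₁ := (continuousOn_jE h₁.1 k₁ y).mono hsub
  have c₂ := (continuousOn_jE h₂.1 k₂ y).mono hsub
  have c₃ : ContinuousOn (fun t => 2 * (jR κ₁ y - jR κ₁ t) * jE κ₁ t y) (uIcc x y) :=
    (continuousOn_const.mul (continuousOn_const.sub ((continuousOn_jR h₁.1 k₁).mono hsub))).mul c₁
  rw [jD_eq_integral h₁.1 k₁ hx0 hy0, jD_eq_integral h₂.1 k₂ hx0 hy0,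
    ← integral_jE_deriv h₁.1 k₁ hx0 hy0, ← intervalIntegral.integral_sub c₂.intervalIntegrable
      c₁.intervalIntegrable, ← intervalIntegral.integral_const_mul, ← intervalIntegral.integral_sub
      (c₂.fun_sub c₁).intervalIntegrable (continuousOn_const.fun_mul c₃).intervalIntegrable]
  refine (intervalIntegral.norm_integral_le_of_norm_le_const (C := 320 * y ^ 2 * ‖κ₂ - κ₁‖ ^ 2)
    fun t ht => ?_).trans ?_
  · rw [uIoc_of_le hxy] at ht
    exact norm_jE_taylor_le h0 h₁ h₂ (hx.trans ht.1.le) ht.2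
  · rw [abs_of_nonneg (by linarith)]
    have : y - x ≤ y := by linarith
    calc _ ≤ 320 * y ^ 2 * ‖κ₂ - κ₁‖ ^ 2 * y := by gcongr
      _ = _ := by ring

theorem norm_jD_sub_le {κ₀ κ₁ κ₂ : ℂ} (h0 : κ₀ ≠ 0) (h₁ : κ₁ ∈ halfDisc κ₀)
    (h₂ : κ₂ ∈ halfDisc κ₀) {x y : ℝ} (hx : 1 / ‖κ₀‖ ≤ x) (hxy : x ≤ y) :
    ‖jD κ₂ x y - jD κ₁ x y‖ ≤ 60 / ‖κ₀‖ * y * ‖κ₂ - κ₁‖ := by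
  have hx0 : 0 < x := (one_div_pos.2 (norm_pos_iff.2 h0)).trans_le hx
  have hy0 := hx0.trans_le hxy
  refine (convex_halfDisc κ₀).norm_image_sub_le_of_norm_hasDerivWithin_le (f := fun κ => jD κ x y)
    (f' := fun κ => jD₁ κ x y) (fun κ h => hasDerivWithinAt_of_norm_sub_le fun c hc => ?_)
    (fun κ h => norm_jD₁_le h0 h hx hxy) h₁ h₂
  have hlim : ∀ᶠ w in 𝓝[halfDisc κ₀] κ, 320 * y ^ 3 * ‖w - κ‖ < c := by
    have : Tendsto (fun w => 320 * y ^ 3 * ‖w - κ‖) (𝓝[halfDisc κ₀] κ) (𝓝 0) := by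
      have : Continuous fun w : ℂ => 320 * y ^ 3 * ‖w - κ‖ := by fun_prop
      simpa using (this.tendsto κ).mono_left nhdsWithin_le_nhds
    exact (tendsto_order.1 this).2 c hc
  filter_upwards [hlim, self_mem_nhdsWithin] with w hw hwB
  refine (norm_jD_taylor_le h0 h hwB hx hxy).trans ?_
  rw [sq, ← mul_assoc]
  exact mul_le_mul_of_nonneg_right hw.le (norm_nonneg _)

/-! ### Differentiability and Lipschitz bounds for the Jost solution -/

/-- The tail `∫ₐ^∞ y |q y| dy`. -/
noncomputable def qTail (q : ℝ → ℝ) (a : ℝ) : ℝ := ∫ y in Ioi a, y * |q y|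

theorem qTail_nonneg (q : ℝ → ℝ) {a : ℝ} (ha : 0 ≤ a) : 0 ≤ qTail q a :=
  setIntegral_nonneg measurableSet_Ioi fun _ hy => mul_nonneg (ha.trans (le_of_lt hy)) (abs_nonneg _)

/-- On `y ≥ a` the weight `1 + log⁺ a` is at most `1 + |log y|`. This absorbs the logarithmic growth
of the regular solution at `a = 1/‖κ₀‖`. -/
theorem qTail_mul_logWeight_le {q : ℝ → ℝ} (hq : IsLogIntegrable q) {a : ℝ} (ha : 0 ≤ a) :
    qTail q a * logWeight a ≤ logNorm q := by
  rw [qTail, ← integral_mul_const]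
  refine (setIntegral_mono_on ((hq.mul_integrableOn.mono_set (Ioi_subset_Ioi ha)).mul_const _)
    (hq.integrableOn.mono_set (Ioi_subset_Ioi ha)) measurableSet_Ioi fun y hy => ?_).trans
    (setIntegral_mono_set hq.integrableOn ((ae_restrict_iff' measurableSet_Ioi).2
      (.of_forall fun y hy => ?_)) (Ioi_subset_Ioi ha).eventuallyLE)
  · have hy0 : 0 < y := ha.trans_lt hy
    have h1 : logWeight a ≤ 1 + |Real.log y| := (logWeight_mono (le_of_lt hy)).trans logWeight_le
    calc y * |q y| * logWeight a ≤ y * |q y| * (1 + |Real.log y|) := by gcongr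
      _ = _ := by ring
  · have hy0 : (0 : ℝ) < y := hy
    simp only [Pi.zero_apply]
    positivity

theorem qTail_le_logNorm {q : ℝ → ℝ} (hq : IsLogIntegrable q) {a : ℝ} (ha : 0 ≤ a) :
    qTail q a ≤ logNorm q :=
  (le_mul_of_one_le_right (qTail_nonneg q ha) (one_le_logWeight a)).trans
    (qTail_mul_logWeight_le hq ha)

theorem jostBound_nonneg (q : ℝ → ℝ) {a C : ℝ} (ha : 0 ≤ a) (hC : 0 ≤ C) (y : ℝ) :
    0 ≤ jostBound q a C y :=
  indicator_nonneg (fun _ hy => mul_nonneg hC (mul_nonneg (ha.trans (le_of_lt hy)) (abs_nonneg _))) y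

theorem hasDerivWithinAt_kernelOp_indicator {q : ℝ → ℝ} (hq : IsLogIntegrable q) {a : ℝ} (ha : 0 < a)
    {S : Set ℂ} {κ₀ : ℂ} (h₀ : κ₀ ∈ S) {k : ℂ → ℝ → ℝ → ℂ} {k' : ℝ → ℝ → ℂ} {L A p C : ℝ}
    (hL : 0 < L) (hA : 0 ≤ A)
    (hk : ∀ κ ∈ S, IsKernel (fun x => (Ioi a).indicator fun y => k κ x y * q y) (jostBound q a C))
    (hk' : IsKernel (fun x => (Ioi a).indicator fun y => k' x y * q y) (jostBound q a L))
    (hlip : ∀ κ ∈ S, ∀ x, ∀ y ∈ Ioi a, ‖k κ x y - k κ₀ x y‖ ≤ L * y * ‖κ - κ₀‖)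
    (hk'L : ∀ x, ∀ y ∈ Ioi a, ‖k' x y‖ ≤ L * y)
    (htay : ∀ κ ∈ S, ∀ x, ∀ y ∈ Ioi a,
      ‖k κ x y - k κ₀ x y - (κ - κ₀) * k' x y‖ ≤ A * y ^ p * y * ‖κ - κ₀‖ ^ 2) :
    HasDerivWithinAt (fun κ => kernelOp fun x => (Ioi a).indicator fun y => k κ x y * q y)
      (kernelOp fun x => (Ioi a).indicator fun y => k' x y * q y) S κ₀ := by
  have hm : AEStronglyMeasurable ((Ioi a).indicator fun y : ℝ => A / (2 * L) * y ^ p) := by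
    refine (aestronglyMeasurable_indicator_iff measurableSet_Ioi).2 ?_
    exact ((measurable_id.pow_const p).const_mul _).aestronglyMeasurable
  refine hasDerivWithinAt_kernelOp (τ := (Ioi a).indicator fun y : ℝ => A / (2 * L) * y ^ p) h₀ hk hk'
    (integrable_jostBound hq ha (2 * L)) hm (jostBound_nonneg q ha.le (by positivity))
    (fun y => indicator_nonneg (fun y hy => ?_) y) fun κ hκ x y => ?_
  · have : (0 : ℝ) < y := ha.trans hy
    positivity
  · by_cases hy : y ∈ Ioi a
    · have hy0 : (0 : ℝ) < y := ha.trans hy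
      simp only [indicator_of_mem hy, jostBound]
      have e : k κ x y * (q y : ℂ) - k κ₀ x y * q y - (κ - κ₀) * (k' x y * q y) =
        (k κ x y - k κ₀ x y - (κ - κ₀) * k' x y) * q y := by ring
      rw [e, norm_mul, Complex.norm_real, Real.norm_eq_abs]
      -- The minimum switches from the Taylor bound to the Lipschitz bound `2 L y |q| ‖κ - κ₀‖`
      -- exactly where the two coincide, which dictates `τ = A / (2L) · y^p`.
      rcases le_total 1 (A / (2 * L) * y ^ p * ‖κ - κ₀‖) with h | h
      · rw [min_eq_left h]
        have h1 : ‖k κ x y - k κ₀ x y - (κ - κ₀) * k' x y‖ ≤ 2 * L * y * ‖κ - κ₀‖ := by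
          refine (norm_sub_le _ _).trans ?_
          rw [norm_mul]
          have := mul_le_mul_of_nonneg_left (hk'L x y hy) (norm_nonneg (κ - κ₀))
          linarith [hlip κ hκ x y hy]
        calc _ ≤ 2 * L * y * ‖κ - κ₀‖ * |q y| := by gcongr
          _ = _ := by ring
      · rw [min_eq_right h]
        calc _ ≤ A * y ^ p * y * ‖κ - κ₀‖ ^ 2 * |q y| := by gcongr; exact htay κ hκ x y hy
          _ = _ := by field_simp
    · simp only [indicator_of_notMem hy, jostBound]
      simp

theorem norm_kernelOp_indicator_sub_le {q : ℝ → ℝ} (hq : IsLogIntegrable q) {a : ℝ} (ha : 0 < a)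
    {k₁ k₂ : ℝ → ℝ → ℂ} {L C₁ C₂ : ℝ}
    (h₁ : IsKernel (fun x => (Ioi a).indicator fun y => k₁ x y * q y) (jostBound q a C₁))
    (h₂ : IsKernel (fun x => (Ioi a).indicator fun y => k₂ x y * q y) (jostBound q a C₂))
    (hL : ∀ x, ∀ y ∈ Ioi a, ‖k₁ x y - k₂ x y‖ ≤ L * y) :
    ‖kernelOp (fun x => (Ioi a).indicator fun y => k₁ x y * q y) -
      kernelOp (fun x => (Ioi a).indicator fun y => k₂ x y * q y)‖ ≤ L * qTail q a := by
  rw [qTail, ← integral_jostBound]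
  refine h₁.norm_kernelOp_sub_le h₂ (integrable_jostBound hq ha L) fun x y => ?_
  by_cases hy : y ∈ Ioi a
  · simp only [indicator_of_mem hy, jostBound]
    rw [← sub_mul, norm_mul, Complex.norm_real, Real.norm_eq_abs, ← mul_assoc]
    exact mul_le_mul_of_nonneg_right (hL x y hy) (abs_nonneg _)
  · simp [indicator_of_notMem hy, jostBound]

section

variable {q : ℝ → ℝ} {κ₀ κ : ℂ}

theorem isKernel_jostKernel_of_mem_halfDisc (hq : IsLogIntegrable q) (h0 : κ₀ ≠ 0)
    (h : κ ∈ halfDisc κ₀) : IsKernel (jostKernel q (1 / ‖κ₀‖) κ) (jostBound q (1 / ‖κ₀‖) 4) :=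
  isKernel_jostKernel hq h.1 (ne_zero_of_mem_halfDisc h0 h) (one_div_pos.2 (norm_pos_iff.2 h0))
    fun _ _ ht hty => norm_jE_le_four h0 h ht hty

theorem isKernel_jD₁ (hq : IsLogIntegrable q) (h0 : κ₀ ≠ 0) (h : κ ∈ halfDisc κ₀) :
    IsKernel (fun x => (Ioi (1 / ‖κ₀‖)).indicator fun y =>
      jD₁ κ (min (max x (1 / ‖κ₀‖)) y) y * q y) (jostBound q (1 / ‖κ₀‖) (60 / ‖κ₀‖)) := by
  have ha := one_div_pos.2 (norm_pos_iff.2 h0)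
  set a := 1 / ‖κ₀‖
  have hk0 := ne_zero_of_mem_halfDisc h0 h
  have hsub : Ioi a ⊆ Ioi 0 := Ioi_subset_Ioi ha.le
  have hmem : ∀ x, ∀ y ∈ Ioi a, a ≤ min (max x a) y := fun x y hy =>
    le_min (le_max_right _ _) (le_of_lt hy)
  have cG := (continuousOn_jG h.1 hk0).mono hsub
  have hpos : ∀ x, ∀ y ∈ Ioi a, min (max x a) y ∈ Ioi 0 := fun x y hy => ha.trans_le (hmem x y hy)
  refine isKernel_of_le_jostBound hq ha (k := fun x y => jD₁ κ (min (max x a) y) y)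
    (fun x => ?_) (fun y hy => ?_) (fun x y hy => norm_jD₁_le h0 h (hmem x y hy) (min_le_right _ _))
  · have cm : ContinuousOn (fun y => min (max x a) y) (Ioi a) :=
      (continuous_const.min continuous_id).continuousOn
    have cGm : ContinuousOn (fun y => jG κ (min (max x a) y)) (Ioi a) :=
      (continuousOn_jG h.1 hk0).comp cm (hpos x)
    have cE : ContinuousOn (fun y => jE κ (min (max x a) y) y) (Ioi a) :=
      (cG.div cGm fun y hy => jG_ne_zero h.1 hk0 (hpos x y hy)).pow 2
    have cD : ContinuousOn (fun y => jD κ (min (max x a) y) y) (Ioi a) :=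
      (cG.pow 2).mul (((continuousOn_jB h.1 hk0).mono hsub).sub
        ((continuousOn_jB h.1 hk0).comp cm (hpos x)))
    exact ((continuousOn_const.mul ((continuousOn_jR h.1 hk0).mono hsub)).mul cD).add
      (((Complex.continuous_ofReal.continuousOn.sub
        ((Complex.continuous_ofReal.comp_continuousOn cm).mul cE)).sub cD).div_const _)
  · have cm : Continuous fun x => min (max x a) y :=
      (continuous_id.max continuous_const).min continuous_const
    have cE : Continuous fun x => jE κ (min (max x a) y) y :=
      (continuousOn_jE h.1 hk0 y).comp_continuous cm fun x => hpos x y hy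
    have cD : Continuous fun x => jD κ (min (max x a) y) y :=
      continuous_const.mul (continuous_const.sub
        ((continuousOn_jB h.1 hk0).comp_continuous cm fun x => hpos x y hy))
    exact (continuous_const.mul cD).add (((continuous_const.sub
      ((Complex.continuous_ofReal.comp cm).mul cE)).sub cD).div_const _)

theorem DifferentiableWithinAt.boundedContinuousFunction_apply {f : ℂ → ℝ →ᵇ ℂ} {S : Set ℂ} {z : ℂ}
    (h : DifferentiableWithinAt ℂ f S z) (x : ℝ) :
    DifferentiableWithinAt ℂ (fun w => f w x) S z :=
  (BoundedContinuousFunction.evalCLM (β := ℂ) ℂ x).differentiableAt.comp_differentiableWithinAt z h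

theorem mem_halfDisc_self (hκ : 0 ≤ κ₀.re) : κ₀ ∈ halfDisc κ₀ :=
  ⟨hκ, by rw [sub_self, norm_zero]; positivity⟩

theorem differentiableWithinAt_kernelOp_jostKernel (hq : IsLogIntegrable q) (h0 : κ₀ ≠ 0)
    (hκ : 0 ≤ κ₀.re) :
    DifferentiableWithinAt ℂ (fun κ => kernelOp (jostKernel q (1 / ‖κ₀‖) κ)) (halfDisc κ₀) κ₀ := by
  have hn := norm_pos_iff.2 h0
  have ha := one_div_pos.2 hn
  have hmem : ∀ x, ∀ y ∈ Ioi (1 / ‖κ₀‖), 1 / ‖κ₀‖ ≤ min (max x (1 / ‖κ₀‖)) y := fun x y hy =>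
    le_min (le_max_right _ _) (le_of_lt hy)
  refine HasDerivWithinAt.differentiableWithinAt (F := (ℝ →ᵇ ℂ) →L[ℂ] (ℝ →ᵇ ℂ))
    (hasDerivWithinAt_kernelOp_indicator hq ha (mem_halfDisc_self hκ) (p := 2) (A := 320)
      (k := fun κ x y => jD κ (min (max x (1 / ‖κ₀‖)) y) y) (by positivity) (by norm_num)
      (fun κ h => isKernel_jostKernel_of_mem_halfDisc hq h0 h)
      (isKernel_jD₁ hq h0 (mem_halfDisc_self hκ))
      (fun κ h x y hy => norm_jD_sub_le h0 (mem_halfDisc_self hκ) h (hmem x y hy) (min_le_right _ _))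
      (fun x y hy => norm_jD₁_le h0 (mem_halfDisc_self hκ) (hmem x y hy) (min_le_right _ _))
      fun κ h x y hy => ?_)
  refine (norm_jD_taylor_le h0 (mem_halfDisc_self hκ) h (hmem x y hy) (min_le_right _ _)).trans
    (le_of_eq ?_)
  rw [Real.rpow_two]
  ring

theorem norm_kernelOp_jostKernel_sub_le (hq : IsLogIntegrable q) (h0 : κ₀ ≠ 0) {κ₁ κ₂ : ℂ}
    (h₁ : κ₁ ∈ halfDisc κ₀) (h₂ : κ₂ ∈ halfDisc κ₀) :
    ‖kernelOp (jostKernel q (1 / ‖κ₀‖) κ₂) - kernelOp (jostKernel q (1 / ‖κ₀‖) κ₁)‖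
      ≤ 60 / ‖κ₀‖ * ‖κ₂ - κ₁‖ * qTail q (1 / ‖κ₀‖) :=
  norm_kernelOp_indicator_sub_le hq (one_div_pos.2 (norm_pos_iff.2 h0))
    (isKernel_jostKernel_of_mem_halfDisc hq h0 h₂) (isKernel_jostKernel_of_mem_halfDisc hq h0 h₁)
    fun x y hy => (norm_jD_sub_le h0 h₁ h₂ (le_min (le_max_right _ _) (le_of_lt hy))
      (min_le_right _ _)).trans (le_of_eq (by ring))

/-- A bound for the inverse of the Volterra operator of the Jost solution. -/
noncomputable def jostConst (q : ℝ → ℝ) : ℝ := 2 * Real.exp (2 * (4 * logNorm q))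

theorem jostConst_pos (q : ℝ → ℝ) : 0 < jostConst q := mul_pos two_pos (Real.exp_pos _)

theorem isUnit_jostKernel_of_mem_halfDisc (hq : IsLogIntegrable q) (h0 : κ₀ ≠ 0)
    (h : κ ∈ halfDisc κ₀) : IsUnit (1 - kernelOp (jostKernel q (1 / ‖κ₀‖) κ)) ∧
      ‖Ring.inverse (1 - kernelOp (jostKernel q (1 / ‖κ₀‖) κ))‖ ≤ jostConst q := by
  have ha := one_div_pos.2 (norm_pos_iff.2 h0)
  obtain ⟨h1, h2⟩ := isUnit_one_sub_jostKernel hq h.1 (ne_zero_of_mem_halfDisc h0 h) ha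
    fun _ _ ht hty => norm_jE_le_four h0 h ht hty
  refine ⟨h1, h2.trans ?_⟩
  have := qTail_le_logNorm hq ha.le
  rw [qTail] at this
  unfold jostConst
  gcongr

theorem norm_jostSolOn_le (hq : IsLogIntegrable q) (h0 : κ₀ ≠ 0) (h : κ ∈ halfDisc κ₀) :
    ‖jostSolOn q (1 / ‖κ₀‖) κ‖ ≤ jostConst q := by
  refine (ContinuousLinearMap.le_opNorm _ _).trans ?_
  rw [norm_one, mul_one]
  exact (isUnit_jostKernel_of_mem_halfDisc hq h0 h).2

/-- The resolvent identity with the Lipschitz bound of the kernel; the factor `qTail / ‖κ₀‖` is the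
gain that is spent later. -/
theorem norm_jostSolOn_sub_le (hq : IsLogIntegrable q) (h0 : κ₀ ≠ 0) {κ₁ κ₂ : ℂ}
    (h₁ : κ₁ ∈ halfDisc κ₀) (h₂ : κ₂ ∈ halfDisc κ₀) :
    ‖jostSolOn q (1 / ‖κ₀‖) κ₂ - jostSolOn q (1 / ‖κ₀‖) κ₁‖
      ≤ 60 * jostConst q ^ 2 * (qTail q (1 / ‖κ₀‖) / ‖κ₀‖) * ‖κ₂ - κ₁‖ := by
  obtain ⟨u₁, b₁⟩ := isUnit_jostKernel_of_mem_halfDisc hq h0 h₁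
  obtain ⟨u₂, b₂⟩ := isUnit_jostKernel_of_mem_halfDisc hq h0 h₂
  have hM := (jostConst_pos q).le
  have e : jostSolOn q (1 / ‖κ₀‖) κ₂ - jostSolOn q (1 / ‖κ₀‖) κ₁ =
    (Ring.inverse (1 - kernelOp (jostKernel q (1 / ‖κ₀‖) κ₂)) -
      Ring.inverse (1 - kernelOp (jostKernel q (1 / ‖κ₀‖) κ₁))) 1 := rfl
  rw [e]
  refine (ContinuousLinearMap.le_opNorm _ _).trans ?_
  rw [norm_one, mul_one]
  refine (norm_inverse_one_sub_sub_le u₂ u₁).trans ?_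
  calc _ ≤ jostConst q * (60 / ‖κ₀‖ * ‖κ₂ - κ₁‖ * qTail q (1 / ‖κ₀‖)) * jostConst q := by
        have hT := norm_kernelOp_jostKernel_sub_le hq h0 h₁ h₂
        have := qTail_nonneg q (one_div_pos.2 (norm_pos_iff.2 h0)).le
        gcongr
    _ = _ := by ring

theorem differentiableWithinAt_jostSolOn (hq : IsLogIntegrable q) (h0 : κ₀ ≠ 0) (hκ : 0 ≤ κ₀.re) :
    DifferentiableWithinAt ℂ (jostSolOn q (1 / ‖κ₀‖)) (halfDisc κ₀) κ₀ :=
  (differentiableWithinAt_inverse_one_sub (differentiableWithinAt_kernelOp_jostKernel hq h0 hκ)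
    (isUnit_jostKernel_of_mem_halfDisc hq h0 (mem_halfDisc_self hκ)).1).clm_apply
    (differentiableWithinAt_const _)

/-- The kernel of the functional defining `jostM₁` at `a`. -/
noncomputable def jostKernel₁ (q : ℝ → ℝ) (a : ℝ) (κ : ℂ) (_ y : ℝ) : ℂ :=
  (Ioi a).indicator (fun y => jE κ a y * q y) y

theorem isKernel_jostKernel₁ (hq : IsLogIntegrable q) (h0 : κ₀ ≠ 0)
    (h : κ ∈ halfDisc κ₀) :
    IsKernel (jostKernel₁ q (1 / ‖κ₀‖) κ) (jostBound q (1 / ‖κ₀‖) (4 * ‖κ₀‖)) := by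
  have hn := norm_pos_iff.2 h0
  have ha := one_div_pos.2 hn
  refine isKernel_of_le_jostBound hq ha (k := fun _ y => jE κ (1 / ‖κ₀‖) y) (fun x => ?_)
    (fun y hy => continuous_const) fun x y hy => ?_
  · exact (((continuousOn_jG h.1 (ne_zero_of_mem_halfDisc h0 h)).mono
      (Ioi_subset_Ioi ha.le)).div_const _).pow 2
  · refine (norm_jE_le_four h0 h le_rfl (le_of_lt hy)).trans ?_
    have : 1 / ‖κ₀‖ < y := hy
    rw [div_lt_iff₀ hn] at this
    linarith

theorem jostM₁_eq_kernelOp (hq : IsLogIntegrable q) (h0 : κ₀ ≠ 0) (h : κ ∈ halfDisc κ₀) :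
    jostM₁ q κ (1 / ‖κ₀‖) =
      -(kernelOp (jostKernel₁ q (1 / ‖κ₀‖) κ) (jostSolOn q (1 / ‖κ₀‖) κ) 0) := by
  have ha := one_div_pos.2 (norm_pos_iff.2 h0)
  rw [(isKernel_jostKernel₁ hq h0 h).kernelOp_apply, jostM₁, ← integral_indicator measurableSet_Ioi]
  congr 2; ext y
  by_cases hy : y ∈ Ioi (1 / ‖κ₀‖)
  · simp only [jostKernel₁, indicator_of_mem hy]
    rw [jostM_eq hq h.1 (ne_zero_of_mem_halfDisc h0 h) ha (le_of_lt hy)]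
  · simp only [jostKernel₁, indicator_of_notMem hy, zero_mul]

theorem differentiableWithinAt_kernelOp_jostKernel₁ (hq : IsLogIntegrable q) (h0 : κ₀ ≠ 0)
    (hκ : 0 ≤ κ₀.re) :
    DifferentiableWithinAt ℂ (fun κ => kernelOp (jostKernel₁ q (1 / ‖κ₀‖) κ)) (halfDisc κ₀) κ₀ := by
  have hn := norm_pos_iff.2 h0
  have ha := one_div_pos.2 hn
  have hs := mem_halfDisc_self hκ
  refine HasDerivWithinAt.differentiableWithinAt (F := (ℝ →ᵇ ℂ) →L[ℂ] (ℝ →ᵇ ℂ))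
    (hasDerivWithinAt_kernelOp_indicator hq ha hs (p := 1) (A := 320) (L := 32)
      (k := fun κ _ y => jE κ (1 / ‖κ₀‖) y)
      (k' := fun _ y => 2 * (jR κ₀ y - jR κ₀ (1 / ‖κ₀‖)) * jE κ₀ (1 / ‖κ₀‖) y)
      (by norm_num) (by norm_num)
      (fun κ h => isKernel_jostKernel₁ hq h0 h) ?_
      (fun κ h x y hy => norm_jE_sub_le h0 hs h le_rfl (le_of_lt hy))
      (fun x y hy => norm_jE_deriv_le h0 hs le_rfl (le_of_lt hy))
      fun κ h x y hy => ?_)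
  · have hsub : Ioi (1 / ‖κ₀‖) ⊆ Ioi 0 := Ioi_subset_Ioi ha.le
    refine isKernel_of_le_jostBound hq ha (k := fun _ y =>
      2 * (jR κ₀ y - jR κ₀ (1 / ‖κ₀‖)) * jE κ₀ (1 / ‖κ₀‖) y) (fun x => ?_)
      (fun y hy => continuous_const) (fun x y hy => norm_jE_deriv_le h0 hs le_rfl (le_of_lt hy))
    exact (continuousOn_const.mul (((continuousOn_jR hκ h0).mono hsub).sub continuousOn_const)).mul
      ((((continuousOn_jG hκ h0).mono hsub).div_const _).pow 2)
  · refine (norm_jE_taylor_le h0 hs h le_rfl (le_of_lt hy)).trans (le_of_eq ?_)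
    rw [Real.rpow_one]
    ring

theorem differentiableWithinAt_jostM (hq : IsLogIntegrable q) (h0 : κ₀ ≠ 0) (hκ : 0 ≤ κ₀.re) :
    DifferentiableWithinAt ℂ (fun κ => jostM q κ (1 / ‖κ₀‖)) (halfDisc κ₀) κ₀ := by
  have ha := one_div_pos.2 (norm_pos_iff.2 h0)
  have h : DifferentiableWithinAt ℂ (fun κ => jostSolOn q (1 / ‖κ₀‖) κ (1 / ‖κ₀‖)) (halfDisc κ₀) κ₀ :=
    (differentiableWithinAt_jostSolOn hq h0 hκ).boundedContinuousFunction_apply _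
  exact DifferentiableWithinAt.congr_of_eventuallyEq_of_mem h (eventually_nhdsWithin_of_forall fun κ hκ => jostM_eq hq hκ.1 (ne_zero_of_mem_halfDisc h0 hκ) ha le_rfl)
    (mem_halfDisc_self hκ)

theorem differentiableWithinAt_jostM₁ (hq : IsLogIntegrable q) (h0 : κ₀ ≠ 0) (hκ : 0 ≤ κ₀.re) :
    DifferentiableWithinAt ℂ (fun κ => jostM₁ q κ (1 / ‖κ₀‖)) (halfDisc κ₀) κ₀ := by
  have h1 := (differentiableWithinAt_kernelOp_jostKernel₁ hq h0 hκ).clm_apply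
    (differentiableWithinAt_jostSolOn hq h0 hκ)
  have h2 : DifferentiableWithinAt ℂ (fun κ =>
      -(kernelOp (jostKernel₁ q (1 / ‖κ₀‖) κ) (jostSolOn q (1 / ‖κ₀‖) κ) 0)) (halfDisc κ₀) κ₀ :=
    (h1.boundedContinuousFunction_apply 0).fun_neg
  exact DifferentiableWithinAt.congr_of_eventuallyEq_of_mem h2 (eventually_nhdsWithin_of_forall fun κ h => jostM₁_eq_kernelOp hq h0 h) (mem_halfDisc_self hκ)

theorem norm_jostM_le (hq : IsLogIntegrable q) (h0 : κ₀ ≠ 0) (h : κ ∈ halfDisc κ₀) :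
    ‖jostM q κ (1 / ‖κ₀‖)‖ ≤ jostConst q := by
  rw [jostM_eq hq h.1 (ne_zero_of_mem_halfDisc h0 h) (one_div_pos.2 (norm_pos_iff.2 h0)) le_rfl]
  exact ((jostSolOn q (1 / ‖κ₀‖) κ).norm_coe_le_norm _).trans (norm_jostSolOn_le hq h0 h)

theorem norm_jostM_sub_le (hq : IsLogIntegrable q) (h0 : κ₀ ≠ 0) {κ₁ κ₂ : ℂ}
    (h₁ : κ₁ ∈ halfDisc κ₀) (h₂ : κ₂ ∈ halfDisc κ₀) :
    ‖jostM q κ₂ (1 / ‖κ₀‖) - jostM q κ₁ (1 / ‖κ₀‖)‖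
      ≤ 60 * jostConst q ^ 2 * (qTail q (1 / ‖κ₀‖) / ‖κ₀‖) * ‖κ₂ - κ₁‖ := by
  have ha := one_div_pos.2 (norm_pos_iff.2 h0)
  rw [jostM_eq hq h₁.1 (ne_zero_of_mem_halfDisc h0 h₁) ha le_rfl,
    jostM_eq hq h₂.1 (ne_zero_of_mem_halfDisc h0 h₂) ha le_rfl]
  exact ((jostSolOn q (1 / ‖κ₀‖) κ₂ - jostSolOn q (1 / ‖κ₀‖) κ₁).norm_coe_le_norm _).trans
    (norm_jostSolOn_sub_le hq h0 h₁ h₂)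

theorem norm_jostM₁_le (hq : IsLogIntegrable q) (h0 : κ₀ ≠ 0) (h : κ ∈ halfDisc κ₀) :
    ‖jostM₁ q κ (1 / ‖κ₀‖)‖ ≤ 4 * ‖κ₀‖ * qTail q (1 / ‖κ₀‖) * jostConst q := by
  have hT : ‖kernelOp (jostKernel₁ q (1 / ‖κ₀‖) κ)‖ ≤ 4 * ‖κ₀‖ * qTail q (1 / ‖κ₀‖) := by
    rw [qTail, ← integral_jostBound]
    exact (isKernel_jostKernel₁ hq h0 h).norm_kernelOp_le
  rw [jostM₁_eq_kernelOp hq h0 h, norm_neg]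
  refine (BoundedContinuousFunction.norm_coe_le_norm _ _).trans
    ((ContinuousLinearMap.le_opNorm _ _).trans ?_)
  exact mul_le_mul hT (norm_jostSolOn_le hq h0 h) (norm_nonneg _) ((norm_nonneg _).trans hT)

/-- There is no factor `1/‖κ₀‖` here because `m'` enters the Wronskian multiplied by `a = 1/‖κ₀‖`;
in the second contribution the `‖κ₀‖` of the functional cancels that of `m`, and `240 = 4 · 60`. -/
theorem norm_jostM₁_sub_le (hq : IsLogIntegrable q) (h0 : κ₀ ≠ 0) {κ₁ κ₂ : ℂ}
    (h₁ : κ₁ ∈ halfDisc κ₀) (h₂ : κ₂ ∈ halfDisc κ₀) :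
    ‖jostM₁ q κ₂ (1 / ‖κ₀‖) - jostM₁ q κ₁ (1 / ‖κ₀‖)‖
      ≤ (32 * jostConst q + 240 * jostConst q ^ 2 * logNorm q) * qTail q (1 / ‖κ₀‖) * ‖κ₂ - κ₁‖ := by
  have hn := norm_pos_iff.2 h0
  have ha := one_div_pos.2 hn
  have hM := (jostConst_pos q).le
  have hε := qTail_nonneg q ha.le
  have hεN := qTail_le_logNorm hq ha.le
  set a := 1 / ‖κ₀‖
  have hT : ‖kernelOp (jostKernel₁ q a κ₁)‖ ≤ 4 * ‖κ₀‖ * qTail q a := by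
    rw [qTail, ← integral_jostBound]
    exact (isKernel_jostKernel₁ hq h0 h₁).norm_kernelOp_le
  have hT' : ‖kernelOp (jostKernel₁ q a κ₂) - kernelOp (jostKernel₁ q a κ₁)‖ ≤
      32 * ‖κ₂ - κ₁‖ * qTail q a :=
    norm_kernelOp_indicator_sub_le hq ha (isKernel_jostKernel₁ hq h0 h₂)
      (isKernel_jostKernel₁ hq h0 h₁) fun x y hy =>
      (norm_jE_sub_le h0 h₁ h₂ le_rfl (le_of_lt hy)).trans (le_of_eq (by ring))
  rw [jostM₁_eq_kernelOp hq h0 h₁, jostM₁_eq_kernelOp hq h0 h₂]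
  have e : -(kernelOp (jostKernel₁ q a κ₂) (jostSolOn q a κ₂) 0) -
      -(kernelOp (jostKernel₁ q a κ₁) (jostSolOn q a κ₁) 0) =
      -(((kernelOp (jostKernel₁ q a κ₂) - kernelOp (jostKernel₁ q a κ₁)) (jostSolOn q a κ₂) +
        kernelOp (jostKernel₁ q a κ₁) (jostSolOn q a κ₂ - jostSolOn q a κ₁)) 0) := by
    rw [map_sub]
    simp only [sub_apply, BoundedContinuousFunction.add_apply, BoundedContinuousFunction.sub_apply]
    simp
    ring
  rw [e, norm_neg]
  refine (BoundedContinuousFunction.norm_coe_le_norm _ _).trans ((norm_add_le _ _).trans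
    ((add_le_add (ContinuousLinearMap.le_opNorm _ _) (ContinuousLinearMap.le_opNorm _ _)).trans ?_))
  have hs := norm_jostSolOn_sub_le hq h0 h₁ h₂
  have hb := norm_jostSolOn_le hq h0 h₂
  calc _ ≤ 32 * ‖κ₂ - κ₁‖ * qTail q a * jostConst q + 4 * ‖κ₀‖ * qTail q a *
        (60 * jostConst q ^ 2 * (qTail q a / ‖κ₀‖) * ‖κ₂ - κ₁‖) := by gcongr
    _ = (32 * jostConst q + 240 * jostConst q ^ 2 * qTail q a) * qTail q a * ‖κ₂ - κ₁‖ := by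
      field_simp; ring
    _ ≤ _ := by gcongr

end

/-! ### The inner region: free Jost solution against regular solution -/

theorem mul_one_add_abs_log_le {t : ℝ} (h0 : 0 < t) (h2 : t ≤ 2) : t * (1 + |Real.log t|) ≤ 4 := by
  rcases le_total t 1 with h | h
  · have h3 := Real.abs_log_mul_self_lt t h0 h
    rw [abs_mul, abs_of_pos h0] at h3
    nlinarith
  · rw [abs_of_nonneg (Real.log_nonneg h)]
    nlinarith [Real.log_le_sub_one_of_pos h0, Real.log_nonneg h]

theorem norm_mul_macPsi_le {s : ℂ} (hs : 0 ≤ s.re) (h0 : s ≠ 0) (h2 : ‖s‖ ≤ 2) :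
    ‖s * macPsi s‖ ≤ 20 := by
  rw [norm_mul]
  have h1 := mul_le_mul_of_nonneg_left (norm_macPsi_le hs h0 h2) (norm_nonneg s)
  linarith [mul_one_add_abs_log_le (norm_pos_iff.2 h0) h2]

/-- A bound for the regular solution on `(0, 1 / ‖κ₀‖]`. -/
noncomputable def regConst (q : ℝ → ℝ) : ℝ := 2 * Real.exp (2 * (logNorm q + 9 / 4))

theorem regConst_pos (q : ℝ → ℝ) : 0 < regConst q := mul_pos two_pos (Real.exp_pos _)

/-- The Wronskian of the free Jost solution and the regular solution, up to a constant factor. -/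
noncomputable def freeW (q : ℝ → ℝ) (κ : ℂ) (x : ℝ) : ℂ :=
  macPsi (κ * x) * regP q (-κ ^ 2) x - κ * x * macPsi₁ (κ * x) * regV q (-κ ^ 2) x

theorem hasDerivAt_mul_ofReal (κ : ℂ) (y : ℝ) : HasDerivAt (fun κ : ℂ => κ * y) (y : ℂ) κ := by
  simpa using (hasDerivAt_id κ).mul_const (y : ℂ)

section

variable {q : ℝ → ℝ} {κ₀ κ : ℂ} {y : ℝ}

theorem norm_le_of_mem_halfDisc (h : κ ∈ halfDisc κ₀) : ‖κ‖ ≤ 3 / 2 * ‖κ₀‖ := by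
  have h1 := norm_sub_norm_le κ κ₀
  linarith [h.2]

theorem norm_mul_le_of_mem_halfDisc (h0 : κ₀ ≠ 0) (h : κ ∈ halfDisc κ₀) (hy : 0 < y)
    (hy1 : y ≤ 1 / ‖κ₀‖) : ‖κ * y‖ ≤ 3 / 2 := by
  have hn := norm_pos_iff.2 h0
  rw [norm_mul_ofReal hy.le]
  rw [le_div_iff₀ hn] at hy1
  nlinarith [norm_le_of_mem_halfDisc h]

/-- For `y ≤ 1/‖κ₀‖` one has `|κy| ≤ 3/2`, whence the `9/4 = (3/2)²` in `regConst`. -/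
theorem norm_sq_mul_sq_le (h0 : κ₀ ≠ 0) (h : κ ∈ halfDisc κ₀) (hy : 0 < y)
    (hy1 : y ≤ 1 / ‖κ₀‖) : ‖-κ ^ 2‖ * y ^ 2 ≤ 9 / 4 := by
  have h1 := norm_mul_le_of_mem_halfDisc h0 h hy hy1
  rw [norm_mul_ofReal hy.le] at h1
  rw [norm_neg, norm_pow, ← mul_pow]
  have : 0 ≤ ‖κ‖ * y := by positivity
  nlinarith

theorem norm_regV_le_regConst (hq : IsLogIntegrable q) (h0 : κ₀ ≠ 0) (h : κ ∈ halfDisc κ₀)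
    (hy : 0 < y) (hy1 : y ≤ 1 / ‖κ₀‖) : ‖regV q (-κ ^ 2) y‖ ≤ regConst q * logWeight y := by
  have := norm_sq_mul_sq_le h0 h hy hy1
  have := logWeight_pos y
  refine (norm_regV_le hq _ hy le_rfl).trans ?_
  unfold regConst
  gcongr

theorem norm_regP_le_regConst (hq : IsLogIntegrable q) (h0 : κ₀ ≠ 0) (h : κ ∈ halfDisc κ₀)
    (hy : 0 < y) (hy1 : y ≤ 1 / ‖κ₀‖) :
    ‖regP q (-κ ^ 2) y‖ ≤ (logNorm q + 9 / 4) * regConst q * logWeight y := by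
  have := norm_sq_mul_sq_le h0 h hy hy1
  have := logWeight_pos y
  have := logNorm_nonneg q
  refine (norm_regP_le hq hy _).trans ?_
  unfold regConst
  gcongr

theorem norm_regV_sub_le_regConst (hq : IsLogIntegrable q) (h0 : κ₀ ≠ 0) (hκ : 0 ≤ κ₀.re)
    (h : κ ∈ halfDisc κ₀) (hy : 0 < y) (hy1 : y ≤ 1 / ‖κ₀‖) :
    ‖regV q (-κ ^ 2) y - regV q (-κ₀ ^ 2) y‖ ≤
      regConst q ^ 2 * (5 / 2 * ‖κ₀‖ * ‖κ - κ₀‖ * y ^ 2) * logWeight y := by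
  have h1 := norm_sq_mul_sq_le h0 h hy hy1
  have h2 := norm_sq_mul_sq_le h0 (mem_halfDisc_self hκ) hy hy1
  have h3 := logWeight_pos y
  have h4 : ‖-κ ^ 2 - -κ₀ ^ 2‖ ≤ 5 / 2 * ‖κ₀‖ * ‖κ - κ₀‖ := by
    have e : -κ ^ 2 - -κ₀ ^ 2 = -((κ + κ₀) * (κ - κ₀)) := by ring
    rw [e, norm_neg, norm_mul]
    refine mul_le_mul_of_nonneg_right ?_ (norm_nonneg _)
    linarith [norm_add_le κ κ₀, norm_le_of_mem_halfDisc h]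
  refine (norm_regV_sub_le hq _ _ hy).trans ?_
  calc _ ≤ regConst q * (5 / 2 * ‖κ₀‖ * ‖κ - κ₀‖ * y ^ 2) * regConst q * logWeight y := by
        unfold regConst; gcongr
    _ = _ := by ring

/-- The `κ`-derivative of `ψ(κy)` is `s ψ'(s) / κ` at `s = κy`, at most `5/‖κ‖`. The logarithm of
`ψ` disappears upon differentiation. -/
theorem norm_macPsi_sub_le (h0 : κ₀ ≠ 0) (hκ : 0 ≤ κ₀.re) (h : κ ∈ halfDisc κ₀) (hy : 0 < y)
    (hy1 : y ≤ 1 / ‖κ₀‖) : ‖macPsi (κ * y) - macPsi (κ₀ * y)‖ ≤ 10 / ‖κ₀‖ * ‖κ - κ₀‖ := by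
  have hn := norm_pos_iff.2 h0
  refine (convex_halfDisc κ₀).norm_image_sub_le_of_norm_hasDerivWithin_le
    (f := fun κ => macPsi (κ * y)) (f' := fun κ => macPsi₁ (κ * y) * y) (fun w hw => ?_)
    (fun w hw => ?_) (mem_halfDisc_self hκ) h
  · exact (HasDerivAt.comp w (hasDerivAt_macPsi (mul_ofReal_re_nonneg hw.1 hy.le)
      (mul_ofReal_ne_zero (ne_zero_of_mem_halfDisc h0 hw) hy))
      (hasDerivAt_mul_ofReal w y)).hasDerivWithinAt
  · have hw0 := ne_zero_of_mem_halfDisc h0 hw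
    have hwn := norm_pos_iff.2 hw0
    have h1 := norm_mul_macPsi₁_le (mul_ofReal_re_nonneg hw.1 hy.le) (mul_ofReal_ne_zero hw0 hy)
      ((norm_mul_le_of_mem_halfDisc h0 hw hy hy1).trans (by norm_num))
    have e : w * y * macPsi₁ (w * y) = w * (macPsi₁ (w * y) * y) := by ring
    rw [e, norm_mul] at h1
    rw [le_div_iff₀ hn]
    nlinarith [norm_le_two_mul_of_mem_halfDisc hw, norm_nonneg (macPsi₁ (w * y) * y)]

theorem norm_mul_macPsi₁_sub_le (h0 : κ₀ ≠ 0) (hκ : 0 ≤ κ₀.re) (h : κ ∈ halfDisc κ₀) (hy : 0 < y)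
    (hy1 : y ≤ 1 / ‖κ₀‖) :
    ‖κ * y * macPsi₁ (κ * y) - κ₀ * y * macPsi₁ (κ₀ * y)‖ ≤ 20 * y * ‖κ - κ₀‖ := by
  refine (convex_halfDisc κ₀).norm_image_sub_le_of_norm_hasDerivWithin_le
    (f := fun κ => κ * y * macPsi₁ (κ * y)) (f' := fun κ => κ * y * macPsi (κ * y) * y)
    (fun w hw => ?_) (fun w hw => ?_) (mem_halfDisc_self hκ) h
  · exact (HasDerivAt.comp w (hasDerivAt_mul_macPsi₁ (mul_ofReal_re_nonneg hw.1 hy.le)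
      (mul_ofReal_ne_zero (ne_zero_of_mem_halfDisc h0 hw) hy))
      (hasDerivAt_mul_ofReal w y)).hasDerivWithinAt
  · rw [norm_mul, Complex.norm_real, Real.norm_eq_abs, abs_of_pos hy]
    exact mul_le_mul_of_nonneg_right (norm_mul_macPsi_le (mul_ofReal_re_nonneg hw.1 hy.le)
      (mul_ofReal_ne_zero (ne_zero_of_mem_halfDisc h0 hw) hy)
      ((norm_mul_le_of_mem_halfDisc h0 hw hy hy1).trans (by norm_num))) hy.le

/-- The singularity of `ψ` is harmless in the second term: `v - v₀` carries `‖κ₀‖ y²`, and `‖κ₀‖ y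
|ψ(κ₀y)| ≤ 20`. Here `50 = 20 · 5/2`. -/
theorem norm_macPsi_mul_regV_sub_le (hq : IsLogIntegrable q) (h0 : κ₀ ≠ 0) (hκ : 0 ≤ κ₀.re)
    (h : κ ∈ halfDisc κ₀) (hy : 0 < y) (hy1 : y ≤ 1 / ‖κ₀‖) :
    ‖macPsi (κ * y) * regV q (-κ ^ 2) y - macPsi (κ₀ * y) * regV q (-κ₀ ^ 2) y‖ ≤
      (10 * regConst q + 50 * regConst q ^ 2) / ‖κ₀‖ * logWeight y * ‖κ - κ₀‖ := by
  have hn := norm_pos_iff.2 h0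
  have hs := mem_halfDisc_self hκ
  have h1 := norm_macPsi_sub_le h0 hκ h hy hy1
  have h2 := norm_regV_le_regConst hq h0 h hy hy1
  have h3 := norm_regV_sub_le_regConst hq h0 hκ h hy hy1
  have h4 := norm_mul_macPsi_le (mul_ofReal_re_nonneg hκ hy.le) (mul_ofReal_ne_zero h0 hy)
      ((norm_mul_le_of_mem_halfDisc h0 hs hy hy1).trans (by norm_num))
  rw [norm_mul, norm_mul_ofReal hy.le] at h4
  have hw := logWeight_pos y
  have hC := regConst_pos q
  have e : macPsi (κ * y) * regV q (-κ ^ 2) y - macPsi (κ₀ * y) * regV q (-κ₀ ^ 2) y =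
      (macPsi (κ * y) - macPsi (κ₀ * y)) * regV q (-κ ^ 2) y +
      macPsi (κ₀ * y) * (regV q (-κ ^ 2) y - regV q (-κ₀ ^ 2) y) := by ring
  rw [e]
  refine (norm_add_le _ _).trans ?_
  rw [norm_mul, norm_mul]
  calc _ ≤ 10 / ‖κ₀‖ * ‖κ - κ₀‖ * (regConst q * logWeight y) + ‖macPsi (κ₀ * y)‖ *
        (regConst q ^ 2 * (5 / 2 * ‖κ₀‖ * ‖κ - κ₀‖ * y ^ 2) * logWeight y) := by gcongr
    _ = 10 / ‖κ₀‖ * ‖κ - κ₀‖ * (regConst q * logWeight y) + (‖κ₀‖ * y * ‖macPsi (κ₀ * y)‖) * y *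
        (regConst q ^ 2 * (5 / 2 * ‖κ - κ₀‖) * logWeight y) := by ring
    _ ≤ 10 / ‖κ₀‖ * ‖κ - κ₀‖ * (regConst q * logWeight y) + 20 * (1 / ‖κ₀‖) *
        (regConst q ^ 2 * (5 / 2 * ‖κ - κ₀‖) * logWeight y) := by gcongr
    _ = _ := by ring

theorem norm_macPsi_le_ten (h0 : κ₀ ≠ 0) (h : κ ∈ halfDisc κ₀) : ‖macPsi (κ * (1 / ‖κ₀‖ : ℝ))‖ ≤ 10 := by
  have ha := one_div_pos.2 (norm_pos_iff.2 h0)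
  have h1 := norm_mul_le_of_mem_halfDisc h0 h ha le_rfl
  have h2 := half_le_norm_mul_of_mem_halfDisc h0 h le_rfl
  refine (norm_macPsi_le (mul_ofReal_re_nonneg h.1 ha.le) (mul_ofReal_ne_zero
    (ne_zero_of_mem_halfDisc h0 h) ha) (by linarith)).trans ?_
  have hp : 0 < ‖κ * (1 / ‖κ₀‖ : ℝ)‖ := by linarith
  have : |Real.log ‖κ * (1 / ‖κ₀‖ : ℝ)‖| ≤ 1 := by
    rw [abs_le]
    constructor
    · have h3 := Real.one_sub_inv_le_log_of_pos hp
      have h4 : ‖κ * (1 / ‖κ₀‖ : ℝ)‖⁻¹ ≤ 2 := by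
        rw [inv_le_comm₀ hp two_pos]; linarith
      linarith
    · linarith [Real.log_le_sub_one_of_pos hp]
  linarith

theorem norm_freeW_le (hq : IsLogIntegrable q) (h0 : κ₀ ≠ 0) (h : κ ∈ halfDisc κ₀) :
    ‖freeW q κ (1 / ‖κ₀‖)‖ ≤
      (10 * (logNorm q + 9 / 4) + 5) * regConst q * logWeight (1 / ‖κ₀‖) := by
  have ha := one_div_pos.2 (norm_pos_iff.2 h0)
  have hC := regConst_pos q
  have hw := logWeight_pos (1 / ‖κ₀‖)
  have hL := logNorm_nonneg q
  have h1 := norm_macPsi_le_ten h0 h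
  have h2 := norm_mul_macPsi₁_le (mul_ofReal_re_nonneg h.1 ha.le) (mul_ofReal_ne_zero
    (ne_zero_of_mem_halfDisc h0 h) ha)
      ((norm_mul_le_of_mem_halfDisc h0 h ha le_rfl).trans (by norm_num))
  have h3 := norm_regV_le_regConst hq h0 h ha le_rfl
  have h4 := norm_regP_le_regConst hq h0 h ha le_rfl
  rw [freeW]
  refine (norm_sub_le _ _).trans ?_
  rw [norm_mul, norm_mul _ (regV _ _ _)]
  calc _ ≤ 10 * ((logNorm q + 9 / 4) * regConst q * logWeight (1 / ‖κ₀‖)) +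
        5 * (regConst q * logWeight (1 / ‖κ₀‖)) := by gcongr
    _ = _ := by ring

end

theorem hasDerivAt_macPsi_mul {κ : ℂ} (hκ : 0 ≤ κ.re) (h0 : κ ≠ 0) {x : ℝ} (hx : 0 < x) :
    HasDerivAt (fun x : ℝ => macPsi (κ * x)) (macPsi₁ (κ * x) * κ) x :=
  HasDerivAt.comp x (hasDerivAt_macPsi (mul_ofReal_re_nonneg hκ hx.le) (mul_ofReal_ne_zero h0 hx))
    (hasDerivAt_const_mul_ofReal κ x)

theorem hasDerivAt_mul_macPsi₁_mul {κ : ℂ} (hκ : 0 ≤ κ.re) (h0 : κ ≠ 0) {x : ℝ} (hx : 0 < x) :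
    HasDerivAt (fun x : ℝ => κ * x * macPsi₁ (κ * x)) (κ * x * macPsi (κ * x) * κ) x :=
  HasDerivAt.comp x (hasDerivAt_mul_macPsi₁ (mul_ofReal_re_nonneg hκ hx.le)
    (mul_ofReal_ne_zero h0 hx)) (hasDerivAt_const_mul_ofReal κ x)

theorem continuousOn_macPsi_mul {κ : ℂ} (hκ : 0 ≤ κ.re) (h0 : κ ≠ 0) :
    ContinuousOn (fun x : ℝ => macPsi (κ * x)) (Ioi 0) := fun _ hx =>
  (hasDerivAt_macPsi_mul hκ h0 hx).continuousAt.continuousWithinAt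

theorem continuousOn_macPsi₁_mul {κ : ℂ} (hκ : 0 ≤ κ.re) (h0 : κ ≠ 0) :
    ContinuousOn (fun x : ℝ => macPsi₁ (κ * x)) (Ioi 0) := by
  have h : ContinuousOn (fun x : ℝ => κ * x * macPsi₁ (κ * x) / (κ * x)) (Ioi 0) :=
    ContinuousOn.div (fun x hx =>
      (hasDerivAt_mul_macPsi₁_mul hκ h0 hx).continuousAt.continuousWithinAt) (by fun_prop)
      fun x hx => mul_ofReal_ne_zero h0 hx
  refine h.congr fun x hx => ?_
  have := mul_ofReal_ne_zero h0 hx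
  simp only
  rw [mul_div_cancel_left₀ _ this]

theorem continuousOn_freeW_source {q : ℝ → ℝ} (hq : IsLogIntegrable q) {κ : ℂ} (hκ : 0 ≤ κ.re)
    (h0 : κ ≠ 0) {a b : ℝ} (ha : 0 < a) (hb : 0 < b) :
    IntervalIntegrable (fun y : ℝ => y * q y * (macPsi (κ * y) * regV q (-κ ^ 2) y)) volume a b := by
  have hsub := uIcc_subset_Ioi ha hb
  have hq1 : IntervalIntegrable (fun y : ℝ => (y : ℂ) * q y) volume a b := by
    refine intervalIntegrable_of_Ioi (c := 0) ?_ ha.le hb.le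
    refine hq.mul_integrableOn.mono' (Complex.continuous_ofReal.aestronglyMeasurable.mul
      (aestronglyMeasurable_ofReal_Ioi hq le_rfl))
      ((ae_restrict_iff' measurableSet_Ioi).2 (.of_forall fun y hy => ?_))
    rw [norm_mul, Complex.norm_real, Complex.norm_real, Real.norm_eq_abs, Real.norm_eq_abs,
      abs_of_pos hy]
  exact hq1.mul_continuousOn (((continuousOn_macPsi_mul hκ h0).mono hsub).mul
    (continuous_regV hq _).continuousOn)

/-- The energy terms of the two equations cancel in the Wronskian, so its derivative contains only
`q`. -/
theorem freeW_sub {q : ℝ → ℝ} (hq : IsLogIntegrable q) {κ : ℂ} (hκ : 0 ≤ κ.re)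
    (h0 : κ ≠ 0) {a b : ℝ} (ha : 0 < a) (hb : 0 < b) :
    freeW q κ b - freeW q κ a =
      ∫ y in a..b, y * q y * (macPsi (κ * y) * regV q (-κ ^ 2) y) := by
  have hsub := uIcc_subset_Ioi ha hb
  refine AbsolutelyContinuousOnInterval.sub_eq_integral ?_ (continuousOn_freeW_source hq hκ h0 ha hb) ?_
  · have h1 : AbsolutelyContinuousOnInterval (fun x : ℝ => macPsi (κ * x)) a b :=
      .of_hasDerivAt (fun x hx => hasDerivAt_macPsi_mul hκ h0 (hsub hx))
        (((continuousOn_macPsi₁_mul hκ h0).mono hsub).mul continuousOn_const)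
    have h2 : AbsolutelyContinuousOnInterval (fun x : ℝ => κ * x * macPsi₁ (κ * x)) a b :=
      .of_hasDerivAt (fun x hx => hasDerivAt_mul_macPsi₁_mul hκ h0 (hsub hx))
        (((ContinuousOn.mul (by fun_prop) ((continuousOn_macPsi_mul hκ h0).mono hsub))).mul
          continuousOn_const)
    have h3 : AbsolutelyContinuousOnInterval (regV q (-κ ^ 2)) a b :=
      .of_hasDerivAt (fun x hx => hasDerivAt_regV hq _ (hsub hx))
        ((continuousOn_regP_div hq _).mono hsub)
    exact (h1.cmul (absolutelyContinuous_regP hq _ ha.le hb.le)).sub (h2.cmul h3)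
  · filter_upwards [ae_hasDerivAt_regP hq (-κ ^ 2)] with x hp hx
    have hx0 : 0 < x := hsub hx
    have hxc := Complex.ofReal_ne_zero.2 hx0.ne'
    refine (((hasDerivAt_macPsi_mul hκ h0 hx0).fun_mul (hp hx0)).fun_sub
      ((hasDerivAt_mul_macPsi₁_mul hκ h0 hx0).fun_mul (hasDerivAt_regV hq _ hx0))).congr_deriv ?_
    field_simp
    ring

/-- For `y < x < 1` one has `|log x| ≤ |log y|`, so the logarithm moves under the integral, where it
meets the logarithmic moment of `q` near `0`. -/
theorem tendsto_one_add_abs_log_mul_norm_regP {q : ℝ → ℝ} (hq : IsLogIntegrable q) (z : ℂ) :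
    Tendsto (fun x => (1 + |Real.log x|) * ‖regP q z x‖) (𝓝[>] 0) (𝓝 0) := by
  obtain ⟨M, hM0, hM⟩ := norm_mul_sub_mul_regV_le hq z 1
  have hint := integrableOn_log_mul hq ‖z‖ 1
  have hint' : IntegrableOn (fun y => (1 + |Real.log y|) * (y * (|q y| + ‖z‖))) (Icc 0 1) := by
    rwa [integrableOn_Icc_iff_integrableOn_Ioo]
  have hc := intervalIntegral.continuousOn_primitive hint' 0 ⟨le_rfl, zero_le_one⟩
  have ht : Tendsto (fun x => M * ∫ y in Ioc 0 x, (1 + |Real.log y|) * (y * (|q y| + ‖z‖)))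
      (𝓝[>] 0) (𝓝 0) := by
    have h1 := (hc.mono_left (nhdsWithin_le_of_mem (Icc_mem_nhdsGT one_pos))).const_mul M
    simpa using h1
  refine squeeze_zero' (.of_forall fun x => by positivity) ?_ ht
  filter_upwards [Ioo_mem_nhdsGT (one_pos (α := ℝ))] with x hx
  rw [integral_Ioc_eq_integral_Ioo, regP]
  have h2 : ‖∫ y in Ioo 0 x, (y : ℂ) * ((q y : ℂ) - z) * regV q z y‖ ≤
      ∫ y in Ioo 0 x, (1 + |Real.log x|)⁻¹ * M * ((1 + |Real.log y|) * (y * (|q y| + ‖z‖))) := by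
    refine norm_integral_le_of_norm_le ((hint.mono_set (Ioo_subset_Ioo_right hx.2.le)).const_mul _)
      ((ae_restrict_iff' measurableSet_Ioo).2 (.of_forall fun y hy => ?_))
    have hy0 := hy.1
    have hlog : |Real.log x| ≤ |Real.log y| := by
      rw [abs_of_neg (Real.log_neg hx.1 hx.2), abs_of_neg (Real.log_neg hy0 (hy.2.trans hx.2))]
      exact neg_le_neg (Real.log_le_log hy0 hy.2.le)
    refine (hM y ⟨hy0, hy.2.trans hx.2⟩).trans ?_
    have h3 : 1 ≤ (1 + |Real.log x|)⁻¹ * (1 + |Real.log y|) := by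
      rw [inv_mul_eq_div, one_le_div (by positivity)]
      linarith
    calc M * (y * (|q y| + ‖z‖)) ≤ (M * (y * (|q y| + ‖z‖))) *
          ((1 + |Real.log x|)⁻¹ * (1 + |Real.log y|)) :=
          le_mul_of_one_le_right (by positivity) h3
      _ = _ := by ring
  rw [integral_const_mul] at h2
  calc _ ≤ (1 + |Real.log x|) * ((1 + |Real.log x|)⁻¹ * M *
        ∫ y in Ioo 0 x, (1 + |Real.log y|) * (y * (|q y| + ‖z‖))) := by gcongr
    _ = _ := by
      have : 1 + |Real.log x| ≠ 0 := by positivity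
      field_simp

theorem tendsto_macPsi_mul_regP {q : ℝ → ℝ} (hq : IsLogIntegrable q) (z : ℂ) {κ : ℂ} (hκ : 0 ≤ κ.re)
    (h0 : κ ≠ 0) : Tendsto (fun x : ℝ => macPsi (κ * x) * regP q z x) (𝓝[>] 0) (𝓝 0) := by
  have hn := norm_pos_iff.2 h0
  have ht := (tendsto_one_add_abs_log_mul_norm_regP hq z).const_mul (5 * (1 + |Real.log ‖κ‖|))
  rw [mul_zero] at ht
  refine squeeze_zero_norm' ?_ ht
  filter_upwards [Ioo_mem_nhdsGT (by positivity : 0 < 2 / ‖κ‖)] with x hx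
  have hx0 := hx.1
  have h2 : ‖κ * x‖ ≤ 2 := by
    have := hx.2
    rw [lt_div_iff₀ hn] at this
    rw [norm_mul_ofReal hx0.le]
    linarith
  have h1 := norm_macPsi_le (mul_ofReal_re_nonneg hκ hx0.le) (mul_ofReal_ne_zero h0 hx0) h2
  rw [norm_mul_ofReal hx0.le, Real.log_mul hn.ne' hx0.ne'] at h1
  have h3 : 1 + |Real.log ‖κ‖ + Real.log x| ≤ (1 + |Real.log ‖κ‖|) * (1 + |Real.log x|) := by
    nlinarith [abs_add_le (Real.log ‖κ‖) (Real.log x), abs_nonneg (Real.log ‖κ‖),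
      abs_nonneg (Real.log x), mul_nonneg (abs_nonneg (Real.log ‖κ‖)) (abs_nonneg (Real.log x))]
  rw [norm_mul]
  calc _ ≤ (5 * ((1 + |Real.log ‖κ‖|) * (1 + |Real.log x|))) * ‖regP q z x‖ := by
        gcongr
        linarith
    _ = _ := by ring

/-- Only the difference is treated, so the limit of `s ψ'(s)` at `0` is never needed: `s ψ'(s)` at
`κx` and `κ₀x` differ by `O(x)`. -/
theorem tendsto_freeW_sub {q : ℝ → ℝ} (hq : IsLogIntegrable q) {κ₀ κ : ℂ} (h0 : κ₀ ≠ 0)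
    (hκ : 0 ≤ κ₀.re) (h : κ ∈ halfDisc κ₀) :
    Tendsto (fun x => freeW q κ x - freeW q κ₀ x) (𝓝[>] 0) (𝓝 0) := by
  have ha := one_div_pos.2 (norm_pos_iff.2 h0)
  have hV : ∀ z, Tendsto (regV q z) (𝓝[>] 0) (𝓝 1) := fun z => by
    have := ((continuous_regV hq z).tendsto 0).mono_left (nhdsWithin_le_nhds (s := Ioi 0))
    rwa [regV_of_nonpos hq z le_rfl] at this
  have t1 := tendsto_macPsi_mul_regP hq (-κ ^ 2) h.1 (ne_zero_of_mem_halfDisc h0 h)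
  have t2 := tendsto_macPsi_mul_regP hq (-κ₀ ^ 2) hκ h0
  have t3 : Tendsto (fun x : ℝ => κ * x * macPsi₁ (κ * x) - κ₀ * x * macPsi₁ (κ₀ * x)) (𝓝[>] 0)
      (𝓝 0) := by
    have hc : Tendsto (fun x : ℝ => 20 * x * ‖κ - κ₀‖) (𝓝[>] 0) (𝓝 0) := by
      have : Continuous fun x : ℝ => 20 * x * ‖κ - κ₀‖ := by fun_prop
      simpa using (this.tendsto 0).mono_left (nhdsWithin_le_nhds (s := Ioi 0))
    refine squeeze_zero_norm' ?_ hc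
    filter_upwards [Ioo_mem_nhdsGT ha] with x hx
    exact norm_mul_macPsi₁_sub_le h0 hκ h hx.1 hx.2.le
  have t4 : Tendsto (fun x : ℝ => κ₀ * x * macPsi₁ (κ₀ * x) *
      (regV q (-κ ^ 2) x - regV q (-κ₀ ^ 2) x)) (𝓝[>] 0) (𝓝 0) := by
    have hc : Tendsto (fun x : ℝ => 5 * ‖regV q (-κ ^ 2) x - regV q (-κ₀ ^ 2) x‖) (𝓝[>] 0) (𝓝 0) := by
      simpa using (((hV (-κ ^ 2)).sub (hV (-κ₀ ^ 2))).norm).const_mul 5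
    refine squeeze_zero_norm' ?_ hc
    filter_upwards [Ioo_mem_nhdsGT ha] with x hx
    rw [norm_mul]
    exact mul_le_mul_of_nonneg_right (norm_mul_macPsi₁_le (mul_ofReal_re_nonneg hκ hx.1.le)
      (mul_ofReal_ne_zero h0 hx.1) ((norm_mul_le_of_mem_halfDisc h0 (mem_halfDisc_self hκ) hx.1
      hx.2.le).trans (by norm_num))) (norm_nonneg _)
  have := ((t1.sub t2).sub (t3.mul (hV (-κ ^ 2)))).sub t4
  simp only [sub_zero, zero_mul] at this
  refine this.congr fun x => ?_
  rw [freeW, freeW]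
  ring

theorem norm_freeW_sub_le {q : ℝ → ℝ} (hq : IsLogIntegrable q) {κ₀ κ : ℂ} (h0 : κ₀ ≠ 0)
    (hκ : 0 ≤ κ₀.re) (h : κ ∈ halfDisc κ₀) :
    ‖freeW q κ (1 / ‖κ₀‖) - freeW q κ₀ (1 / ‖κ₀‖)‖ ≤
      (10 * regConst q + 50 * regConst q ^ 2) / ‖κ₀‖ * logNorm q * ‖κ - κ₀‖ := by
  have hn := norm_pos_iff.2 h0
  have ha := one_div_pos.2 hn
  have hC := regConst_pos q
  set a := 1 / ‖κ₀‖ with had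
  set A := (10 * regConst q + 50 * regConst q ^ 2) / ‖κ₀‖ with hA
  have hA0 : 0 ≤ A := by positivity
  have ht := ((tendsto_freeW_sub hq h0 hκ h).norm).add_const (A * logNorm q * ‖κ - κ₀‖)
  rw [norm_zero, zero_add] at ht
  refine ge_of_tendsto ht ?_
  filter_upwards [Ioo_mem_nhdsGT ha] with x hx
  have hk0 := ne_zero_of_mem_halfDisc h0 h
  have i₁ := continuousOn_freeW_source hq h.1 hk0 hx.1 ha
  have i₂ := continuousOn_freeW_source hq hκ h0 hx.1 ha
  -- The boundary term at `x` vanishes in the limit `x → 0`, while the integral is bounded uniformly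
  -- in `x`.
  have e : freeW q κ a - freeW q κ₀ a = (freeW q κ x - freeW q κ₀ x) +
      ∫ y in x..a, (y : ℂ) * q y * (macPsi (κ * y) * regV q (-κ ^ 2) y -
        macPsi (κ₀ * y) * regV q (-κ₀ ^ 2) y) := by
    simp_rw [mul_sub ((_ : ℂ) * _)]
    rw [intervalIntegral.integral_sub i₁ i₂, ← freeW_sub hq h.1 hk0 hx.1 ha,
      ← freeW_sub hq hκ h0 hx.1 ha]
    ring
  rw [e]
  refine (norm_add_le _ _).trans (add_le_add_right ?_ _)
  have hi : IntegrableOn (fun y => A * ‖κ - κ₀‖ * (y * (1 + |Real.log y|) * |q y|)) (Ioi 0) :=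
    hq.integrableOn.const_mul _
  have hsub : Ioc x a ⊆ Ioi 0 := fun y hy => hx.1.trans hy.1
  rw [intervalIntegral.integral_of_le hx.2.le]
  refine (norm_integral_le_of_norm_le (hi.mono_set hsub) ((ae_restrict_iff' measurableSet_Ioc).2
    (.of_forall fun y hy => ?_))).trans ((setIntegral_mono_set hi ((ae_restrict_iff'
      measurableSet_Ioi).2 (.of_forall fun y hy => ?_)) hsub.eventuallyLE).trans (le_of_eq ?_))
  · have hy0 : 0 < y := hx.1.trans hy.1
    rw [norm_mul, norm_mul, Complex.norm_real, Complex.norm_real, Real.norm_eq_abs, Real.norm_eq_abs,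
      abs_of_pos hy0]
    calc _ ≤ y * |q y| * (A * (1 + |Real.log y|) * ‖κ - κ₀‖) := by
          refine mul_le_mul_of_nonneg_left ?_ (by positivity)
          refine (norm_macPsi_mul_regV_sub_le hq h0 hκ h hy0 hy.2).trans ?_
          rw [← hA]
          have := logWeight_le (x := y)
          gcongr
      _ = _ := by ring
  · have hy0 : (0 : ℝ) < y := hy
    simp only [Pi.zero_apply]
    positivity
  · rw [integral_const_mul, ← logNorm]
    ring

/-! ### The full Wronskian at the scale `1/‖κ₀‖` -/

/-- The Wronskian of the Jost solution and the regular solution, up to a constant factor. -/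
noncomputable def redF (q : ℝ → ℝ) (κ : ℂ) (x : ℝ) : ℂ :=
  jostM q κ x * freeW q κ x - x * jostM₁ q κ x * (macPsi (κ * x) * regV q (-κ ^ 2) x)

theorem cpow_mul_jG {κ : ℂ} (h0 : κ ≠ 0) {x : ℝ} (hx : 0 < x) :
    κ ^ (-(1 / 2) : ℂ) * jG κ x = (Real.sqrt x : ℂ) * macPsi (κ * x) := by
  have e : κ ^ (-(1 / 2) : ℂ) = Real.sqrt x * (κ * x) ^ (-(1 / 2) : ℂ) := by
    have h1 : Real.sqrt x = Real.exp (Real.log x / 2) := by rw [Real.exp_half, Real.exp_log hx]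
    rw [Complex.cpow_def_of_ne_zero (mul_ofReal_ne_zero h0 hx), Complex.cpow_def_of_ne_zero h0,
      mul_comm κ (x : ℂ), Complex.log_ofReal_mul hx h0, h1, Complex.ofReal_exp, ← Complex.exp_add]
    congr 1
    push_cast
    ring
  rw [macPsi_eq (mul_ofReal_ne_zero h0 hx), jG, e]
  ring

theorem cpow_mul_jG₁ {κ : ℂ} (hκ : 0 ≤ κ.re) (h0 : κ ≠ 0) {x : ℝ} (hx : 0 < x) :
    κ ^ (-(1 / 2) : ℂ) * jG₁ κ x =
      (Real.sqrt x : ℂ) / x * (macPsi (κ * x) / 2 + κ * x * macPsi₁ (κ * x)) := by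
  have h1 := (hasDerivAt_jG hκ h0 hx).const_mul (κ ^ (-(1 / 2) : ℂ))
  have h2 := ((Real.hasDerivAt_sqrt hx.ne').ofReal_comp).fun_mul (hasDerivAt_macPsi_mul hκ h0 hx)
  have h3 := h2.congr_of_eventuallyEq (f₁ := fun x => κ ^ (-(1 / 2) : ℂ) * jG κ x) (by
    filter_upwards [Ioi_mem_nhds hx] with t ht
    exact cpow_mul_jG h0 ht)
  rw [h1.unique h3]
  have hs := Real.sqrt_pos.2 hx
  have hs2 := Complex.ofReal_ne_zero.2 hs.ne'
  have hx2 := Complex.ofReal_ne_zero.2 hx.ne'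
  have hsq : (Real.sqrt x : ℂ) ^ 2 = x := by
    rw [← Complex.ofReal_pow, Real.sq_sqrt hx.le]
  push_cast
  field_simp
  rw [hsq]
  ring

/-- Holds for every `x`, which allows the evaluation point to be adapted to `κ₀`. Multiplication by
`κ^{-1/2}` replaces `G` by `√x ψ(κx)`, so no fractional power of `κ` remains. -/
theorem cpow_mul_wronskianAt_eq {q : ℝ → ℝ} (hq : IsLogIntegrable q) {κ : ℂ} (hκ : 0 ≤ κ.re)
    (h0 : κ ≠ 0) {x : ℝ} (hx : 0 < x) :
    κ ^ (-(1 / 2) : ℂ) * wronskianAt (jostFn q κ) (regPhi q (-κ ^ 2)) 1 =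
      (Real.sqrt (Real.pi / 2) : ℂ) * redF q κ x := by
  rw [(isSolution_jostFn hq hκ h0).wronskianAt_eq (isSolution_regPhi hq _) one_pos hx, wronskianAt,
    (hasDerivAt_jostFn hq hκ h0 hx).deriv, (hasDerivAt_regPhi hq _ hx).deriv, jostFn, jostFn₁,
    regPhi, regPhi₁, redF, freeW]
  have hS : Real.sqrt (Real.pi * x / 2) = Real.sqrt (Real.pi / 2) * Real.sqrt x := by
    rw [← Real.sqrt_mul (by positivity)]; congr 1; ring
  have e1 := cpow_mul_jG h0 hx
  have e2 := cpow_mul_jG₁ hκ h0 hx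
  have hx2 := Complex.ofReal_ne_zero.2 hx.ne'
  have hsq : (Real.sqrt x : ℂ) ^ 2 = x := by
    rw [← Complex.ofReal_pow, Real.sq_sqrt hx.le]
  rw [hS]
  push_cast
  set s : ℂ := (Real.sqrt x : ℂ)
  set c : ℂ := (Real.sqrt (Real.pi / 2) : ℂ)
  set v := regV q (-κ ^ 2) x
  set p := regP q (-κ ^ 2) x
  set m := jostM q κ x
  set m₁ := jostM₁ q κ x
  calc _ = c * (s / x * (v / 2 + p) * m * (κ ^ (-(1 / 2) : ℂ) * jG κ x) -
        s * v * (m * (κ ^ (-(1 / 2) : ℂ) * jG₁ κ x) + m₁ * (κ ^ (-(1 / 2) : ℂ) * jG κ x))) := by ring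
    _ = c * (s ^ 2 / x) * (m * (macPsi (κ * x) * p - κ * x * macPsi₁ (κ * x) * v) -
        x * m₁ * (macPsi (κ * x) * v)) := by
      rw [e1, e2]; field_simp; ring
    _ = _ := by rw [hsq, div_self hx2, mul_one]

section

variable {q : ℝ → ℝ} {κ₀ : ℂ}

theorem differentiableWithinAt_redF (hq : IsLogIntegrable q) (h0 : κ₀ ≠ 0) (hκ : 0 ≤ κ₀.re) :
    DifferentiableWithinAt ℂ (fun κ => redF q κ (1 / ‖κ₀‖)) (halfDisc κ₀) κ₀ := by
  have ha := one_div_pos.2 (norm_pos_iff.2 h0)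
  have hs := mul_ofReal_re_nonneg hκ ha.le
  have hs0 := mul_ofReal_ne_zero h0 ha
  have hz : DifferentiableAt ℂ (fun κ : ℂ => -κ ^ 2) κ₀ := by fun_prop
  have hΨ : DifferentiableAt ℂ (fun κ : ℂ => macPsi (κ * (1 / ‖κ₀‖ : ℝ))) κ₀ :=
    (HasDerivAt.comp κ₀ (hasDerivAt_macPsi hs hs0) (hasDerivAt_mul_ofReal κ₀ _)).differentiableAt
  have hΘ : DifferentiableAt ℂ (fun κ : ℂ => κ * (1 / ‖κ₀‖ : ℝ) * macPsi₁ (κ * (1 / ‖κ₀‖ : ℝ))) κ₀ :=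
    (HasDerivAt.comp κ₀ (hasDerivAt_mul_macPsi₁ hs hs0) (hasDerivAt_mul_ofReal κ₀ _)).differentiableAt
  have hV : DifferentiableAt ℂ (fun κ : ℂ => regV q (-κ ^ 2) (1 / ‖κ₀‖)) κ₀ :=
    DifferentiableAt.comp κ₀ (g := fun z => regV q z (1 / ‖κ₀‖)) (differentiableAt_regV hq ha _) hz
  have hP : DifferentiableAt ℂ (fun κ : ℂ => regP q (-κ ^ 2) (1 / ‖κ₀‖)) κ₀ :=
    DifferentiableAt.comp κ₀ (g := fun z => regP q z (1 / ‖κ₀‖)) (differentiableAt_regP hq ha _) hz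
  exact ((differentiableWithinAt_jostM hq h0 hκ).fun_mul
    ((hΨ.fun_mul hP).fun_sub (hΘ.fun_mul hV)).differentiableWithinAt).fun_sub
    (((differentiableWithinAt_jostM₁ hq h0 hκ).const_mul _).fun_mul
      (hΨ.fun_mul hV).differentiableWithinAt)

/-- The Lipschitz constant of the Jost function, multiplied by `‖κ‖`. -/
noncomputable def lipConst (q : ℝ → ℝ) : ℝ :=
  60 * jostConst q ^ 2 * logNorm q * ((10 * (logNorm q + 9 / 4) + 5) * regConst q) +
  jostConst q * ((10 * regConst q + 50 * regConst q ^ 2) * logNorm q) +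
  (32 * jostConst q + 240 * jostConst q ^ 2 * logNorm q) * logNorm q * (10 * regConst q) +
  4 * logNorm q * jostConst q * (10 * regConst q + 50 * regConst q ^ 2)

theorem norm_redF_sub_le (hq : IsLogIntegrable q) (h0 : κ₀ ≠ 0) (hκ : 0 ≤ κ₀.re) {κ : ℂ}
    (h : κ ∈ halfDisc κ₀) :
    ‖redF q κ (1 / ‖κ₀‖) - redF q κ₀ (1 / ‖κ₀‖)‖ ≤ lipConst q / ‖κ₀‖ * ‖κ - κ₀‖ := by
  have hn := norm_pos_iff.2 h0
  have ha := one_div_pos.2 hn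
  have hs := mem_halfDisc_self hκ
  have b1 := norm_jostM_sub_le hq h0 hs h
  have b2 := norm_freeW_le hq h0 h
  have b3 := norm_jostM_le hq h0 hs
  have b4 := norm_freeW_sub_le hq h0 hκ h
  have b5 := norm_jostM₁_sub_le hq h0 hs h
  have b6 := norm_jostM₁_le hq h0 hs
  have b7 := norm_macPsi_mul_regV_sub_le hq h0 hκ h ha le_rfl
  have b8 : ‖macPsi (κ * (1 / ‖κ₀‖ : ℝ)) * regV q (-κ ^ 2) (1 / ‖κ₀‖)‖ ≤
      10 * (regConst q * logWeight (1 / ‖κ₀‖)) := by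
    rw [norm_mul]
    exact mul_le_mul (norm_macPsi_le_ten h0 h) (norm_regV_le_regConst hq h0 h ha le_rfl)
      (norm_nonneg _) (by norm_num)
  have hε := qTail_nonneg q ha.le
  have hw := logWeight_pos (1 / ‖κ₀‖)
  have hεw := qTail_mul_logWeight_le hq ha.le
  have hL := logNorm_nonneg q
  have hM := jostConst_pos q
  have hC := regConst_pos q
  have hax : ‖((1 / ‖κ₀‖ : ℝ) : ℂ)‖ = 1 / ‖κ₀‖ := by
    rw [Complex.norm_real, Real.norm_eq_abs, abs_of_pos ha]
  have hinv : 1 / ‖κ₀‖ * ‖κ₀‖ = 1 := one_div_mul_cancel hn.ne'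
  rw [redF, redF]
  rw [div_eq_mul_one_div (lipConst q)]
  rw [div_eq_mul_one_div (qTail q _)] at b1
  rw [div_eq_mul_one_div (10 * regConst q + 50 * regConst q ^ 2)] at b4 b7
  set a := 1 / ‖κ₀‖
  set δ := ‖κ - κ₀‖
  have hδ : 0 ≤ δ := norm_nonneg _
  generalize macPsi (κ * a) * regV q (-κ ^ 2) a = U at *
  generalize macPsi (κ₀ * a) * regV q (-κ₀ ^ 2) a = U₀ at *
  generalize freeW q κ a = W at *
  generalize freeW q κ₀ a = W₀ at *
  generalize jostM q κ a = m at *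
  generalize jostM q κ₀ a = m₀ at *
  generalize jostM₁ q κ a = n at *
  generalize jostM₁ q κ₀ a = n₀ at *
  generalize qTail q a = ε at *
  generalize logWeight a = w at *
  -- Telescoping the two products. In all but the second term a tail `ε` meets a weight `w`, and `ε
  -- w ≤ logNorm q`; the second needs no tail because `W - W₀` carries no weight.
  have e : m * W - a * n * U - (m₀ * W₀ - a * n₀ * U₀) = (m - m₀) * W + m₀ * (W - W₀) -
      a * (n - n₀) * U - a * n₀ * (U - U₀) := by ring
  rw [e]
  have t1 : ‖(m - m₀) * W‖ ≤
      60 * jostConst q ^ 2 * logNorm q * ((10 * (logNorm q + 9 / 4) + 5) * regConst q) * a * δ := by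
    rw [norm_mul]
    calc _ ≤ (60 * jostConst q ^ 2 * (ε * a) * δ) *
          ((10 * (logNorm q + 9 / 4) + 5) * regConst q * w) := by gcongr
      _ = 60 * jostConst q ^ 2 * (ε * w) * ((10 * (logNorm q + 9 / 4) + 5) * regConst q) * a * δ := by
        ring
      _ ≤ _ := by gcongr
  have t2 : ‖m₀ * (W - W₀)‖ ≤
      jostConst q * ((10 * regConst q + 50 * regConst q ^ 2) * logNorm q) * a * δ := by
    rw [norm_mul]
    calc _ ≤ jostConst q * ((10 * regConst q + 50 * regConst q ^ 2) * a * logNorm q * δ) := by gcongr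
      _ = _ := by ring
  have t3 : ‖a * (n - n₀) * U‖ ≤
      (32 * jostConst q + 240 * jostConst q ^ 2 * logNorm q) * logNorm q * (10 * regConst q) * a * δ := by
    rw [norm_mul, norm_mul, hax]
    calc _ ≤ a * ((32 * jostConst q + 240 * jostConst q ^ 2 * logNorm q) * ε * δ) *
          (10 * (regConst q * w)) := by gcongr
      _ = (32 * jostConst q + 240 * jostConst q ^ 2 * logNorm q) * (ε * w) * (10 * regConst q) * a * δ := by
        ring
      _ ≤ _ := by gcongr
  have t4 : ‖a * n₀ * (U - U₀)‖ ≤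
      4 * logNorm q * jostConst q * (10 * regConst q + 50 * regConst q ^ 2) * a * δ := by
    rw [norm_mul, norm_mul, hax]
    calc _ ≤ a * (4 * ‖κ₀‖ * ε * jostConst q) *
          ((10 * regConst q + 50 * regConst q ^ 2) * a * w * δ) := by gcongr
      _ = (a * ‖κ₀‖) * (4 * (ε * w) * jostConst q * (10 * regConst q + 50 * regConst q ^ 2) * a * δ) := by
        ring
      _ ≤ _ := by rw [hinv, one_mul]; gcongr
  have n1 := norm_sub_le ((m - m₀) * W + m₀ * (W - W₀) - a * (n - n₀) * U) (a * n₀ * (U - U₀))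
  have n2 := norm_sub_le ((m - m₀) * W + m₀ * (W - W₀)) (a * (n - n₀) * U)
  have n3 := norm_add_le ((m - m₀) * W) (m₀ * (W - W₀))
  rw [lipConst]
  linarith

end

/-- The Jost function in terms of `κ = -i k`. -/
noncomputable def jostKappa (q : ℝ → ℝ) (κ : ℂ) : ℂ :=
  κ ^ (-(1 / 2) : ℂ) * wronskianAt (jostFn q κ) (regPhi q (-κ ^ 2)) 1

theorem halfDisc_mem_nhdsWithin {κ₀ : ℂ} (h0 : κ₀ ≠ 0) :
    halfDisc κ₀ ∈ 𝓝[{κ | 0 ≤ κ.re}] κ₀ := by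
  have : Metric.closedBall κ₀ (‖κ₀‖ / 2) ∈ 𝓝 κ₀ :=
    Metric.closedBall_mem_nhds _ (half_pos (norm_pos_iff.2 h0))
  filter_upwards [self_mem_nhdsWithin, mem_nhdsWithin_of_mem_nhds this] with κ h1 h2
  exact ⟨h1, by simpa [dist_eq_norm] using h2⟩

theorem differentiableWithinAt_jostKappa {q : ℝ → ℝ} (hq : IsLogIntegrable q) {κ₀ : ℂ} (h0 : κ₀ ≠ 0)
    (hκ : 0 ≤ κ₀.re) : DifferentiableWithinAt ℂ (jostKappa q) {κ | 0 ≤ κ.re} κ₀ := by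
  have ha := one_div_pos.2 (norm_pos_iff.2 h0)
  have h1 := (differentiableWithinAt_redF hq h0 hκ).const_mul (Real.sqrt (Real.pi / 2) : ℂ)
  have h2 : DifferentiableWithinAt ℂ (jostKappa q) (halfDisc κ₀) κ₀ :=
    h1.congr (fun κ h => cpow_mul_wronskianAt_eq hq h.1 (ne_zero_of_mem_halfDisc h0 h) ha)
      (cpow_mul_wronskianAt_eq hq hκ h0 ha)
  exact h2.mono_of_mem_nhdsWithin (halfDisc_mem_nhdsWithin h0)

theorem norm_jostKappa_sub_le {q : ℝ → ℝ} (hq : IsLogIntegrable q) {κ₀ : ℂ} (h0 : κ₀ ≠ 0)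
    (hκ : 0 ≤ κ₀.re) : ∀ᶠ κ in 𝓝[{κ | 0 ≤ κ.re}] κ₀, ‖jostKappa q κ - jostKappa q κ₀‖ ≤
      Real.sqrt (Real.pi / 2) * lipConst q / ‖κ₀‖ * ‖κ - κ₀‖ := by
  have ha := one_div_pos.2 (norm_pos_iff.2 h0)
  filter_upwards [halfDisc_mem_nhdsWithin h0] with κ h
  rw [jostKappa, jostKappa, cpow_mul_wronskianAt_eq hq h.1 (ne_zero_of_mem_halfDisc h0 h) ha,
    cpow_mul_wronskianAt_eq hq hκ h0 ha, ← mul_sub, norm_mul, Complex.norm_real, Real.norm_eq_abs,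
    abs_of_nonneg (Real.sqrt_nonneg _), mul_div_assoc, mul_assoc]
  exact mul_le_mul_of_nonneg_left (norm_redF_sub_le hq h0 hκ h) (Real.sqrt_nonneg _)

/-- On `(0, 1]` the weights coincide, and for `x > 1` one has `1 + log x ≤ ((log 2)⁻¹ + 1) log (1 +
x)`. -/
theorem IsLogIntegrable.of_locallyIntegrableOn {q : ℝ → ℝ}
    (hq_loc : LocallyIntegrableOn q (Ioi (0 : ℝ)))
    (hq_zero : IntegrableOn (fun x : ℝ => x * (1 - Real.log x) * |q x|) (Ioc 0 1))
    (hq_infty : IntegrableOn (fun x : ℝ => x * Real.log (1 + x) * |q x|) (Ioi 1)) :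
    IsLogIntegrable q := by
  have hm := hq_loc.aestronglyMeasurable
  refine ⟨hm, ?_⟩
  rw [← Ioc_union_Ioi_eq_Ioi (zero_le_one (α := ℝ))]
  refine IntegrableOn.union (hq_zero.congr_fun (fun x hx => ?_) measurableSet_Ioc) ?_
  · simp only
    rw [abs_of_nonpos (Real.log_nonpos hx.1.le hx.2), sub_eq_add_neg]
  · have h2 : 0 < Real.log 2 := Real.log_pos (by norm_num)
    refine (hq_infty.const_mul ((Real.log 2)⁻¹ + 1)).mono' ?_
      ((ae_restrict_iff' measurableSet_Ioi).2 (.of_forall fun x hx => ?_))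
    · have hlog : Measurable fun x : ℝ => x * (1 + |Real.log x|) :=
        measurable_id.mul (measurable_const.add (Real.measurable_log.norm))
      exact hlog.aestronglyMeasurable.mul
        (hm.mono_measure (Measure.restrict_mono (Ioi_subset_Ioi zero_le_one) le_rfl)).norm
    · have hx1 : (1 : ℝ) < x := hx
      have hx0 : 0 < x := one_pos.trans hx1
      have h3 : Real.log 2 ≤ Real.log (1 + x) := Real.log_le_log two_pos (by linarith)
      have h4 : Real.log x ≤ Real.log (1 + x) := Real.log_le_log hx0 (by linarith)
      have h5 : 1 ≤ (Real.log 2)⁻¹ * Real.log (1 + x) := by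
        rw [inv_mul_eq_div, one_le_div h2]; exact h3
      rw [Real.norm_eq_abs, abs_of_nonneg (Real.log_nonneg hx1.le), abs_of_nonneg (by
        have := Real.log_nonneg hx1.le
        positivity)]
      calc x * (1 + Real.log x) * |q x| ≤ x * (((Real.log 2)⁻¹ + 1) * Real.log (1 + x)) * |q x| := by
            gcongr
            linarith
        _ = _ := by ring

/-! ### Independence of the chosen solutions -/

/-- If `W(u, w) = 0`, then `W(u, s) = (u/w) W(w, s)` wherever `w ≠ 0`; the last factor is constant
and the quotient tends to `0`. This avoids any appeal to uniqueness for the initial value problem.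
-/
theorem wronskianAt_eq_zero_of_tendsto {q : ℝ → ℝ} {z : ℂ} {u w s : ℝ → ℂ} (hu : IsSolution q z u)
    (hw : IsSolution q z w) (hs : IsSolution q z s) (huw : ∀ x, 0 < x → wronskianAt u w x = 0)
    {l : Filter ℝ} [l.NeBot] (hl : ∀ᶠ x in l, 0 < x ∧ w x ≠ 0)
    (ht : Tendsto (fun x => u x / w x) l (𝓝 0)) {y : ℝ} (hy : 0 < y) : wronskianAt u s y = 0 := by
  have h : Tendsto (fun x => u x / w x * wronskianAt w s y) l (𝓝 0) := by
    simpa using ht.mul_const (wronskianAt w s y)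
  refine tendsto_nhds_unique (tendsto_const_nhds.congr' ?_) h
  filter_upwards [hl] with x hx
  rw [hu.wronskianAt_eq hs hy hx.1, hw.wronskianAt_eq hs hy hx.1]
  have h1 := huw x hx.1
  have hw0 := hx.2
  rw [wronskianAt] at h1 ⊢
  rw [wronskianAt]
  field_simp
  linear_combination s x * h1

theorem wronskianAt_sub_left {q : ℝ → ℝ} {z : ℂ} {u v s : ℝ → ℂ} (hu : IsSolution q z u)
    (hv : IsSolution q z v) {x : ℝ} (hx : 0 < x) :
    wronskianAt (fun x => u x - v x) s x = wronskianAt u s x - wronskianAt v s x := by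
  rw [wronskianAt, deriv_fun_sub (hu.differentiableAt x hx) (hv.differentiableAt x hx), wronskianAt,
    wronskianAt]
  ring

theorem wronskianAt_swap (u v : ℝ → ℂ) (x : ℝ) : wronskianAt u v x = -wronskianAt v u x := by
  rw [wronskianAt, wronskianAt]; ring

/-- A nonzero limit of `x ε'(x)` would force logarithmic divergence: `ε(x) - ε(x/2)` tends to `L log
2`, but also to `0`. -/
theorem eq_zero_of_tendsto_mul_deriv {ε ε' : ℝ → ℂ} {c L : ℂ} {b : ℝ} (hb : 0 < b)
    (hd : ∀ x ∈ Ioo 0 b, HasDerivAt ε (ε' x) x)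
    (hε : Tendsto ε (𝓝[>] 0) (𝓝 c)) (hε' : Tendsto (fun x : ℝ => x * ε' x) (𝓝[>] 0) (𝓝 L)) : L = 0 := by
  have hhalf : Tendsto (fun x : ℝ => x / 2) (𝓝[>] 0) (𝓝[>] 0) := by
    refine tendsto_nhdsWithin_iff.2 ⟨?_, ?_⟩
    · have : Continuous fun x : ℝ => x / 2 := by fun_prop
      simpa using (this.tendsto 0).mono_left (nhdsWithin_le_nhds (s := Ioi 0))
    · filter_upwards [self_mem_nhdsWithin] with x hx
      exact half_pos (mem_Ioi.1 hx)
  have h1 : Tendsto (fun x : ℝ => ε x - ε (x / 2) - L * Real.log 2) (𝓝[>] 0) (𝓝 (-(L * Real.log 2))) := by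
    have := (hε.sub (hε.comp hhalf)).sub_const (L * (Real.log 2 : ℂ))
    simpa using this
  have h2 : Tendsto (fun x : ℝ => ε x - ε (x / 2) - L * Real.log 2) (𝓝[>] 0) (𝓝 0) := by
    rw [Metric.tendsto_nhds]
    intro η hη
    have h3 := (Metric.tendsto_nhds.1 hε') (η / 2) (half_pos hη)
    obtain ⟨r, hr, hrs⟩ := mem_nhdsGT_iff_exists_Ioo_subset.1 h3
    have hr0 : (0 : ℝ) < r := hr
    filter_upwards [Ioo_mem_nhdsGT (lt_min hr0 hb)] with x hx
    have hx0 := hx.1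
    have hmem : ∀ t ∈ Icc (x / 2) x, 0 < t ∧ t < r ∧ t < b := fun t ht =>
      ⟨(half_pos hx0).trans_le ht.1, ht.2.trans_lt (hx.2.trans_le (min_le_left _ _)),
        ht.2.trans_lt (hx.2.trans_le (min_le_right _ _))⟩
    -- On `[x/2, x]` the derivative of `ε - L log` is at most `(η/2)/(x/2)`, and the interval has
    -- length `x/2`.
    have h4 := (convex_Icc (x / 2) x).norm_image_sub_le_of_norm_hasDerivWithin_le
      (f := fun t : ℝ => ε t - L * (Real.log t : ℂ)) (f' := fun t : ℝ => ε' t - L * ((t⁻¹ : ℝ) : ℂ))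
      (C := η / 2 / (x / 2)) (fun t ht => by
        obtain ⟨h5, h6, h7⟩ := hmem t ht
        exact ((hd t ⟨h5, h7⟩).fun_sub
          ((Real.hasDerivAt_log h5.ne').ofReal_comp.const_mul L)).hasDerivWithinAt)
      (fun t ht => by
        obtain ⟨h5, h6, h7⟩ := hmem t ht
        have h8 : dist (t * ε' t) L < η / 2 := hrs ⟨h5, h6⟩
        rw [dist_eq_norm] at h8
        have e : ε' t - L * ((t⁻¹ : ℝ) : ℂ) = (t * ε' t - L) / t := by
          have := Complex.ofReal_ne_zero.2 h5.ne'
          push_cast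
          field_simp
        rw [e, norm_div, Complex.norm_real, Real.norm_eq_abs, abs_of_pos h5]
        exact div_le_div₀ (half_pos hη).le h8.le (half_pos hx0) ht.1)
      (left_mem_Icc.2 (by linarith)) (right_mem_Icc.2 (by linarith))
    have e : ε x - L * (Real.log x : ℂ) - (ε (x / 2) - L * (Real.log (x / 2) : ℂ)) =
        ε x - ε (x / 2) - L * Real.log 2 := by
      rw [Real.log_div hx0.ne' two_ne_zero]
      push_cast
      ring
    rw [e, Real.norm_eq_abs, abs_of_nonneg (by linarith)] at h4
    rw [dist_zero_right]
    have e2 : η / 2 / (x / 2) * (x - x / 2) = η / 2 := by field_simp; ring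
    rw [e2] at h4
    linarith
  have h3 := tendsto_nhds_unique h1 h2
  have h4 : (Real.log 2 : ℂ) ≠ 0 := Complex.ofReal_ne_zero.2 (Real.log_pos (by norm_num)).ne'
  rw [neg_eq_zero] at h3
  exact (mul_eq_zero.1 h3).resolve_right h4

theorem tendsto_regP {q : ℝ → ℝ} (hq : IsLogIntegrable q) (z : ℂ) :
    Tendsto (regP q z) (𝓝[>] 0) (𝓝 0) :=
  squeeze_zero_norm (fun x => le_mul_of_one_le_left (norm_nonneg _)
    (by linarith [abs_nonneg (Real.log x)])) (tendsto_one_add_abs_log_mul_norm_regP hq z)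

theorem tendsto_regV {q : ℝ → ℝ} (hq : IsLogIntegrable q) (z : ℂ) :
    Tendsto (regV q z) (𝓝[>] 0) (𝓝 1) := by
  have := ((continuous_regV hq z).tendsto 0).mono_left (nhdsWithin_le_nhds (s := Ioi 0))
  rwa [regV_of_nonpos hq z le_rfl] at this

/-- Write the difference as `√(πx/2) ε` with `ε → 0`. Constancy of its Wronskian with `regPhi`
forces `x ε'` to converge to a multiple of that constant, hence the constant is zero. -/
theorem IsRegularSolution.wronskianAt_sub_eq_zero {q : ℝ → ℝ} (hq : IsLogIntegrable q) {z : ℂ}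
    {u s : ℝ → ℂ} (hu : IsRegularSolution q z u) (hs : IsSolution q z s) {y : ℝ} (hy : 0 < y) :
    wronskianAt (fun x => u x - regPhi q z x) s y = 0 := by
  obtain ⟨v, hv, hv0, huv⟩ := hu.regular
  have he : IsSolution q z fun x => u x - regPhi q z x := hu.isSolution.sub (isSolution_regPhi hq z)
  set e : ℝ → ℂ := fun x => u x - regPhi q z x with hed
  set ε : ℝ → ℂ := fun x => e x / (Real.sqrt (Real.pi * x / 2) : ℂ) with hεd
  have hS : ∀ x, 0 < x → 0 < Real.sqrt (Real.pi * x / 2) := fun x hx =>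
    Real.sqrt_pos.2 (by have := Real.pi_pos; positivity)
  have hSc : ∀ x, 0 < x → (Real.sqrt (Real.pi * x / 2) : ℂ) ≠ 0 := fun x hx =>
    Complex.ofReal_ne_zero.2 (hS x hx).ne'
  have hεv : ∀ x, 0 < x → x ≤ 1 → ε x = v x - regV q z x := fun x hx hx1 => by
    have := hSc x hx
    simp only [hεd, hed]
    rw [huv x hx hx1, regPhi, ← mul_sub, mul_div_cancel_left₀ _ this]
  have hε0 : Tendsto ε (𝓝[>] 0) (𝓝 0) := by
    have hc : Tendsto v (𝓝[>] 0) (𝓝 1) := by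
      have h1 := hv.continuousOn
      rw [uIcc_of_le zero_le_one] at h1
      have h2 := (h1 0 ⟨le_rfl, zero_le_one⟩).mono_left
        (nhdsWithin_le_of_mem (Icc_mem_nhdsGT (one_pos (α := ℝ))))
      rwa [hv0] at h2
    have h3 := hc.sub (tendsto_regV hq z)
    rw [sub_self] at h3
    refine h3.congr' ?_
    filter_upwards [Ioo_mem_nhdsGT (one_pos (α := ℝ))] with x hx
    rw [hεv x hx.1 hx.2.le]
  set ε' : ℝ → ℂ := fun x => deriv e x / (Real.sqrt (Real.pi * x / 2) : ℂ) - ε x / (2 * x) with hε'd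
  have hεd' : ∀ x, 0 < x → HasDerivAt ε (ε' x) x := fun x hx => by
    have h1 := (he.differentiableAt x hx).hasDerivAt.fun_div
      (hasDerivAt_sqrt_pi_mul hx).ofReal_comp (hSc x hx)
    refine h1.congr_deriv ?_
    have := hSc x hx
    have := Complex.ofReal_ne_zero.2 hx.ne'
    simp only [hε'd, hεd]
    push_cast
    field_simp
  set c := wronskianAt e (regPhi q z) 1 with hcd
  have hW : ∀ x, 0 < x → ε x * regP q z x - (x * ε' x) * regV q z x = 2 / Real.pi * c := fun x hx => by
    have hx0 := Complex.ofReal_ne_zero.2 hx.ne'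
    have hpi := Complex.ofReal_ne_zero.2 Real.pi_ne_zero
    have hs0 := hSc x hx
    have hsq : (Real.sqrt (Real.pi * x / 2) : ℂ) ^ 2 = Real.pi * x / 2 := by
      rw [← Complex.ofReal_pow, Real.sq_sqrt (by have := Real.pi_pos; positivity)]
      push_cast
      ring
    rw [hcd, he.wronskianAt_eq (isSolution_regPhi hq z) one_pos hx, wronskianAt,
      (hasDerivAt_regPhi hq z hx).deriv, regPhi₁, regPhi]
    have e1 : e x = Real.sqrt (Real.pi * x / 2) * ε x := by
      simp only [hεd]; field_simp
    have e2 : deriv e x = Real.sqrt (Real.pi * x / 2) * (ε' x + ε x / (2 * x)) := by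
      simp only [hε'd]; field_simp; ring
    rw [e1, e2]
    push_cast
    calc _ = 2 / Real.pi * ((Real.pi * x / 2) / x) *
        (ε x * regP q z x - (x * ε' x) * regV q z x) := by field_simp
      _ = _ := by rw [← hsq]; field_simp; ring
  have hv1 := tendsto_regV hq z
  have hvne : ∀ᶠ x in 𝓝[>] (0 : ℝ), regV q z x ≠ 0 := hv1.eventually_ne one_ne_zero
  have hlim : Tendsto (fun x : ℝ => x * ε' x) (𝓝[>] 0) (𝓝 (-(2 / Real.pi * c))) := by
    have h1 := ((hε0.mul (tendsto_regP hq z)).sub_const (2 / Real.pi * c)).div hv1 one_ne_zero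
    simp only [mul_zero, zero_sub, div_one] at h1
    refine h1.congr' ?_
    filter_upwards [hvne, self_mem_nhdsWithin] with x hx hx0
    have := hW x hx0
    rw [Pi.div_apply, div_eq_iff hx]
    linear_combination this
  have hc0 : c = 0 := by
    have h1 := eq_zero_of_tendsto_mul_deriv one_pos (fun x hx => hεd' x hx.1) hε0 hlim
    have hpi := Complex.ofReal_ne_zero.2 Real.pi_ne_zero
    rw [neg_eq_zero] at h1
    exact (mul_eq_zero.1 h1).resolve_left (div_ne_zero two_ne_zero hpi)
  refine wronskianAt_eq_zero_of_tendsto he (isSolution_regPhi hq z) hs (fun x hx => ?_) (l := 𝓝[>] 0) ?_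
    ?_ hy
  · rw [he.wronskianAt_eq (isSolution_regPhi hq z) hx one_pos]; exact hc0
  · filter_upwards [hvne, self_mem_nhdsWithin] with x hx hx0
    exact ⟨hx0, mul_ne_zero (hSc x hx0) hx⟩
  · have h1 := hε0.div hv1 one_ne_zero
    rw [zero_div] at h1
    refine h1.congr' ?_
    filter_upwards [self_mem_nhdsWithin] with x hx0
    rw [Pi.div_apply, regPhi, hεd, div_div]

theorem norm_exp_I_mul_le_one {k : ℂ} (hk : 0 ≤ k.im) {x : ℝ} (hx : 0 ≤ x) :
    ‖Complex.exp (Complex.I * k * x)‖ ≤ 1 := by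
  rw [Complex.norm_exp, Real.exp_le_one_iff]
  simp
  exact mul_nonneg hk hx

/-- The Wronskian of the difference with `w` is `e^{2ikx} o(1)`, and the exponential is bounded by
`1` for `Im k ≥ 0`. Being constant, it is zero. -/
theorem IsJostSolution.wronskianAt_sub_eq_zero {q : ℝ → ℝ} {k : ℂ} (hk : 0 ≤ k.im) {u w s : ℝ → ℂ}
    (hu : IsJostSolution q k u) (hw : IsJostSolution q k w) (hs : IsSolution q (k ^ 2) s) {y : ℝ}
    (hy : 0 < y) : wronskianAt (fun x => u x - w x) s y = 0 := by
  have hd : IsSolution q (k ^ 2) fun x => u x - w x := hu.isSolution.sub hw.isSolution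
  set E : ℝ → ℂ := fun x => Complex.exp (Complex.I * k * x) with hE
  have hE0 : ∀ x, E x ≠ 0 := fun x => Complex.exp_ne_zero _
  -- For `k = 0` the quotient in `tendsto_deriv` is `0` by the convention for division by zero, so
  -- it cannot tend to `1`.
  by_cases hk0 : k = 0
  · exfalso
    have h := hu.tendsto_deriv
    simp only [hk0, mul_zero, zero_mul, div_zero] at h
    exact zero_ne_one (tendsto_nhds_unique tendsto_const_nhds h)
  have hik : Complex.I * k ≠ 0 := mul_ne_zero Complex.I_ne_zero hk0
  have t1 : Tendsto (fun x => (u x - w x) / E x) atTop (𝓝 0) := by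
    have := hu.tendsto.sub hw.tendsto
    rw [sub_self] at this
    exact this.congr fun x => (sub_div _ _ _).symm
  have t2 : Tendsto (fun x => deriv (fun x => u x - w x) x / E x) atTop (𝓝 0) := by
    have := (hu.tendsto_deriv.sub hw.tendsto_deriv).const_mul (Complex.I * k)
    rw [sub_self, mul_zero] at this
    refine this.congr' ?_
    filter_upwards [eventually_gt_atTop 0] with x hx
    rw [deriv_fun_sub (hu.isSolution.differentiableAt x hx) (hw.isSolution.differentiableAt x hx)]
    have := hE0 x
    simp only [hE] at this ⊢
    field_simp
  have t3 : Tendsto (fun x => deriv w x / E x) atTop (𝓝 (Complex.I * k)) := by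
    have := hw.tendsto_deriv.const_mul (Complex.I * k)
    rw [mul_one] at this
    refine this.congr fun x => ?_
    have := hE0 x
    simp only [hE] at this ⊢
    field_simp
  have tE : ∀ g : ℝ → ℂ, Tendsto g atTop (𝓝 0) → Tendsto (fun x => E x ^ 2 * g x) atTop (𝓝 0) := by
    intro g hg
    refine squeeze_zero_norm' ?_ (tendsto_zero_iff_norm_tendsto_zero.1 hg)
    filter_upwards [eventually_ge_atTop 0] with x hx
    rw [norm_mul, norm_pow]
    exact mul_le_of_le_one_left (norm_nonneg _)
      (pow_le_one₀ (norm_nonneg _) (norm_exp_I_mul_le_one hk hx))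
  have hW : Tendsto (fun x => wronskianAt (fun x => u x - w x) w x) atTop (𝓝 0) := by
    have h1 := (t1.mul t3).sub (t2.mul hw.tendsto)
    rw [zero_mul, zero_mul, sub_zero] at h1
    refine (tE _ h1).congr fun x => ?_
    have := hE0 x
    rw [wronskianAt]
    simp only [hE] at this ⊢
    field_simp
  refine wronskianAt_eq_zero_of_tendsto hd hw.isSolution hs (fun x hx => ?_) (l := atTop) ?_ ?_ hy
  · refine tendsto_nhds_unique (tendsto_const_nhds.congr' ?_) hW
    filter_upwards [eventually_gt_atTop 0] with t ht
    exact hd.wronskianAt_eq hw.isSolution hx ht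
  · filter_upwards [eventually_gt_atTop 0, hw.tendsto.eventually_ne one_ne_zero] with x hx h1
    exact ⟨hx, fun h => h1 (by rw [h, zero_div])⟩
  · have h1 := t1.div hw.tendsto one_ne_zero
    rw [zero_div] at h1
    refine h1.congr fun x => ?_
    rw [Pi.div_apply]
    exact div_div_div_cancel_right₀ (hE0 x) _ _

/-! ### Return to the variable `k` and conclusion -/

theorem isRegularSolution_regularSolution {q : ℝ → ℝ} (hq : IsLogIntegrable q) (z : ℂ) :
    IsRegularSolution q z (regularSolution q z) := by
  have h : ∃ u, IsRegularSolution q z u := ⟨_, isRegularSolution_regPhi hq z⟩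
  rw [regularSolution, dif_pos h]
  exact h.choose_spec

theorem isJostSolution_jostSolution {q : ℝ → ℝ} (hq : IsLogIntegrable q) {k : ℂ} (hk : 0 ≤ k.im)
    (hk0 : k ≠ 0) : IsJostSolution q k (jostSolution q k) := by
  have h : ∃ u, IsJostSolution q k u := ⟨_, isJostSolution_jostFn hq hk hk0⟩
  rw [jostSolution, dif_pos h]
  exact h.choose_spec

theorem neg_I_mul_re (k : ℂ) : (-(Complex.I * k)).re = k.im := by simp

theorem neg_I_mul_sq (k : ℂ) : -(-(Complex.I * k)) ^ 2 = k ^ 2 := by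
  rw [neg_sq, mul_pow, Complex.I_sq]; ring

theorem jostFunction_eq {q : ℝ → ℝ} (hq : IsLogIntegrable q) {k : ℂ} (hk : 0 ≤ k.im) (hk0 : k ≠ 0) :
    jostFunction q k = wronskianAt (jostFn q (-(Complex.I * k))) (regPhi q (k ^ 2)) 1 := by
  have hJ := isJostSolution_jostSolution hq hk hk0
  have hf := isJostSolution_jostFn hq hk hk0
  have hR := isRegularSolution_regularSolution hq (k ^ 2)
  have hφ := isSolution_regPhi hq (k ^ 2)
  have h1 := hJ.wronskianAt_sub_eq_zero hk hf hφ one_pos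
  have h2 := hR.wronskianAt_sub_eq_zero hq hJ.isSolution one_pos
  rw [wronskianAt_sub_left hJ.isSolution hf.isSolution one_pos] at h1
  rw [wronskianAt_sub_left hR.isSolution hφ one_pos, wronskianAt_swap,
    wronskianAt_swap (regPhi _ _)] at h2
  rw [jostFunction]
  linear_combination h1 - h2

/-- Since `arg (-i) = -π/2` and `arg k ∈ [0, π]`, the arguments add without crossing the cut; this
produces the factor `e^{iπ/4}`. -/
theorem neg_I_mul_cpow {k : ℂ} (hk : 0 ≤ k.im) (hk0 : k ≠ 0) :
    (-(Complex.I * k)) ^ (-(1 / 2) : ℂ) =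
      Complex.exp (Complex.I * (Real.pi / 4)) * k ^ (-(1 / 2) : ℂ) := by
  have hI : -Complex.I ≠ 0 := neg_ne_zero.2 Complex.I_ne_zero
  have h0 : -Complex.I * k ≠ 0 := mul_ne_zero hI hk0
  have harg : Complex.arg (-Complex.I) + Complex.arg k ∈ Ioc (-Real.pi) Real.pi := by
    rw [Complex.arg_neg_I]
    have h1 := Complex.arg_nonneg_iff.2 hk
    have h2 := Complex.arg_le_pi k
    have := Real.pi_pos
    constructor <;> linarith
  rw [← neg_mul, Complex.cpow_def_of_ne_zero h0, Complex.cpow_def_of_ne_zero hk0,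
    (Complex.log_mul_eq_add_log_iff hI hk0).2 harg, Complex.log_neg_I, ← Complex.exp_add]
  congr 1
  ring

theorem jostF_eq {q : ℝ → ℝ} (hq : IsLogIntegrable q) {k : ℂ} (hk : 0 ≤ k.im) (hk0 : k ≠ 0) :
    jostF q k = jostKappa q (-(Complex.I * k)) := by
  rw [jostF, jostKappa, neg_I_mul_sq, neg_I_mul_cpow hk hk0, jostFunction_eq hq hk hk0]

theorem norm_derivWithin_le_of_eventually {f : ℂ → ℂ} {k : ℂ} (hk : 0 ≤ k.im) {C : ℝ}
    (hd : DifferentiableWithinAt ℂ f {w | 0 ≤ w.im} k)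
    (hl : ∀ᶠ w in 𝓝[{w | 0 ≤ w.im}] k, ‖f w - f k‖ ≤ C * ‖w - k‖) :
    ‖derivWithin f {w | 0 ≤ w.im} k‖ ≤ C := by
  have hs := hasDerivWithinAt_iff_tendsto_slope.1 hd.hasDerivWithinAt
  -- Approach along `k + it`, which stays in the half-plane even for real `k`, shows that `k` is an
  -- accumulation point, so the bound on slopes passes to the derivative.
  have hp : Tendsto (fun t : ℝ => k + t * Complex.I) (𝓝[>] 0) (𝓝[{w | 0 ≤ w.im} \ {k}] k) := by
    refine tendsto_nhdsWithin_iff.2 ⟨?_, ?_⟩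
    · have : Continuous fun t : ℝ => k + t * Complex.I := by fun_prop
      simpa using (this.tendsto 0).mono_left (nhdsWithin_le_nhds (s := Ioi 0))
    · filter_upwards [self_mem_nhdsWithin] with t ht
      have ht0 : (0 : ℝ) < t := ht
      refine ⟨?_, ?_⟩
      · simp; linarith
      · simp [ht0.ne']
  have hl' : ∀ᶠ w in 𝓝[{w | 0 ≤ w.im} \ {k}] k, ‖slope f k w‖ ≤ C := by
    filter_upwards [hl.filter_mono (nhdsWithin_mono k sdiff_subset), self_mem_nhdsWithin] with w hw hwk
    have h0 : 0 < ‖w - k‖ := norm_pos_iff.2 (sub_ne_zero.2 hwk.2)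
    rw [slope_def_field, norm_div, div_le_iff₀ h0]
    exact hw
  have : (𝓝[{w : ℂ | 0 ≤ w.im} \ {k}] k).NeBot := hp.neBot
  exact le_of_tendsto hs.norm hl'

theorem lemma2p18 (q : ℝ → ℝ)
    (hq_loc : LocallyIntegrableOn q (Ioi (0 : ℝ)))
    (hq_zero : IntegrableOn (fun x : ℝ => x * (1 - Real.log x) * |q x|) (Ioc 0 1))
    (hq_infty : IntegrableOn (fun x : ℝ => x * Real.log (1 + x) * |q x|) (Ioi 1)) :
    (∀ z : ℂ, IsRegularSolution q z (regularSolution q z)) ∧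
    (∀ k : ℂ, 0 ≤ k.im → k ≠ 0 → IsJostSolution q k (jostSolution q k)) ∧
    ∃ C : ℝ, ∀ k : ℂ, 0 ≤ k.im → k ≠ 0 →
      DifferentiableWithinAt ℂ (jostF q) {w : ℂ | 0 ≤ w.im} k ∧
      ‖derivWithin (jostF q) {w : ℂ | 0 ≤ w.im} k‖ ≤ C / ‖k‖ := by
  have hq := IsLogIntegrable.of_locallyIntegrableOn hq_loc hq_zero hq_infty
  refine ⟨isRegularSolution_regularSolution hq, fun k hk hk0 => isJostSolution_jostSolution hq hk hk0,
    Real.sqrt (Real.pi / 2) * lipConst q, fun k hk hk0 => ?_⟩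
  set ι : ℂ → ℂ := fun w => -(Complex.I * w) with hι
  have hκ : 0 ≤ (ι k).re := by rw [hι, neg_I_mul_re]; exact hk
  have h0 : ι k ≠ 0 := neg_ne_zero.2 (mul_ne_zero Complex.I_ne_zero hk0)
  have hmaps : MapsTo ι {w | 0 ≤ w.im} {κ | 0 ≤ κ.re} := fun w hw => by
    change 0 ≤ (ι w).re
    rw [hι, neg_I_mul_re]; exact hw
  have hιd : DifferentiableAt ℂ ι k := by fun_prop
  have heq : ∀ᶠ w in 𝓝[{w : ℂ | 0 ≤ w.im}] k, jostF q w = jostKappa q (ι w) := by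
    filter_upwards [self_mem_nhdsWithin, mem_nhdsWithin_of_mem_nhds (isOpen_ne.mem_nhds hk0)]
      with w hw hw0
    exact jostF_eq hq hw hw0
  have hd : DifferentiableWithinAt ℂ (jostF q) {w | 0 ≤ w.im} k :=
    ((differentiableWithinAt_jostKappa hq h0 hκ).comp k hιd.differentiableWithinAt
      hmaps).congr_of_eventuallyEq heq (jostF_eq hq hk hk0)
  refine ⟨hd, norm_derivWithin_le_of_eventually hk hd ?_⟩
  have hnorm : ‖ι k‖ = ‖k‖ := by rw [hι, norm_neg, norm_mul, Complex.norm_I, one_mul]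
  have ht : Tendsto ι (𝓝[{w | 0 ≤ w.im}] k) (𝓝[{κ | 0 ≤ κ.re}] (ι k)) :=
    hιd.continuousAt.continuousWithinAt.tendsto_nhdsWithin hmaps
  filter_upwards [heq, ht.eventually (norm_jostKappa_sub_le hq h0 hκ)] with w hw1 hw2
  rw [hw1, jostF_eq hq hk hk0]
  refine hw2.trans (le_of_eq ?_)
  have : ι w - ι k = -(Complex.I * (w - k)) := by simp only [hι]; ring
  rw [hnorm, this, norm_neg, norm_mul, Complex.norm_I, one_mul]
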